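/- Conventions. A matrix ordered operator space is an operator space $E$ (norms on all $\mathcal M_n(E)$, $n\in\mathbb N$, satisfying Ruan's axioms) with a completely isometric conjugate-linear involution, together with norm-closed convex cones $P_n\subseteq \mathcal M_n(E)_h$ of "positive" elements such that $P_n\cap -P_n=\{0\}$ and $AP_nA^*\subseteq P_m$ for all scalar matrices $A\in\mathcal M_{m,n}$. A linear map $\phi$ between such spaces is completely contractive if $\|\phi_n\|\le 1$ for all $n\in\mathbb N$, completely isometric if every $\phi_n$ is isometric, and completely positive if it preserves the involution and every $\phi_n$ maps positive elements to positive elements; a complete order isomorphism is a completely positive linear bijection with completely positive inverse. For a nonzero, possibly infinite, cardinal $n$, $\mathcal M_n=B(H_n)$ with $\dim H_n=n$, with its weak* topology. The partial unitization $E^\sharp$ is the space $E\oplus\mathbb C$ with unit $(0,1)$, in which $(x,\alpha)\in\mathcal M_n(E)_h\oplus(\mathcal M_n)_h$ is positive if and only if $\alpha\ge 0$ and $\phi_n(\alpha_\epsilon^{-1/2}x\,\alpha_\epsilon^{-1/2})\ge -1$ for all $\epsilon>0$ and all completely contractive and completely positive maps $\phi:E\to\mathcal M_n$, where $\alpha_\epsilon=\alpha+\epsilon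 1_n$; for $x\in\mathcal M_n(E^\sharp)$, $\|x\|$ is the infimum of all $\alpha>0$ for which $\begin{pmatrix}\alpha 1_n & x\\ x^* & \alpha 1_n\end{pmatrix}$ is positive. An operator system (possibly nonunital) is a complete matrix ordered operator space $S$ for which the inclusion $S\to S^\sharp$, $s\mapsto(s,0)$, is completely isometric. For a complete operator space $V$, identify $\mathcal M_n(V^*)$ with the space $\mathrm{CB}(V,\mathcal M_n)$ of completely bounded maps, with the point-weak* topology. A compact nc convex set over $V^*$ is a graded set $K=\bigsqcup_n K_n$, over the nonzero cardinals $n$, with $K_n\subseteq\mathcal M_n(V^*)$ compact, such that $\sum\alpha_ix_i\alpha_i^*\in K_n$ for all bounded families $x_i\in K_{n_i}$ and all isometries $\alpha_i\in\mathcal M_{n,n_i}$ with $\sum\alpha_i\alpha_i^*=1_n$, and $\beta^*x\beta\in K_m$ for all $x\in K_n$ and all isometries $\beta\in\mathcal M_{n,m}$. A continuous affine nc map between such sets is a graded map that respects these direct sums and compressions and is point-weak* continuous on each $K_n$. Continuous affine nc functions $K\to\mathcal M=\bigsqcup_n\mathcal M_n$ are defined in the same way; they form the space $\mathrm A(K)$,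 with unit the function with value $1_n$ on $K_n$, the pointwise involution, the uniform norms $\|a\|=\sup_{x\in K}\|a(x)\|$ for $a\in\mathcal M_k(\mathrm A(K))$, and the pointwise positive elements of $\mathcal M_k(\mathrm A(K))$. For $z\in K_1$, $\mathrm A(K,z)\subseteq\mathrm A(K)$ is the subspace of all $a$ with $a(z)=0$, with the inherited structure. The pair $(K,z)$ is a pointed compact nc convex set if every completely contractive and completely positive map $\mathrm A(K,z)\to\mathcal M_n$, for every $n$, is evaluation at a point of $K_n$. The nc quasistate space of an operator system $S$ is the pair $(K,z)$, where $K_n$ is the set of completely contractive and completely positive maps $S\to\mathcal M_n$ and $z\in K_1$ is the zero map; for $x\in K_n$ let $x^\sharp:S^\sharp\to\mathcal M_n$, $x^\sharp(s,\alpha)=x(s)+\alpha 1_n$. Theorem. Let $S$ be an operator system with nc quasistate space $(K,z)$. (1) For $s\in S^\sharp$ the formula $\hat s(x)=x^\sharp(s)$, $x\in K$, defines an element $\hat s$ of $\mathrm A(K)$, and $s\mapsto\hat s$ is a unital complete order isomorphism from $S^\sharp$ onto $\mathrm A(K)$. It restricts to a completely isometric complete order isomorphism from $S$ onto $\mathrm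 A(K,z)$. (2) $(K,z)$ is a pointed compact nc convex set. (3) Let $V$ be a complete operator space, $L$ a compact nc convex set over $V^*$ and $y\in L_1$. Then $(L,y)$ is a pointed compact nc convex set if and only if it is pointedly affinely homeomorphic to the nc quasistate space $(K',z')$ of some operator system, i.e. there is a bijective continuous affine nc map $L\to K'$ with continuous affine nc inverse that maps $y$ to $z'$. -/

import Mathlib

open scoped InnerProductSpace ComplexOrder Matrix.Norms.L2Operator

universe u v w

noncomputable section

namespace NCDuality

/-! ### Matrix norms, matrix cones, operator spaces -/

/-- The data of a norm on each space `M_n(E)` of square matrices over `E`. The axioms are stated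
separately, in `IsOperatorSpace`. -/
class MatrixNorm (E : Type*) where
  /-- the norm on `M_n(E)` -/
  matNorm : (n : ℕ) → Matrix (Fin n) (Fin n) E → ℝ

/-- The data of a set of positive elements in each `M_n(E)`. The axioms are stated separately,
in `IsMatrixCone`. -/
class MatrixCone (E : Type*) where
  /-- the positive elements of `M_n(E)` -/
  cone : (n : ℕ) → Set (Matrix (Fin n) (Fin n) E)

open MatrixNorm MatrixCone

/-- The product `A x B` of a matrix `x` over `E` with scalar matrices `A` and `B`. -/
def scalarMul {E : Type*} [AddCommGroup E] [Module ℂ E] {m n p : ℕ}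
    (A : Matrix (Fin m) (Fin n) ℂ) (x : Matrix (Fin n) (Fin n) E)
    (B : Matrix (Fin n) (Fin p) ℂ) : Matrix (Fin m) (Fin p) E :=
  fun i j => ∑ k, ∑ l, (A i k * B l j) • x k l

/-- The block matrix `[[a, b], [c, d]]` as an element of `M_{m+n}(E)`. -/
def block {E : Type*} {m n : ℕ} (a : Matrix (Fin m) (Fin m) E) (b : Matrix (Fin m) (Fin n) E)
    (c : Matrix (Fin n) (Fin m) E) (d : Matrix (Fin n) (Fin n) E) :
    Matrix (Fin (m + n)) (Fin (m + n)) E :=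
  Matrix.reindex finSumFinEquiv finSumFinEquiv (Matrix.fromBlocks a b c d)

/-- Ruan's axioms: each `matNorm n` is a norm on `M_n(E)`, and the norms satisfy
`‖x ⊕ y‖ = max ‖x‖ ‖y‖` and `‖A x B‖ ≤ ‖A‖ ‖x‖ ‖B‖` (operator norms of scalar matrices). -/
structure IsOperatorSpace (E : Type*) [AddCommGroup E] [Module ℂ E] [MatrixNorm E] : Prop where
  eq_zero_iff : ∀ (n : ℕ) (x : Matrix (Fin n) (Fin n) E), matNorm n x = 0 ↔ x = 0
  add_le : ∀ (n : ℕ) (x y : Matrix (Fin n) (Fin n) E),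
    matNorm n (x + y) ≤ matNorm n x + matNorm n y
  smul_eq : ∀ (n : ℕ) (c : ℂ) (x : Matrix (Fin n) (Fin n) E),
    matNorm n (c • x) = ‖c‖ * matNorm n x
  directSum : ∀ (m n : ℕ) (x : Matrix (Fin m) (Fin m) E) (y : Matrix (Fin n) (Fin n) E),
    matNorm (m + n) (block x 0 0 y) = max (matNorm m x) (matNorm n y)
  scalarMul_le : ∀ (m n : ℕ) (A : Matrix (Fin m) (Fin n) ℂ) (x : Matrix (Fin n) (Fin n) E)
    (B : Matrix (Fin n) (Fin m) ℂ), matNorm m (scalarMul A x B) ≤ ‖A‖ * matNorm n x * ‖B‖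

/-- Completeness of `E` in the norm of `M_1(E) = E`: every Cauchy sequence converges. -/
def IsNormComplete (E : Type*) [AddCommGroup E] [MatrixNorm E] : Prop :=
  ∀ f : ℕ → E,
    (∀ ε > 0, ∃ N, ∀ m ≥ N, ∀ n ≥ N, matNorm 1 (fun _ _ : Fin 1 => f m - f n) < ε) →
    ∃ x : E, ∀ ε > 0, ∃ N, ∀ n ≥ N, matNorm 1 (fun _ _ : Fin 1 => f n - x) < ε

/-- The axioms of a matrix cone: norm-closed cones of self-adjoint matrices with
`P_n ∩ -P_n = {0}` and `A P_n A^* ⊆ P_m`. -/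
structure IsMatrixCone (E : Type*) [AddCommGroup E] [Module ℂ E] [Star E]
    [MatrixNorm E] [MatrixCone E] : Prop where
  selfAdjoint : ∀ (n : ℕ), ∀ x ∈ cone (E := E) n, x.conjTranspose = x
  add_mem : ∀ (n : ℕ), ∀ x ∈ cone (E := E) n, ∀ y ∈ cone (E := E) n, x + y ∈ cone (E := E) n
  closed : ∀ (n : ℕ) (x : Matrix (Fin n) (Fin n) E),
    (∀ ε > 0, ∃ y ∈ cone (E := E) n, matNorm n (x - y) < ε) → x ∈ cone (E := E) n
  inter_neg : ∀ (n : ℕ) (x : Matrix (Fin n) (Fin n) E),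
    (x ∈ cone (E := E) n ∧ -x ∈ cone (E := E) n) ↔ x = 0
  conj_mem : ∀ (m n : ℕ) (A : Matrix (Fin m) (Fin n) ℂ), ∀ x ∈ cone (E := E) n,
    scalarMul A x A.conjTranspose ∈ cone (E := E) m

/-- A complete matrix ordered operator space: a complete self-adjoint operator space (so that the
involution is completely isometric) together with a matrix cone. -/
structure IsCompleteMatrixOrdered (E : Type*) [AddCommGroup E] [Module ℂ E] [StarAddMonoid E]
    [StarModule ℂ E] [MatrixNorm E] [MatrixCone E] : Prop where
  operatorSpace : IsOperatorSpace E
  star_isometric : ∀ (n : ℕ) (x : Matrix (Fin n) (Fin n) E),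
    matNorm n x.conjTranspose = matNorm n x
  complete : IsNormComplete E
  matrixCone : IsMatrixCone E

/-! ### Maps -/

section Maps

variable {E F : Type*} [AddCommGroup E] [Module ℂ E] [AddCommGroup F] [Module ℂ F]

/-- `‖φ_n‖ ≤ C` for all `n`. -/
def CBBound [MatrixNorm E] [MatrixNorm F] (C : ℝ) (φ : E →ₗ[ℂ] F) : Prop :=
  ∀ (n : ℕ) (x : Matrix (Fin n) (Fin n) E), matNorm n (x.map φ) ≤ C * matNorm n x

/-- Completely bounded linear maps. -/
def IsCompletelyBounded [MatrixNorm E] [MatrixNorm F] (φ : E →ₗ[ℂ] F) : Prop :=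
  ∃ C : ℝ, CBBound C φ

/-- Completely contractive linear maps. -/
def IsCompletelyContractive [MatrixNorm E] [MatrixNorm F] (φ : E →ₗ[ℂ] F) : Prop :=
  CBBound 1 φ

/-- Completely isometric linear maps. -/
def IsCompletelyIsometric [MatrixNorm E] [MatrixNorm F] (φ : E →ₗ[ℂ] F) : Prop :=
  ∀ (n : ℕ) (x : Matrix (Fin n) (Fin n) E), matNorm n (x.map φ) = matNorm n x

/-- Completely positive linear maps. As usual, these preserve the involution; this is not automatic
when `E` is not spanned by its positive elements. -/
structure IsCompletelyPositive [Star E] [Star F] [MatrixCone E] [MatrixCone F]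
    (φ : E →ₗ[ℂ] F) : Prop where
  map_star : ∀ x : E, φ (star x) = star (φ x)
  map_cone : ∀ (n : ℕ), ∀ x ∈ cone (E := E) n, x.map φ ∈ cone (E := F) n

/-- A complete order isomorphism is completely positive with completely positive inverse. -/
def IsCompleteOrderIso [Star E] [Star F] [MatrixCone E] [MatrixCone F] (e : E ≃ₗ[ℂ] F) : Prop :=
  IsCompletelyPositive (e : E →ₗ[ℂ] F) ∧ IsCompletelyPositive (e.symm : F →ₗ[ℂ] E)

/-- Completely contractive and completely positive maps. -/
def IsCCP [Star E] [Star F] [MatrixNorm E] [MatrixNorm F] [MatrixCone E] [MatrixCone F]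
    (φ : E →ₗ[ℂ] F) : Prop :=
  IsCompletelyContractive φ ∧ IsCompletelyPositive φ

end Maps

/-! ### Bounded operators on a Hilbert space -/

section Operators

variable {H : Type*} [NormedAddCommGroup H] [InnerProductSpace ℂ H]

/-- A matrix `[T_ij]` of operators on `H`, as an operator on the Hilbert space direct sum `H^m`. -/
def blockOp {m : ℕ} (T : Matrix (Fin m) (Fin m) (H →L[ℂ] H)) :
    PiLp 2 (fun _ : Fin m => H) →L[ℂ] PiLp 2 (fun _ : Fin m => H) :=
  (PiLp.continuousLinearEquiv 2 ℂ (fun _ : Fin m => H)).symm.toContinuousLinearMap ∘L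
    ContinuousLinearMap.pi (fun i => ∑ j, T i j ∘L PiLp.proj 2 (fun _ : Fin m => H) j)

/-- The norm of `M_m(B(H)) = B(H^m)`. -/
instance : MatrixNorm (H →L[ℂ] H) where
  matNorm _ T := ‖blockOp T‖

/-- The positive operators in `M_m(B(H)) = B(H^m)`. -/
instance : MatrixCone (H →L[ℂ] H) where
  cone _ := {T | (blockOp T).IsPositive}

/-- The weak* continuous functional `T ↦ ∑ k, ⟪ξ k, T (η k)⟫` on `B(H)` given by two square summable
sequences in `H`. -/
def normalFunctional (ξ η : lp (fun _ : ℕ => H) 2) (T : H →L[ℂ] H) : ℂ :=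
  ∑' k, ⟪ξ k, T (η k)⟫_ℂ

/-- The weak* (ultraweak) topology of `B(H)`. -/
abbrev weakStarTopology (H : Type*) [NormedAddCommGroup H] [InnerProductSpace ℂ H] :
    TopologicalSpace (H →L[ℂ] H) :=
  ⨅ (ξ : lp (fun _ : ℕ => H) 2) (η : lp (fun _ : ℕ => H) 2),
    TopologicalSpace.induced (normalFunctional ξ η) inferInstance

/-- `∑ i, T i = S` (unconditionally) in the weak* topology of `B(H)`. -/
def WeakStarHasSum {I : Type*} (T : I → (H →L[ℂ] H)) (S : H →L[ℂ] H) : Prop :=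
  ∀ ξ η : lp (fun _ : ℕ => H) 2,
    HasSum (fun i => normalFunctional ξ η (T i)) (normalFunctional ξ η S)

variable {G : Type*} [NormedAddCommGroup G] [InnerProductSpace ℂ G]
variable [CompleteSpace G] [CompleteSpace H]

/-- `T ↦ α^* T α` for an isometry `α : G → H`. -/
def compress (α : G →ₗᵢ[ℂ] H) : (H →L[ℂ] H) →ₗ[ℂ] (G →L[ℂ] G) where
  toFun T := ContinuousLinearMap.adjoint α.toContinuousLinearMap ∘L T ∘L α.toContinuousLinearMap
  map_add' S T := by ext; simp
  map_smul' c T := by ext; simp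

/-- `T ↦ α T α^*` for an isometry `α : G → H`. -/
def expand (α : G →ₗᵢ[ℂ] H) : (G →L[ℂ] G) →ₗ[ℂ] (H →L[ℂ] H) where
  toFun T := α.toContinuousLinearMap ∘L T ∘L ContinuousLinearMap.adjoint α.toContinuousLinearMap
  map_add' S T := by ext; simp
  map_smul' c T := by ext; simp

end Operators

/-! ### The partial unitization and operator systems -/

section Unitization

/-- The `n × n` matrix `1_n ⊗ e`. -/
def diagUnit {E : Type*} [Zero E] (e : E) (n : ℕ) : Matrix (Fin n) (Fin n) E :=
  Matrix.diagonal (fun _ => e)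

/-- The norm on `M_n(E)` induced by an order unit `e`:
`inf {α > 0 : [[α (1_n ⊗ e), x], [x^*, α (1_n ⊗ e)]] ≥ 0}`. -/
def orderUnitNorm {E : Type*} [AddCommGroup E] [Module ℂ E] [Star E] [MatrixCone E] (e : E)
    (n : ℕ) (x : Matrix (Fin n) (Fin n) E) : ℝ :=
  sInf {α : ℝ | 0 < α ∧
    block ((α : ℂ) • diagUnit e n) x x.conjTranspose ((α : ℂ) • diagUnit e n)
      ∈ cone (E := E) (n + n)}

/-- `α ↦ α^{-1/2}` for a positive definite matrix `α`, by functional calculus. -/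
def invSqrt {n : ℕ} (α : Matrix (Fin n) (Fin n) ℂ) : Matrix (Fin n) (Fin n) ℂ :=
  cfc (fun t : ℝ => (Real.sqrt t)⁻¹) α

variable {E : Type*} [AddCommGroup E] [Module ℂ E] [StarAddMonoid E] [StarModule ℂ E]
  [MatrixNorm E] [MatrixCone E]

/-- The matrix cone of the partial unitization `E^♯ = E ⊕ ℂ`: the pairs `(x, α)` with `x` and `α`
self-adjoint, `α ≥ 0`, and `φ_n(α_ε^{-1/2} x α_ε^{-1/2}) ≥ -1` for all `ε > 0` and all completely
contractive and completely positive `φ : E → M_n`, where `α_ε = α + ε 1_n`. The vector space with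
involution `E ⊕ ℂ` and its element `(0, 1)` are those of Mathlib's `Unitization ℂ E`. -/
instance : MatrixCone (Unitization ℂ E) where
  cone n := {s | (s.map (fun t => t.snd)).conjTranspose = s.map (fun t => t.snd) ∧
    (s.map (fun t => t.fst)).PosSemidef ∧
    ∀ ε : ℝ, 0 < ε →
      ∀ φ : E →ₗ[ℂ] (EuclideanSpace ℂ (Fin n) →L[ℂ] EuclideanSpace ℂ (Fin n)), IsCCP φ →
        (scalarMul (invSqrt (s.map (fun t => t.fst) + (ε : ℂ) • 1)) (s.map (fun t => t.snd))
            (invSqrt (s.map (fun t => t.fst) + (ε : ℂ) • 1))).map φ + 1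
          ∈ cone (E := EuclideanSpace ℂ (Fin n) →L[ℂ] EuclideanSpace ℂ (Fin n)) n}

/-- The norm of the partial unitization is the one induced by its unit. -/
instance : MatrixNorm (Unitization ℂ E) where
  matNorm := orderUnitNorm (1 : Unitization ℂ E)

/-- The canonical inclusion `E → E^♯`. -/
def inclusion (E : Type*) [AddCommGroup E] [Module ℂ E] : E →ₗ[ℂ] Unitization ℂ E :=
  Unitization.inrHom ℂ ℂ E

/-- A (possibly nonunital) operator system: a complete matrix ordered operator space for which the
canonical inclusion into the partial unitization is completely isometric. -/
structure IsOperatorSystem (S : Type*) [AddCommGroup S] [Module ℂ S] [StarAddMonoid S]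
    [StarModule ℂ S] [MatrixNorm S] [MatrixCone S] : Prop where
  completeMatrixOrdered : IsCompleteMatrixOrdered S
  inclusion_isometric : IsCompletelyIsometric (inclusion S)

end Unitization

/-! ### Noncommutative convex sets -/

/-- The nonzero dimensions: nonempty index types (the cardinal `n` is represented by the sets with
`n` elements). -/
abbrev Dim : Type (w + 1) := {n : Type w // Nonempty n}

/-- The dimension `1`. -/
def Dim.one : Dim.{w} := ⟨PUnit, ⟨PUnit.unit⟩⟩

/-- The Hilbert space `H_n = ℓ²(n)` of dimension `n`. -/
abbrev HSpace (n : Dim.{w}) : Type w := lp (fun _ : n.1 => ℂ) 2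

/-- The algebra `M_n = B(H_n)`. -/
abbrev Mat (n : Dim.{w}) : Type w := HSpace n →L[ℂ] HSpace n

/-- Graded sets `K = ⊔ K_n` of linear maps `V → M_n`. For an operator space `V`, the completely
bounded maps `V → M_n` are the elements of `M_n(V^*) = CB(V, M_n)`, the `n × n` matrices over the
dual operator space `V^*`. -/
abbrev NCSet (V : Type v) [AddCommGroup V] [Module ℂ V] : Type (max v (w + 1)) :=
  ∀ n : Dim.{w}, Set (V →ₗ[ℂ] Mat n)

section NCConvex

variable {V : Type v} [AddCommGroup V] [Module ℂ V]

/-- The point-weak* topology on maps `V → M_n`. -/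
abbrev pointWeakStar (V : Type v) [AddCommGroup V] [Module ℂ V] (n : Dim.{w}) :
    TopologicalSpace (V →ₗ[ℂ] Mat n) :=
  ⨅ s : V, TopologicalSpace.induced (fun φ => φ s) (weakStarTopology (HSpace n))

/-- The point-weak* topology on the graded component `K_n`. -/
abbrev levelTopology (K : NCSet.{v, w} V) (n : Dim.{w}) : TopologicalSpace (K n) :=
  TopologicalSpace.induced Subtype.val (pointWeakStar V n)

/-- `∑ i, α_i α_i^* = 1_n`. -/
def IsDecomposition {I : Type w} {m : I → Dim.{w}} {n : Dim.{w}}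
    (α : ∀ i, HSpace (m i) →ₗᵢ[ℂ] HSpace n) : Prop :=
  WeakStarHasSum (fun i => expand (α i) 1) 1

/-- `∑ i, α_i x_i α_i^* = y`, where the sum converges in the point-weak* topology. -/
def IsDirectSum {I : Type w} {m : I → Dim.{w}} {n : Dim.{w}}
    (α : ∀ i, HSpace (m i) →ₗᵢ[ℂ] HSpace n) (x : ∀ i, V →ₗ[ℂ] Mat (m i)) (y : V →ₗ[ℂ] Mat n) :
    Prop :=
  ∀ s : V, WeakStarHasSum (fun i => expand (α i) (x i s)) (y s)

/-- Compact nc convex sets over the dual operator space `V^*`: graded subsets of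
`⊔ M_n(V^*) = ⊔ CB(V, M_n)` which are closed under direct sums of bounded families and under
compressions by isometries, and whose graded components are point-weak* compact. -/
structure IsCompactNCConvex [MatrixNorm V] (K : NCSet.{v, w} V) : Prop where
  completelyBounded : ∀ n, ∀ x ∈ K n, IsCompletelyBounded x
  directSum : ∀ (I : Type w) (m : I → Dim.{w}) (n : Dim.{w})
    (α : ∀ i, HSpace (m i) →ₗᵢ[ℂ] HSpace n) (x : ∀ i, V →ₗ[ℂ] Mat (m i)) (y : V →ₗ[ℂ] Mat n),
    (∀ i, x i ∈ K (m i)) → (∃ C : ℝ, ∀ i, CBBound C (x i)) → IsDecomposition α →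
    IsDirectSum α x y → y ∈ K n
  compression : ∀ (m n : Dim.{w}) (β : HSpace m →ₗᵢ[ℂ] HSpace n), ∀ x ∈ K n,
    compress β ∘ₗ x ∈ K m
  compact : ∀ n, @IsCompact _ (pointWeakStar V n) (K n)

/-! ### Affine nc maps and functions -/

/-- Continuous affine nc maps `θ : K → L`: graded maps which respect direct sums of bounded
families, are equivariant with respect to isometries, and are continuous on each component. -/
structure IsContinuousAffineNCMap [MatrixNorm V] {W : Type*} [AddCommGroup W] [Module ℂ W]
    (K : NCSet.{v, w} V) (L : ∀ n : Dim.{w}, Set (W →ₗ[ℂ] Mat n)) (θ : ∀ n, K n → L n) :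
    Prop where
  directSum : ∀ (I : Type w) (m : I → Dim.{w}) (n : Dim.{w})
    (α : ∀ i, HSpace (m i) →ₗᵢ[ℂ] HSpace n) (x : ∀ i, K (m i)) (y : K n),
    (∃ C : ℝ, ∀ i, CBBound C (x i).1) → IsDecomposition α → IsDirectSum α (fun i => (x i).1) y.1 →
    IsDirectSum α (fun i => (θ (m i) (x i)).1) (θ n y).1
  isometry : ∀ (m n : Dim.{w}) (β : HSpace m →ₗᵢ[ℂ] HSpace n) (x : K n) (y : K m),
    y.1 = compress β ∘ₗ x.1 → (θ m y).1 = compress β ∘ₗ (θ n x).1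
  continuous : ∀ n, @Continuous _ _ (levelTopology K n) (levelTopology L n) (θ n)

/-- `(K, z)` and `(L, w)` are pointedly affinely homeomorphic. -/
def PointedlyAffinelyHomeomorphic [MatrixNorm V] {W : Type*} [AddCommGroup W] [Module ℂ W]
    [MatrixNorm W] (K : NCSet.{v, w} V) (z : K Dim.one)
    (L : ∀ n : Dim.{w}, Set (W →ₗ[ℂ] Mat n)) (w : L Dim.one) : Prop :=
  ∃ θ : ∀ n, K n ≃ L n,
    IsContinuousAffineNCMap K L (fun n => θ n) ∧
    IsContinuousAffineNCMap L K (fun n => (θ n).symm) ∧ θ Dim.one z = w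

/-- Continuous affine nc functions `a : K → M`. -/
structure IsContinuousAffineNCFun [MatrixNorm V] (K : NCSet.{v, w} V) (a : ∀ n, K n → Mat n) :
    Prop where
  directSum : ∀ (I : Type w) (m : I → Dim.{w}) (n : Dim.{w})
    (α : ∀ i, HSpace (m i) →ₗᵢ[ℂ] HSpace n) (x : ∀ i, K (m i)) (y : K n),
    (∃ C : ℝ, ∀ i, CBBound C (x i).1) → IsDecomposition α → IsDirectSum α (fun i => (x i).1) y.1 →
    WeakStarHasSum (fun i => expand (α i) (a (m i) (x i))) (a n y)
  isometry : ∀ (m n : Dim.{w}) (β : HSpace m →ₗᵢ[ℂ] HSpace n) (x : K n) (y : K m),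
    y.1 = compress β ∘ₗ x.1 → a m y = compress β (a n x)
  continuous : ∀ n, @Continuous _ _ (levelTopology K n) (weakStarTopology (HSpace n)) (a n)

end NCConvex

/-! ### Helper facts on the weak* topology -/

section Helpers

variable {H : Type*} [NormedAddCommGroup H] [InnerProductSpace ℂ H]

theorem summable_normal (ξ η : lp (fun _ : ℕ => H) 2) (T : H →L[ℂ] H) :
    Summable (fun k => ⟪ξ k, T (η k)⟫_ℂ) := by
  have h : Summable (fun k => ‖ξ k‖ * ‖η k‖) :=
    lp.summable_mul (by rw [Real.holderConjugate_iff]; norm_num) ξ η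
  refine Summable.of_norm_bounded (h.mul_left ‖T‖) fun k => ?_
  calc ‖⟪ξ k, T (η k)⟫_ℂ‖ ≤ ‖ξ k‖ * ‖T (η k)‖ := norm_inner_le_norm _ _
    _ ≤ ‖ξ k‖ * (‖T‖ * ‖η k‖) := by gcongr; exact T.le_opNorm _
    _ = ‖T‖ * (‖ξ k‖ * ‖η k‖) := by ring

theorem normal_add (ξ η : lp (fun _ : ℕ => H) 2) (S T : H →L[ℂ] H) :
    normalFunctional ξ η (S + T) = normalFunctional ξ η S + normalFunctional ξ η T := by
  simp only [normalFunctional, _root_.add_apply, inner_add_right]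
  exact (summable_normal ξ η S).tsum_add (summable_normal ξ η T)

theorem normal_smul (ξ η : lp (fun _ : ℕ => H) 2) (c : ℂ) (T : H →L[ℂ] H) :
    normalFunctional ξ η (c • T) = c * normalFunctional ξ η T := by
  simp only [normalFunctional, _root_.smul_apply, inner_smul_right, tsum_mul_left]

theorem normal_zero (ξ η : lp (fun _ : ℕ => H) 2) :
    normalFunctional ξ η (0 : H →L[ℂ] H) = 0 := by
  simp [normalFunctional]

theorem normal_star [CompleteSpace H] (ξ η : lp (fun _ : ℕ => H) 2) (T : H →L[ℂ] H) :
    normalFunctional ξ η (star T) = star (normalFunctional η ξ T) := by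
  unfold normalFunctional
  rw [tsum_star]
  refine tsum_congr fun k => ?_
  rw [ContinuousLinearMap.star_eq_adjoint, ContinuousLinearMap.adjoint_inner_right]
  exact (inner_conj_symm _ _).symm

theorem continuous_weakStar_iff {X : Type*} {t : TopologicalSpace X} {f : X → (H →L[ℂ] H)} :
    @Continuous _ _ t (weakStarTopology H) f ↔
      ∀ ξ η : lp (fun _ : ℕ => H) 2, @Continuous _ _ t inferInstance (fun x => normalFunctional ξ η (f x)) := by
  refine continuous_iInf_rng.trans (forall_congr' fun ξ => ?_)
  exact continuous_iInf_rng.trans (forall_congr' fun η => continuous_induced_rng)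

variable {G : Type*} [NormedAddCommGroup G] [InnerProductSpace ℂ G]
variable [CompleteSpace G] [CompleteSpace H]

theorem expand_star (α : G →ₗᵢ[ℂ] H) (T : G →L[ℂ] G) :
    expand α (star T) = star (expand α T) := by
  simp [expand, ContinuousLinearMap.star_eq_adjoint, ContinuousLinearMap.adjoint_comp,
    ContinuousLinearMap.comp_assoc]

theorem compress_star (α : G →ₗᵢ[ℂ] H) (T : H →L[ℂ] H) :
    compress α (star T) = star (compress α T) := by
  simp [compress, ContinuousLinearMap.star_eq_adjoint, ContinuousLinearMap.adjoint_comp,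
    ContinuousLinearMap.comp_assoc]

theorem compress_one (α : G →ₗᵢ[ℂ] H) : compress α (1 : H →L[ℂ] H) = 1 := by
  refine ContinuousLinearMap.ext fun x => ext_inner_left ℂ fun y => ?_
  simp [compress, ContinuousLinearMap.adjoint_inner_right]

end Helpers

/-! ### The function systems `A(K)` and `A(K, z)` -/

section FunctionSystems

variable {V : Type v} [AddCommGroup V] [Module ℂ V] [MatrixNorm V]

theorem IsContinuousAffineNCFun.star {K : NCSet.{v, w} V} {a : ∀ n, K n → Mat n}
    (ha : IsContinuousAffineNCFun K a) : IsContinuousAffineNCFun K (star a) where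
  directSum I m n α x y hC hα hs ξ η := by
    have h := (ha.directSum I m n α x y hC hα hs η ξ).star
    simpa only [Pi.star_apply, expand_star, normal_star] using h
  isometry m n β x y h := by
    simp only [Pi.star_apply, compress_star, ha.isometry m n β x y h]
  continuous n := by
    refine continuous_weakStar_iff.2 fun ξ η => ?_
    simp only [Pi.star_apply, normal_star]
    let _ := levelTopology K n
    exact (continuous_weakStar_iff.1 (ha.continuous n) η ξ).star

/-- The space `A(K)` of continuous affine nc functions on `K`. -/
def A (K : NCSet.{v, w} V) : Submodule ℂ (∀ n : Dim.{w}, K n → Mat n) where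
  carrier := {a | IsContinuousAffineNCFun K a}
  zero_mem' :=
    { directSum := fun I m n α x y _ _ _ ξ η => by
        simp [normal_zero, hasSum_zero]
      isometry := fun m n β x y _ => by simp
      continuous := fun n => continuous_weakStar_iff.2 fun ξ η =>
        @continuous_const _ _ (levelTopology K n) _ (normalFunctional ξ η 0) }
  add_mem' := fun {a b} ha hb =>
    { directSum := fun I m n α x y hC hα hs ξ η => by
        simpa only [Pi.add_apply, map_add, normal_add] using
          (ha.directSum I m n α x y hC hα hs ξ η).add (hb.directSum I m n α x y hC hα hs ξ η)
      isometry := fun m n β x y h => by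
        simp only [Pi.add_apply, map_add, ha.isometry m n β x y h, hb.isometry m n β x y h]
      continuous := fun n => continuous_weakStar_iff.2 fun ξ η => by
        simp only [Pi.add_apply, normal_add]
        let _ := levelTopology K n
        exact (continuous_weakStar_iff.1 (ha.continuous n) ξ η).add
          (continuous_weakStar_iff.1 (hb.continuous n) ξ η) }
  smul_mem' := fun c a ha =>
    { directSum := fun I m n α x y hC hα hs ξ η => by
        simpa only [Pi.smul_apply, map_smul, normal_smul] using
          (ha.directSum I m n α x y hC hα hs ξ η).mul_left c
      isometry := fun m n β x y h => by
        simp only [Pi.smul_apply, map_smul, ha.isometry m n β x y h]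
      continuous := fun n => continuous_weakStar_iff.2 fun ξ η => by
        simp only [Pi.smul_apply, normal_smul]
        let _ := levelTopology K n
        exact continuous_const.mul (continuous_weakStar_iff.1 (ha.continuous n) ξ η) }

variable (K : NCSet.{v, w} V)

/-- The involution `a^*(x) = a(x)^*` of `A(K)`. -/
instance : StarAddMonoid (A K) where
  star a := ⟨star a.1, IsContinuousAffineNCFun.star a.2⟩
  star_involutive a := Subtype.ext (star_star a.1)
  star_add a b := Subtype.ext (star_add a.1 b.1)

instance : StarModule ℂ (A K) where
  star_smul c a := Subtype.ext (star_smul c a.1)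

/-- The unit of `A(K)` is the function with constant value `1_n` on `K_n`. -/
instance : One (A K) where
  one := ⟨fun _ _ => 1,
    { directSum := fun _ _ _ _ _ _ _ hα _ => hα
      isometry := fun _ _ β _ _ _ => (compress_one β).symm
      continuous := fun n => continuous_weakStar_iff.2 fun ξ η =>
        @continuous_const _ _ (levelTopology K n) _ (normalFunctional ξ η 1) }⟩

/-- The value `a(x) = [a_ij(x)]` in `M_k(M_n)` of a matrix `a` over `A(K)` at a point `x` of
`K_n`. -/
def evalMat {K : NCSet.{v, w} V} {k : ℕ} (a : Matrix (Fin k) (Fin k) (A K)) {n : Dim.{w}}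
    (x : K n) : Matrix (Fin k) (Fin k) (Mat n) :=
  a.map (fun f => f.1 n x)

/-- The norm of `M_k(A(K))` is the uniform norm `‖a‖ = sup {‖a(x)‖ : x ∈ K}`. -/
instance : MatrixNorm (A K) where
  matNorm k a := sSup {r : ℝ | ∃ (n : Dim.{w}) (x : K n), r = matNorm k (evalMat a x)}

/-- The positive elements of `M_k(A(K))` are the functions with positive values. -/
instance : MatrixCone (A K) where
  cone k := {a | ∀ (n : Dim.{w}) (x : K n), evalMat a x ∈ cone (E := Mat n) k}

variable {K}

/-- The space `A(K, z)` of pointed continuous affine nc functions on `K`, those with `a(z) = 0`. -/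
def APointed (K : NCSet.{v, w} V) (z : K Dim.one) :
    Submodule ℂ (∀ n : Dim.{w}, K n → Mat n) where
  carrier := {a | a ∈ A K ∧ a Dim.one z = 0}
  zero_mem' := ⟨(A K).zero_mem, rfl⟩
  add_mem' := fun ha hb => ⟨(A K).add_mem ha.1 hb.1, by simp [ha.2, hb.2]⟩
  smul_mem' := fun c _ ha => ⟨(A K).smul_mem c ha.1, by simp [ha.2]⟩

/-- The inclusion of `A(K, z)` in `A(K)`. -/
def APointed.toA {K : NCSet.{v, w} V} {z : K Dim.one} (a : APointed K z) : A K :=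
  ⟨a.1, a.2.1⟩

variable (z : K Dim.one)

instance : StarAddMonoid (APointed K z) where
  star a := ⟨star a.1, (star (APointed.toA a)).2, by simp [a.2.2]⟩
  star_involutive a := Subtype.ext (star_star a.1)
  star_add a b := Subtype.ext (star_add a.1 b.1)

instance : StarModule ℂ (APointed K z) where
  star_smul c a := Subtype.ext (star_smul c a.1)

/-- The matrix norms of `A(K, z)` are inherited from `A(K)`. -/
instance : MatrixNorm (APointed K z) where
  matNorm k a := matNorm k (a.map APointed.toA)

/-- The matrix cone of `A(K, z)` is inherited from `A(K)`. -/
instance : MatrixCone (APointed K z) where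
  cone k := {a | a.map APointed.toA ∈ cone (E := A K) k}

/-- `(K, z)` is a pointed compact nc convex set: `K` is a compact nc convex set, `z ∈ K_1`, and
every nc quasistate on `A(K, z)` is evaluation at a point of `K`. -/
structure IsPointedCompactNCConvex (K : NCSet.{v, w} V) (z : K Dim.one) : Prop where
  compactNCConvex : IsCompactNCConvex K
  quasistate_eq_eval : ∀ (n : Dim.{w}) (θ : APointed K z →ₗ[ℂ] Mat n),
    IsCCP θ →
    ∃ x : K n, ∀ a : APointed K z, θ a = a.1 n x

end FunctionSystems

/-! ### The nc quasistate space -/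

section Quasistates

variable (S : Type u) [AddCommGroup S] [Module ℂ S] [StarAddMonoid S] [MatrixNorm S]
  [MatrixCone S]

/-- The nc quasistate space `K = ⊔ K_n`, where `K_n` is the set of completely contractive and
completely positive maps `S → M_n`. -/
def quasistateSpace : NCSet.{u, w} S := fun _ => {φ | IsCCP φ}

theorem isCCP_zero (hS : IsOperatorSpace S) (n : Dim.{w}) : IsCCP (0 : S →ₗ[ℂ] Mat n) := by
  have h0 : ∀ k, blockOp (0 : Matrix (Fin k) (Fin k) (Mat n)) = 0 := fun k => by
    ext x i
    simp [blockOp]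
  have hmap : ∀ (k : ℕ) (x : Matrix (Fin k) (Fin k) S), x.map (0 : S →ₗ[ℂ] Mat n) = 0 :=
    fun k x => by ext i j : 2; rfl
  refine ⟨fun k x => ?_, ⟨fun x => by simp, fun k x _ => ?_⟩⟩
  · have hz : matNorm k (0 : Matrix (Fin k) (Fin k) S) = 0 := (hS.eq_zero_iff k 0).2 rfl
    have hneg : matNorm k (-x) = matNorm k x := by
      have := hS.smul_eq k (-1) x
      simpa using this
    have hle := hS.add_le k x (-x)
    rw [add_neg_cancel, hz, hneg] at hle
    rw [hmap]
    change ‖blockOp (0 : Matrix (Fin k) (Fin k) (Mat n))‖ ≤ _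
    rw [h0, norm_zero]
    linarith
  · rw [hmap]
    change (blockOp (0 : Matrix (Fin k) (Fin k) (Mat n))).IsPositive
    rw [h0]
    exact ContinuousLinearMap.isPositive_zero

variable {S}
variable [StarModule ℂ S]

/-- The distinguished point `z ∈ K_1` of the nc quasistate space: the zero map. -/
def zeroQuasistate (hS : IsOperatorSystem S) : quasistateSpace.{u, w} S Dim.one :=
  ⟨0, isCCP_zero S hS.completeMatrixOrdered.operatorSpace Dim.one⟩

/-- The unital extension `x^♯(s, α) = x(s) + α 1_n` of a map `x : S → M_n` to `S^♯`. -/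
def sharp {n : Dim.{w}} (x : S →ₗ[ℂ] Mat n) (s : Unitization ℂ S) : Mat n :=
  x s.snd + s.fst • 1

end Quasistates

end NCDuality

end

open NCDuality

/-! The nc quasistates, i.e. the completely contractive and completely positive (ccp) maps `S →
M_n`, see all of `S^♯`. In the definition of the cone, the conjugation by `α_ε^{-1/2}` can be undone
and `ε` sent to `0`. So `(x, α)` is positive exactly when it is self-adjoint and every unital
extension `φ^♯` sends it to a positive operator; the zero map accounts for `α ≥ 0`. A quadratic form
at `n` vectors involves only a compression to dimension at most `n`, so it does not matter which
dimensions are tested (`mem_cone_unitization_iff_forall_dim`). Hence `s ↦ ŝ` preserves and reflects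
order, and the order unit norm of `x ∈ M_n(S)` is the supremum of `‖φ_n(x)‖` over all quasistates.
Being an operator system means that the quasistates norm `S`.

Surjectivity is Kadison's argument. An nc function commutes with compression to a unit vector, so it
is determined by its scalar values on `K_1`, and the numerical radius bounds its norm up to a factor
`4`. On the compact convex set `K_1`, separating the graph of a continuous affine function from a
vertical translate gives uniform approximation by elements of `S` plus constants
(`exists_affine_approx`); for functions vanishing at `z` the constants can be dropped. The
approximants are Cauchy in `S`, and completeness supplies the limit (`exists_eq_eval`).

That pointwise positivity implies positivity in the given cone of `S` is a further Hahn-Banach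
argument: a functional on `M_n(S)` separating a matrix from the cone is, up to scaling, a ccp map `S
→ M_n` (`mem_cone_of_forall_isCCP`).

Given `S ≅ A(K, z)`, a quasistate of `A(K, z)` is one of `S`, hence a point of `K`. For the
characterization, `A(L, y)` is an operator system for every compact nc convex `L`; if `(L, y)` is
pointed, evaluation identifies `L` with its quasistate space. In the other direction, quasistates
are transported by pulling functions back along the homeomorphism.

One reduction is used throughout: equivariance under isometries already forces compatibility with
direct sums (`weakStarHasSum_of_equivariant`), because a direct sum is fixed by the unitaries `1 - 2
α_i α_i^*`. -/

namespace NCDuality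

open MatrixNorm MatrixCone

noncomputable section

set_option linter.unusedSectionVars false

/-! ### Operator matrices through their sesquilinear forms -/

section Sesq

variable {H : Type*} [NormedAddCommGroup H] [InnerProductSpace ℂ H] {ι κ : Type*}
  [Fintype ι] [Fintype κ] {m n : ℕ}

/-- The sesquilinear form `∑ ⟪ξ i, T i j (η j)⟫` of a matrix of operators. -/
def sesq (T : Matrix ι κ (H →L[ℂ] H)) (ξ : ι → H) (η : κ → H) : ℂ :=
  ∑ i, ∑ j, ⟪ξ i, T i j (η j)⟫_ℂ

/-- The squared norm of a finite family of vectors. -/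
def sqNorm (ξ : ι → H) : ℝ := ∑ i, ‖ξ i‖ ^ 2

theorem sqNorm_nonneg (ξ : ι → H) : 0 ≤ sqNorm ξ :=
  Finset.sum_nonneg fun _ _ => sq_nonneg _

theorem sqNorm_toLp (ξ : Fin m → H) : sqNorm ξ = ‖WithLp.toLp 2 ξ‖ ^ 2 := by
  rw [PiLp.norm_sq_eq_of_L2]; rfl

theorem inner_blockOp (T : Matrix (Fin m) (Fin m) (H →L[ℂ] H))
    (ξ η : PiLp 2 (fun _ : Fin m => H)) :
    ⟪ξ, blockOp T η⟫_ℂ = sesq T (fun i => ξ i) (fun i => η i) := by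
  simp [blockOp, sesq, PiLp.inner_apply, inner_sum]

theorem sesq_smul_right (T : Matrix ι κ (H →L[ℂ] H)) (c : ℂ) (ξ : ι → H) (η : κ → H) :
    sesq T ξ (c • η) = c * sesq T ξ η := by
  simp [sesq, Finset.mul_sum]

theorem sqNorm_smul (c : ℂ) (ξ : ι → H) : sqNorm (c • ξ) = ‖c‖ ^ 2 * sqNorm ξ := by
  simp [sqNorm, norm_smul, mul_pow, Finset.mul_sum]

theorem sesq_add (S T : Matrix ι κ (H →L[ℂ] H)) (ξ : ι → H) (η : κ → H) :
    sesq (S + T) ξ η = sesq S ξ η + sesq T ξ η := by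
  simp [sesq, Finset.sum_add_distrib]

theorem sesq_smul (c : ℂ) (T : Matrix ι κ (H →L[ℂ] H)) (ξ : ι → H) (η : κ → H) :
    sesq (c • T) ξ η = c * sesq T ξ η := by
  simp [sesq, Finset.mul_sum]

@[simp] theorem sesq_zero (ξ : ι → H) (η : κ → H) :
    sesq (0 : Matrix ι κ (H →L[ℂ] H)) ξ η = 0 := by
  simp [sesq]

@[simp] theorem sesq_zero_left (T : Matrix ι κ (H →L[ℂ] H)) (η : κ → H) : sesq T 0 η = 0 := by
  simp [sesq]

@[simp] theorem sesq_zero_right (T : Matrix ι κ (H →L[ℂ] H)) (ξ : ι → H) : sesq T ξ 0 = 0 := by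
  simp [sesq]

@[simp] theorem sqNorm_zero : sqNorm (0 : ι → H) = 0 := by simp [sqNorm]

theorem sesq_conjTranspose [CompleteSpace H] (T : Matrix ι κ (H →L[ℂ] H)) (ξ : κ → H)
    (η : ι → H) : sesq T.conjTranspose ξ η = star (sesq T η ξ) := by
  simp only [sesq, star_sum, Matrix.conjTranspose_apply, ContinuousLinearMap.star_eq_adjoint,
    ContinuousLinearMap.adjoint_inner_right]
  rw [Finset.sum_comm]
  exact Finset.sum_congr rfl fun i _ => Finset.sum_congr rfl fun j _ => (inner_conj_symm _ _).symm

theorem sesq_block (a : Matrix (Fin m) (Fin m) (H →L[ℂ] H)) (b : Matrix (Fin m) (Fin n) (H →L[ℂ] H))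
    (c : Matrix (Fin n) (Fin m) (H →L[ℂ] H)) (d : Matrix (Fin n) (Fin n) (H →L[ℂ] H))
    (ξ η : Fin (m + n) → H) :
    sesq (block a b c d) ξ η =
      sesq a (fun i => ξ (Fin.castAdd n i)) (fun i => η (Fin.castAdd n i)) +
      sesq b (fun i => ξ (Fin.castAdd n i)) (fun i => η (Fin.natAdd m i)) +
      (sesq c (fun i => ξ (Fin.natAdd m i)) (fun i => η (Fin.castAdd n i)) +
      sesq d (fun i => ξ (Fin.natAdd m i)) (fun i => η (Fin.natAdd m i))) := by
  simp [sesq, block, Fin.sum_univ_add, Finset.sum_add_distrib]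
  ring

theorem sqNorm_add_split (ξ : Fin (m + n) → H) : sqNorm ξ =
    sqNorm (fun i => ξ (Fin.castAdd n i)) + sqNorm (fun i => ξ (Fin.natAdd m i)) := by
  simp [sqNorm, Fin.sum_univ_add]

theorem mem_cone_iff_sesq (T : Matrix (Fin m) (Fin m) (H →L[ℂ] H)) :
    T ∈ cone (E := H →L[ℂ] H) m ↔ ∀ ξ : Fin m → H, 0 ≤ sesq T ξ ξ := by
  change (blockOp T).IsPositive ↔ _
  constructor
  · intro h ξ
    have := h.inner_nonneg_right (WithLp.toLp 2 ξ)
    rwa [inner_blockOp] at this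
  · intro h
    have h' : ∀ x, 0 ≤ ⟪x, blockOp T x⟫_ℂ := fun x => by rw [inner_blockOp]; exact h _
    rw [ContinuousLinearMap.isPositive_iff_complex]
    intro x
    obtain ⟨h2, h3⟩ := Complex.le_def.1 (h' x)
    rw [← inner_conj_symm (blockOp T x) x]
    refine ⟨?_, by rw [RCLike.conj_re]; exact h2⟩
    apply Complex.ext
    · simp only [RCLike.re_to_complex, Complex.ofReal_re]
    · rw [Complex.ofReal_im, Complex.conj_im, ← h3, Complex.zero_im, neg_zero]

theorem matNorm_nonneg_op (T : Matrix (Fin m) (Fin m) (H →L[ℂ] H)) : 0 ≤ matNorm m T :=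
  norm_nonneg (blockOp T)

theorem norm_sesq_le (T : Matrix (Fin m) (Fin m) (H →L[ℂ] H)) (ξ η : Fin m → H) :
    ‖sesq T ξ η‖ ≤ matNorm m T * (‖WithLp.toLp 2 ξ‖ * ‖WithLp.toLp 2 η‖) := by
  have := inner_blockOp T (WithLp.toLp 2 ξ) (WithLp.toLp 2 η)
  simp only at this
  rw [← this]
  refine (norm_inner_le_norm _ _).trans ?_
  have h := (blockOp T).le_opNorm (WithLp.toLp 2 η)
  have h' := mul_le_mul_of_nonneg_left h (norm_nonneg (WithLp.toLp 2 ξ))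
  change _ ≤ ‖blockOp T‖ * _
  linarith

/-- By `2ab ≤ a² + b²` the norm bound becomes additive in the squared norms of the vectors, so it
can be summed over blocks and over direct sums. Nothing is lost, since unit vectors give back `‖T‖ ≤
C`. -/
theorem two_norm_sesq_le (T : Matrix (Fin m) (Fin m) (H →L[ℂ] H)) {C : ℝ}
    (h : matNorm m T ≤ C) (ξ η : Fin m → H) :
    2 * ‖sesq T ξ η‖ ≤ C * (sqNorm ξ + sqNorm η) := by
  have h1 := norm_sesq_le T ξ η
  have hT := matNorm_nonneg_op T
  rw [sqNorm_toLp, sqNorm_toLp]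
  have h2 : matNorm m T * (‖WithLp.toLp 2 ξ‖ * ‖WithLp.toLp 2 η‖) ≤
    C * (‖WithLp.toLp 2 ξ‖ * ‖WithLp.toLp 2 η‖) := by gcongr
  nlinarith [mul_nonneg (hT.trans h) (sq_nonneg (‖WithLp.toLp 2 ξ‖ - ‖WithLp.toLp 2 η‖))]

theorem matNorm_le_of_two_norm_sesq_le (T : Matrix (Fin m) (Fin m) (H →L[ℂ] H)) {C : ℝ}
    (hC : 0 ≤ C) (h : ∀ ξ η : Fin m → H, 2 * ‖sesq T ξ η‖ ≤ C * (sqNorm ξ + sqNorm η)) :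
    matNorm m T ≤ C := by
  change ‖blockOp T‖ ≤ C
  refine ContinuousLinearMap.opNorm_le_of_re_inner_le (𝕜 := ℂ) hC fun x y hx hy => ?_
  have h1 := h (fun i => y i) (fun i => x i)
  have hx' : sqNorm (fun i => x i) = 1 := by rw [sqNorm_toLp]; change ‖x‖ ^ 2 = 1; simp [hx]
  have hy' : sqNorm (fun i => y i) = 1 := by rw [sqNorm_toLp]; change ‖y‖ ^ 2 = 1; simp [hy]
  rw [← inner_blockOp, hx', hy'] at h1
  refine (RCLike.re_le_norm _).trans ?_
  rw [norm_inner_symm]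
  linarith

theorem matNorm_le_iff (T : Matrix (Fin m) (Fin m) (H →L[ℂ] H)) {C : ℝ} (hC : 0 ≤ C) :
    matNorm m T ≤ C ↔ ∀ ξ η : Fin m → H, 2 * ‖sesq T ξ η‖ ≤ C * (sqNorm ξ + sqNorm η) :=
  ⟨two_norm_sesq_le T, matNorm_le_of_two_norm_sesq_le T hC⟩

theorem blockOp_add (S T : Matrix (Fin m) (Fin m) (H →L[ℂ] H)) :
    blockOp (S + T) = blockOp S + blockOp T := by
  refine ContinuousLinearMap.ext fun x => ext_inner_left ℂ fun y => ?_
  simp only [add_apply, inner_add_right, inner_blockOp, sesq_add]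

/-- The action of a scalar matrix on families of vectors. -/
def scalarAct (A : Matrix ι κ ℂ) (ξ : κ → H) : ι → H := fun i => ∑ k, A i k • ξ k

theorem sesq_scalarMul {p : ℕ} (A : Matrix (Fin m) (Fin n) ℂ)
    (T : Matrix (Fin n) (Fin n) (H →L[ℂ] H)) (B : Matrix (Fin n) (Fin p) ℂ) (ξ : Fin m → H)
    (η : Fin p → H) :
    sesq (scalarMul A T B) ξ η = sesq T (scalarAct A.conjTranspose ξ) (scalarAct B η) := by
  simp only [sesq, scalarMul, scalarAct, _root_.sum_apply, smul_apply, inner_sum,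
    sum_inner, map_sum, map_smul, inner_smul_left, inner_smul_right, Matrix.conjTranspose_apply,
    RCLike.star_def, Complex.conj_conj]
  calc _ = ∑ i, ∑ k, ∑ l, ∑ j, A i k * B l j * ⟪ξ i, T k l (η j)⟫_ℂ := by
        refine Finset.sum_congr rfl fun i _ => ?_
        rw [Finset.sum_comm]
        refine Finset.sum_congr rfl fun k _ => ?_
        rw [Finset.sum_comm]
    _ = ∑ k, ∑ l, ∑ j, ∑ i, A i k * B l j * ⟪ξ i, T k l (η j)⟫_ℂ := by
        rw [Finset.sum_comm]
        refine Finset.sum_congr rfl fun k _ => ?_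
        rw [Finset.sum_comm]
        refine Finset.sum_congr rfl fun l _ => ?_
        rw [Finset.sum_comm]
    _ = _ := by
        simp only [Finset.mul_sum]
        refine Finset.sum_congr rfl fun k _ => Finset.sum_congr rfl fun l _ =>
          Finset.sum_congr rfl fun j _ => Finset.sum_congr rfl fun i _ => ?_
        ring

/-- In an orthonormal basis of the span of the `ξ i`, the matrix `A` acts on each coordinate
separately, and there the bound is the definition of its operator norm. -/
theorem sqNorm_scalarAct_le (A : Matrix (Fin m) (Fin n) ℂ) (ξ : Fin n → H) :
    sqNorm (scalarAct A ξ) ≤ ‖A‖ ^ 2 * sqNorm ξ := by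
  let W := Submodule.span ℂ (Set.range ξ)
  have : FiniteDimensional ℂ W := FiniteDimensional.span_of_finite ℂ (Set.finite_range ξ)
  let b := stdOrthonormalBasis ℂ W
  let ξ' : Fin n → W := fun i => ⟨ξ i, Submodule.subset_span ⟨i, rfl⟩⟩
  have key : ∀ {p : ℕ} (ζ : Fin p → W), sqNorm ζ = ∑ k, ∑ i, ‖⟪b k, ζ i⟫_ℂ‖ ^ 2 := by
    intro p ζ
    rw [Finset.sum_comm]
    exact Finset.sum_congr rfl fun i _ => (b.sum_sq_norm_inner_right (ζ i)).symm
  have h : sqNorm (scalarAct A ξ') ≤ ‖A‖ ^ 2 * sqNorm ξ' := by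
    rw [key, key, Finset.mul_sum]
    refine Finset.sum_le_sum fun k _ => ?_
    have h1 := Matrix.l2_opNorm_mulVec A (WithLp.toLp 2 fun i => ⟪b k, ξ' i⟫_ℂ)
    have h2 := pow_le_pow_left₀ (norm_nonneg _) h1 2
    rw [mul_pow, EuclideanSpace.norm_sq_eq, EuclideanSpace.norm_sq_eq] at h2
    simpa [Matrix.mulVec, dotProduct, scalarAct, inner_sum, inner_smul_right] using h2
  have h3 : sqNorm (scalarAct A ξ') = sqNorm (scalarAct A ξ) :=
    Finset.sum_congr rfl fun i _ => by
      rw [Submodule.coe_norm]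
      simp [scalarAct, ξ']
  have h4 : sqNorm ξ' = sqNorm ξ := Finset.sum_congr rfl fun i _ => by simp [ξ']
  rwa [h3, h4] at h

theorem norm_scalarAct_le (A : Matrix (Fin m) (Fin n) ℂ) (ξ : Fin n → H) :
    ‖WithLp.toLp 2 (scalarAct A ξ)‖ ≤ ‖A‖ * ‖WithLp.toLp 2 ξ‖ := by
  have := sqNorm_scalarAct_le A ξ
  rw [sqNorm_toLp, sqNorm_toLp, ← mul_pow] at this
  exact le_of_sq_le_sq this (by positivity)

theorem norm_apply_le_matNorm (T : Matrix (Fin m) (Fin m) (H →L[ℂ] H)) (i j : Fin m) :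
    ‖T i j‖ ≤ matNorm m T := by
  refine ContinuousLinearMap.opNorm_le_of_re_inner_le (𝕜 := ℂ) (matNorm_nonneg_op T)
    fun x y hx hy => ?_
  have h := two_norm_sesq_le T le_rfl (Pi.single i y) (Pi.single j x)
  have h1 : sesq T (Pi.single i y) (Pi.single j x) = ⟪y, T i j x⟫_ℂ := by
    rw [sesq, Finset.sum_eq_single i, Finset.sum_eq_single j] <;> simp +contextual
  have h2 : ∀ (k : Fin m) (z : H), ‖z‖ = 1 → sqNorm (Pi.single k z : Fin m → H) = 1 := by
    intro k z hz
    rw [sqNorm, Finset.sum_eq_single k] <;> simp +contextual [hz]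
  rw [h1, h2 _ _ hx, h2 _ _ hy] at h
  refine (RCLike.re_le_norm _).trans ?_
  rw [norm_inner_symm]
  linarith

theorem matNorm_le_sum (T : Matrix (Fin m) (Fin m) (H →L[ℂ] H)) :
    matNorm m T ≤ ∑ i, ∑ j, ‖T i j‖ := by
  have hC : 0 ≤ ∑ i, ∑ j, ‖T i j‖ := by positivity
  refine (matNorm_le_iff T hC).2 fun ξ η => ?_
  rw [sesq]
  have : ‖∑ i, ∑ j, ⟪ξ i, T i j (η j)⟫_ℂ‖ ≤ ∑ i, ∑ j, ‖⟪ξ i, T i j (η j)⟫_ℂ‖ :=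
    (norm_sum_le _ _).trans (Finset.sum_le_sum fun i _ => norm_sum_le _ _)
  refine (mul_le_mul_of_nonneg_left this zero_le_two).trans ?_
  rw [Finset.mul_sum, Finset.sum_mul]
  refine Finset.sum_le_sum fun i _ => ?_
  rw [Finset.mul_sum, Finset.sum_mul]
  refine Finset.sum_le_sum fun j _ => ?_
  have h1 : ‖⟪ξ i, T i j (η j)⟫_ℂ‖ ≤ ‖ξ i‖ * (‖T i j‖ * ‖η j‖) :=
    (norm_inner_le_norm _ _).trans (by gcongr; exact (T i j).le_opNorm _)
  have h2 : ‖ξ i‖ ^ 2 ≤ sqNorm ξ :=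
    Finset.single_le_sum (f := fun i => ‖ξ i‖ ^ 2) (fun _ _ => sq_nonneg _) (Finset.mem_univ i)
  have h3 : ‖η j‖ ^ 2 ≤ sqNorm η :=
    Finset.single_le_sum (f := fun i => ‖η i‖ ^ 2) (fun _ _ => sq_nonneg _) (Finset.mem_univ j)
  have h4 : ‖T i j‖ * (‖ξ i‖ ^ 2 + ‖η j‖ ^ 2) ≤ ‖T i j‖ * (sqNorm ξ + sqNorm η) := by gcongr
  nlinarith [mul_nonneg (norm_nonneg (T i j)) (sq_nonneg (‖ξ i‖ - ‖η j‖))]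

theorem matNorm_one_eq (T : H →L[ℂ] H) : matNorm 1 (fun _ _ : Fin 1 => T) = ‖T‖ := by
  refine le_antisymm ?_ (norm_apply_le_matNorm (fun _ _ : Fin 1 => T) 0 0)
  simpa using matNorm_le_sum (fun _ _ : Fin 1 => T)

/-- The algebra of bounded operators satisfies Ruan's axioms. -/
theorem isOperatorSpace_op : IsOperatorSpace (H →L[ℂ] H) where
  eq_zero_iff n x := by
    constructor
    · intro h
      ext1 i j
      exact norm_le_zero_iff.1 ((norm_apply_le_matNorm x i j).trans h.le)
    · rintro rfl
      exact le_antisymm ((matNorm_le_sum _).trans (by simp)) (matNorm_nonneg_op _)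
  add_le n x y := by
    change ‖blockOp (x + y)‖ ≤ ‖blockOp x‖ + ‖blockOp y‖
    rw [blockOp_add]
    exact norm_add_le (blockOp x) (blockOp y)
  smul_eq n c x := by
    have key : ∀ (c : ℂ) (x : Matrix (Fin n) (Fin n) (H →L[ℂ] H)),
        matNorm n (c • x) ≤ ‖c‖ * matNorm n x := fun c x => by
      have hx := matNorm_nonneg_op x
      refine (matNorm_le_iff _ (by positivity)).2 fun ξ η => ?_
      rw [sesq_smul, norm_mul]
      have := mul_le_mul_of_nonneg_left (two_norm_sesq_le x le_rfl ξ η) (norm_nonneg c)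
      linarith
    refine le_antisymm (key c x) ?_
    by_cases hc : c = 0
    · simpa [hc] using matNorm_nonneg_op _
    · have h := mul_le_mul_of_nonneg_left (key c⁻¹ (c • x)) (norm_nonneg c)
      rwa [inv_smul_smul₀ hc, norm_inv, mul_inv_cancel_left₀ (norm_ne_zero_iff.2 hc)] at h
  directSum m n x y := by
    apply le_antisymm
    · have hM := (matNorm_nonneg_op x).trans (le_max_left _ (matNorm n y))
      refine (matNorm_le_iff _ hM).2 fun ξ η => ?_
      rw [sesq_block, sqNorm_add_split ξ, sqNorm_add_split η, sesq_zero, sesq_zero, add_zero,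
        zero_add]
      have h1 := two_norm_sesq_le x (le_max_left _ (matNorm n y))
        (fun i => ξ (Fin.castAdd n i)) (fun i => η (Fin.castAdd n i))
      have h2 := two_norm_sesq_le y (le_max_right (matNorm m x) _)
        (fun i => ξ (Fin.natAdd m i)) (fun i => η (Fin.natAdd m i))
      have h3 := norm_add_le (sesq x (fun i => ξ (Fin.castAdd n i)) (fun i => η (Fin.castAdd n i)))
        (sesq y (fun i => ξ (Fin.natAdd m i)) (fun i => η (Fin.natAdd m i)))
      linarith
    · have h0 := matNorm_nonneg_op (block x 0 0 y)
      refine max_le ((matNorm_le_iff _ h0).2 fun ξ η => ?_) ((matNorm_le_iff _ h0).2 fun ξ η => ?_)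
      · have := two_norm_sesq_le (block x 0 0 y) le_rfl (Fin.append ξ 0) (Fin.append η 0)
        simpa [sesq_block, sqNorm_add_split, sqNorm_zero, ← Pi.zero_def] using this
      · have := two_norm_sesq_le (block x 0 0 y) le_rfl (Fin.append 0 ξ) (Fin.append 0 η)
        simpa [sesq_block, sqNorm_add_split, sqNorm_zero, ← Pi.zero_def] using this
  scalarMul_le m n A x B := by
    have hx := matNorm_nonneg_op x
    refine (matNorm_le_iff _ (by positivity)).2 fun ξ η => ?_
    rw [sesq_scalarMul, sqNorm_toLp, sqNorm_toLp]
    have h1 := norm_sesq_le x (scalarAct A.conjTranspose ξ) (scalarAct B η)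
    have h2 := norm_scalarAct_le A.conjTranspose ξ
    have h3 := norm_scalarAct_le B η
    rw [Matrix.l2_opNorm_conjTranspose] at h2
    have h4 : matNorm n x * (‖WithLp.toLp 2 (scalarAct A.conjTranspose ξ)‖ *
        ‖WithLp.toLp 2 (scalarAct B η)‖) ≤
        matNorm n x * ((‖A‖ * ‖WithLp.toLp 2 ξ‖) * (‖B‖ * ‖WithLp.toLp 2 η‖)) := by gcongr
    have h5 : 0 ≤ ‖A‖ * matNorm n x * ‖B‖ := by positivity
    nlinarith [mul_nonneg h5 (sq_nonneg (‖WithLp.toLp 2 ξ‖ - ‖WithLp.toLp 2 η‖))]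

theorem matNorm_conjTranspose [CompleteSpace H] (T : Matrix (Fin m) (Fin m) (H →L[ℂ] H)) :
    matNorm m T.conjTranspose = matNorm m T := by
  have key : ∀ T : Matrix (Fin m) (Fin m) (H →L[ℂ] H),
      matNorm m T.conjTranspose ≤ matNorm m T := fun T =>
    (matNorm_le_iff _ (matNorm_nonneg_op T)).2 fun ξ η => by
      rw [sesq_conjTranspose, norm_star, add_comm]
      exact two_norm_sesq_le T le_rfl η ξ
  refine le_antisymm (key T) ?_
  simpa using key T.conjTranspose

theorem sesq_diagUnit (c : ℂ) (ξ η : Fin m → H) :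
    sesq (c • diagUnit (1 : H →L[ℂ] H) m) ξ η = c * ∑ i, ⟪ξ i, η i⟫_ℂ := by
  rw [sesq_smul, sesq]
  congr 1
  refine Finset.sum_congr rfl fun i _ => ?_
  rw [Finset.sum_eq_single i] <;> simp +contextual [diagUnit, eq_comm]

theorem sum_inner_self (ξ : Fin m → H) : ∑ i, ⟪ξ i, ξ i⟫_ℂ = (sqNorm ξ : ℂ) := by
  simp [sqNorm, inner_self_eq_norm_sq_to_K]

theorem block_mem_cone_iff [CompleteSpace H] (T : Matrix (Fin m) (Fin m) (H →L[ℂ] H)) {α : ℝ}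
    (hα : 0 ≤ α) :
    block ((α : ℂ) • diagUnit (1 : H →L[ℂ] H) m) T T.conjTranspose ((α : ℂ) • diagUnit 1 m) ∈
      cone (E := H →L[ℂ] H) (m + m) ↔ matNorm m T ≤ α := by
  rw [mem_cone_iff_sesq, matNorm_le_iff T hα]
  have key : ∀ ζ : Fin (m + m) → H,
      sesq (block ((α : ℂ) • diagUnit (1 : H →L[ℂ] H) m) T T.conjTranspose
        ((α : ℂ) • diagUnit 1 m)) ζ ζ =
      ((α * (sqNorm (fun i => ζ (Fin.castAdd m i)) + sqNorm (fun i => ζ (Fin.natAdd m i))) +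
        2 * (sesq T (fun i => ζ (Fin.castAdd m i)) (fun i => ζ (Fin.natAdd m i))).re : ℝ) : ℂ) := by
    intro ζ
    rw [sesq_block, sesq_diagUnit, sesq_diagUnit, sesq_conjTranspose, sum_inner_self,
      sum_inner_self]
    apply Complex.ext <;> simp
    ring
  constructor
  · intro h ξ η
    -- Rotating `η` by this phase makes the real part in `key` as negative as possible without
    -- changing the norms.
    obtain ⟨c, hc, hc'⟩ : ∃ c : ℂ, ‖c‖ = 1 ∧ c * sesq T ξ η = -(‖sesq T ξ η‖ : ℂ) := by
      by_cases h0 : sesq T ξ η = 0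
      · exact ⟨1, by simp, by simp [h0]⟩
      · have h0' : (‖sesq T ξ η‖ : ℂ) ≠ 0 := by simpa using h0
        refine ⟨-(‖sesq T ξ η‖ : ℂ) / sesq T ξ η, ?_, by field_simp⟩
        rw [norm_div, norm_neg, Complex.norm_real, norm_norm, div_self (by simpa using h0)]
    have h1 := h (Fin.append ξ (c • η))
    rw [key, Complex.zero_le_real] at h1
    simp only [Fin.append_left, Fin.append_right] at h1
    have h2 : sqNorm (fun i => (c • η) i) = sqNorm η := by
      change sqNorm (c • η) = _
      simp [sqNorm_smul, hc]
    have h3 : sesq T (fun i => ξ i) (fun i => (c • η) i) = -(‖sesq T ξ η‖ : ℂ) := by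
      rw [← hc']; exact sesq_smul_right T c ξ η
    rw [h2, h3] at h1
    simp at h1
    linarith
  · intro h ζ
    rw [key, Complex.zero_le_real]
    have h1 := h (fun i => ζ (Fin.castAdd m i)) (fun i => ζ (Fin.natAdd m i))
    have h2 := Complex.abs_re_le_norm
      (sesq T (fun i => ζ (Fin.castAdd m i)) (fun i => ζ (Fin.natAdd m i)))
    have h3 := (abs_le.1 h2).1
    linarith

/-- Polarization writes `⟪T x, y⟫` as a quarter of four quadratic values at vectors of norm at most
`2`, each bounded by `4 * M`. The constant is not optimal, but only its finiteness matters below. -/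
theorem norm_le_of_numericalRadius (T : H →L[ℂ] H) {M : ℝ} (hM : 0 ≤ M)
    (h : ∀ x : H, ‖x‖ = 1 → ‖⟪x, T x⟫_ℂ‖ ≤ M) : ‖T‖ ≤ 4 * M := by
  have h' : ∀ x : H, ‖⟪T x, x⟫_ℂ‖ ≤ M * ‖x‖ ^ 2 := by
    intro x
    by_cases hx : x = 0
    · simp [hx]
    have h1 := h ((‖x‖⁻¹ : ℂ) • x) (by simp [norm_smul, hx])
    rw [norm_inner_symm]
    rw [map_smul, inner_smul_left, inner_smul_right] at h1
    simp only [norm_mul, RCLike.norm_conj, norm_inv, Complex.norm_real, norm_norm] at h1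
    have hx' : 0 < ‖x‖ := norm_pos_iff.2 hx
    field_simp at h1
    linarith
  refine ContinuousLinearMap.opNorm_le_of_re_inner_le (𝕜 := ℂ) (by positivity) fun x y hx hy => ?_
  refine (RCLike.re_le_norm _).trans ?_
  have h2 := inner_map_polarization' (T : H →ₗ[ℂ] H) x y
  simp only [ContinuousLinearMap.coe_coe] at h2
  rw [h2]
  have h3 : ∀ z : H, ‖z‖ ≤ 2 → ‖⟪T z, z⟫_ℂ‖ ≤ 4 * M := fun z hz =>
    (h' z).trans (by nlinarith [norm_nonneg z, pow_le_pow_left₀ (norm_nonneg z) hz 2])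
  have a1 := h3 (x + y) ((norm_add_le _ _).trans (by linarith))
  have a2 := h3 (x - y) ((norm_sub_le _ _).trans (by linarith))
  have a3 := h3 (x + Complex.I • y) ((norm_add_le _ _).trans (by simp [norm_smul]; linarith))
  have a4 := h3 (x - Complex.I • y) ((norm_sub_le _ _).trans (by simp [norm_smul]; linarith))
  rw [norm_div, RCLike.norm_ofNat, div_le_iff₀ (by norm_num)]
  refine (norm_add_le _ _).trans ?_
  have b1 := norm_sub_le (⟪T (x + y), x + y⟫_ℂ - ⟪T (x - y), x - y⟫_ℂ)
    (Complex.I * ⟪T (x + Complex.I • y), x + Complex.I • y⟫_ℂ)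
  have b2 := norm_sub_le ⟪T (x + y), x + y⟫_ℂ ⟪T (x - y), x - y⟫_ℂ
  rw [norm_mul, Complex.norm_I, one_mul] at b1 ⊢
  linarith

end Sesq

/-! ### Conjugation of ccp maps and reduction to finite dimensions -/

section Conjugation

variable {H G : Type*} [NormedAddCommGroup H] [InnerProductSpace ℂ H] [CompleteSpace H]
  [NormedAddCommGroup G] [InnerProductSpace ℂ G] [CompleteSpace G]

/-- `T ↦ C^* T C`. -/
def conjOp (C : G →L[ℂ] H) : (H →L[ℂ] H) →ₗ[ℂ] (G →L[ℂ] G) where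
  toFun T := ContinuousLinearMap.adjoint C ∘L T ∘L C
  map_add' S T := by ext; simp
  map_smul' c T := by ext; simp

theorem inner_conjOp (C : G →L[ℂ] H) (T : H →L[ℂ] H) (x y : G) :
    ⟪x, conjOp C T y⟫_ℂ = ⟪C x, T (C y)⟫_ℂ := by
  simp [conjOp, ContinuousLinearMap.adjoint_inner_right]

theorem inner_compress (β : G →ₗᵢ[ℂ] H) (T : H →L[ℂ] H) (x y : G) :
    ⟪x, compress β T y⟫_ℂ = ⟪β x, T (β y)⟫_ℂ :=
  inner_conjOp _ T x y

theorem conjOp_star (C : G →L[ℂ] H) (T : H →L[ℂ] H) : conjOp C (star T) = star (conjOp C T) := by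
  simp [conjOp, ContinuousLinearMap.star_eq_adjoint, ContinuousLinearMap.adjoint_comp,
    ContinuousLinearMap.comp_assoc]

theorem sesq_map_conjOp {m : ℕ} (C : G →L[ℂ] H) (T : Matrix (Fin m) (Fin m) (H →L[ℂ] H))
    (ξ η : Fin m → G) :
    sesq (T.map (conjOp C)) ξ η = sesq T (fun i => C (ξ i)) (fun i => C (η i)) := by
  simp only [sesq, Matrix.map_apply, inner_conjOp]

variable {E : Type*} [AddCommGroup E] [Module ℂ E] [Star E] [MatrixNorm E] [MatrixCone E]

theorem sqNorm_le_of_norm_le_one {m : ℕ} {C : G →L[ℂ] H} (hC : ‖C‖ ≤ 1) (ξ : Fin m → G) :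
    sqNorm (fun i => C (ξ i)) ≤ sqNorm ξ := by
  refine Finset.sum_le_sum fun i _ => pow_le_pow_left₀ (norm_nonneg _) ?_ 2
  simpa using C.le_of_opNorm_le hC (ξ i)

theorem IsCCP.matNorm_map_le {φ : E →ₗ[ℂ] (H →L[ℂ] H)} (hφ : IsCCP φ) {m : ℕ}
    (x : Matrix (Fin m) (Fin m) E) : matNorm m (x.map φ) ≤ matNorm m x := by
  simpa using hφ.1 m x

theorem IsCCP.conj {φ : E →ₗ[ℂ] (H →L[ℂ] H)} (hφ : IsCCP φ) {C : G →L[ℂ] H} (hC : ‖C‖ ≤ 1) :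
    IsCCP (conjOp C ∘ₗ φ) := by
  have hmap : ∀ (m : ℕ) (x : Matrix (Fin m) (Fin m) E),
      x.map (conjOp C ∘ₗ φ) = (x.map φ).map (conjOp C) := fun m x => rfl
  refine ⟨fun m x => ?_, fun x => ?_, fun m x hx => ?_⟩
  · rw [one_mul]
    have h0 := hφ.matNorm_map_le x
    have h1 := (matNorm_nonneg_op _).trans h0
    rw [hmap, matNorm_le_iff _ h1]
    intro ξ η
    rw [sesq_map_conjOp]
    refine (two_norm_sesq_le _ h0 _ _).trans ?_
    gcongr <;> exact sqNorm_le_of_norm_le_one hC _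
  · simp only [LinearMap.comp_apply, hφ.2.map_star, conjOp_star]
  · rw [hmap, mem_cone_iff_sesq]
    intro ξ
    rw [sesq_map_conjOp]
    exact (mem_cone_iff_sesq _).1 (hφ.2.map_cone m x hx) _

theorem IsCCP.compress {φ : E →ₗ[ℂ] (H →L[ℂ] H)} (hφ : IsCCP φ) (β : G →ₗᵢ[ℂ] H) :
    IsCCP (NCDuality.compress β ∘ₗ φ) :=
  hφ.conj β.norm_toContinuousLinearMap_le

/-- The unital extension `(s, α) ↦ φ s + α 1` to the partial unitization. -/
def sharpMap (φ : E →ₗ[ℂ] (H →L[ℂ] H)) : Unitization ℂ E →ₗ[ℂ] (H →L[ℂ] H) where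
  toFun s := φ s.snd + s.fst • 1
  map_add' s t := by simp [add_smul]; abel
  map_smul' c s := by simp [mul_smul]

theorem sharpMap_apply (φ : E →ₗ[ℂ] (H →L[ℂ] H)) (s : Unitization ℂ E) :
    sharpMap φ s = φ s.snd + s.fst • 1 := rfl

theorem exists_linearIsometry {W G : Type*} [NormedAddCommGroup W] [InnerProductSpace ℂ W]
    [FiniteDimensional ℂ W] [NormedAddCommGroup G] [InnerProductSpace ℂ G] [FiniteDimensional ℂ G]
    (h : Module.finrank ℂ W ≤ Module.finrank ℂ G) : Nonempty (W →ₗᵢ[ℂ] G) := by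
  let b := stdOrthonormalBasis ℂ W
  let c := stdOrthonormalBasis ℂ G
  have hc : Orthonormal ℂ (c ∘ Fin.castLE h) := c.orthonormal.comp _ (Fin.castLE_injective h)
  refine ⟨(b.toBasis.constr ℂ (c ∘ Fin.castLE h)).isometryOfOrthonormal (v := b.toBasis)
    (by simp) ?_⟩
  convert hc using 1
  ext1 i
  exact b.toBasis.constr_basis ℂ _ i

/-- A quadratic form of a ccp map only sees a compression to a finite-dimensional space. -/
theorem IsCCP.exists_transfer {φ : E →ₗ[ℂ] (H →L[ℂ] H)} (hφ : IsCCP φ) {n : ℕ} (ξ : Fin n → H)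
    (G : Type*) [NormedAddCommGroup G] [InnerProductSpace ℂ G] [FiniteDimensional ℂ G]
    [CompleteSpace G] (hn : n ≤ Module.finrank ℂ G) :
    ∃ (ψ : E →ₗ[ℂ] (G →L[ℂ] G)) (ζ : Fin n → G), IsCCP ψ ∧
      ∀ s : Matrix (Fin n) (Fin n) (Unitization ℂ E),
        sesq (s.map (sharpMap ψ)) ζ ζ = sesq (s.map (sharpMap φ)) ξ ξ := by
  let W := Submodule.span ℂ (Set.range ξ)
  have : FiniteDimensional ℂ W := FiniteDimensional.span_of_finite ℂ (Set.finite_range ξ)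
  have hW : Module.finrank ℂ W ≤ n := by
    exact (finrank_range_le_card (R := ℂ) ξ).trans (by simp)
  obtain ⟨J⟩ := exists_linearIsometry (hW.trans hn)
  let ξ' : Fin n → W := fun i => ⟨ξ i, Submodule.subset_span ⟨i, rfl⟩⟩
  -- The contraction `C` inverts `J` on the span of the `ξ i`, so conjugating by `C` and moving the
  -- vectors by `J` leaves the form of `φ` unchanged.
  let C : G →L[ℂ] H := W.subtypeL ∘L ContinuousLinearMap.adjoint J.toContinuousLinearMap
  have hC : ‖C‖ ≤ 1 := by
    refine (ContinuousLinearMap.opNorm_comp_le _ _).trans ?_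
    rw [LinearIsometryEquiv.norm_map]
    exact mul_le_one₀ W.norm_subtypeL_le (norm_nonneg _) J.norm_toContinuousLinearMap_le
  have hCJ : ∀ i, C (J (ξ' i)) = ξ i := by
    intro i
    have : ContinuousLinearMap.adjoint J.toContinuousLinearMap (J (ξ' i)) = ξ' i :=
      ext_inner_left ℂ fun v => by simp [ContinuousLinearMap.adjoint_inner_right]
    simp [C, this, ξ']
  refine ⟨conjOp C ∘ₗ φ, fun i => J (ξ' i), hφ.conj hC, fun s => ?_⟩
  refine Finset.sum_congr rfl fun i _ => Finset.sum_congr rfl fun j _ => ?_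
  simp only [Matrix.map_apply, sharpMap_apply, add_apply, inner_add_right, LinearMap.comp_apply,
    inner_conjOp, hCJ, smul_apply, inner_smul_right]
  -- The unit is not conjugated by `C`; its contribution agrees because `J` preserves inner
  -- products.
  congr 2
  exact J.inner_map_map (ξ' i) (ξ' j)

end Conjugation

/-! ### Inverse square roots of positive definite matrices -/

section InvSqrt

variable {n : ℕ}

theorem posDef_add_smul_one {α : Matrix (Fin n) (Fin n) ℂ} (hα : α.PosSemidef) {ε : ℝ}
    (hε : 0 < ε) : (α + (ε : ℂ) • 1).PosDef :=
  Matrix.PosDef.posSemidef_add hα (Matrix.PosDef.one.smul (by simpa using hε))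

theorem exists_sqrt_mul_invSqrt {α : Matrix (Fin n) (Fin n) ℂ} (hα : α.PosDef) :
    ∃ R : Matrix (Fin n) (Fin n) ℂ, R.conjTranspose = R ∧ R * R = α ∧ invSqrt α * R = 1 ∧
      R * invSqrt α = 1 ∧ (invSqrt α).conjTranspose = invSqrt α := by
  have hsa : IsSelfAdjoint α := hα.1
  have hpos : ∀ x ∈ spectrum ℝ α, 0 < x := by
    intro x hx
    rw [hα.1.spectrum_real_eq_range_eigenvalues] at hx
    obtain ⟨i, rfl⟩ := hx
    exact hα.eigenvalues_pos i
  -- The spectrum is finite, so every function is continuous on it.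
  have hc : ∀ f : ℝ → ℝ, ContinuousOn f (spectrum ℝ α) := fun f =>
    (Matrix.finite_real_spectrum (A := α)).continuousOn f
  have h1 : cfc (fun t : ℝ => (Real.sqrt t)⁻¹) α * cfc Real.sqrt α = 1 := by
    rw [← cfc_mul _ _ α (hc _) (hc _), ← cfc_one ℝ α]
    refine cfc_congr fun x hx => ?_
    exact inv_mul_cancel₀ (Real.sqrt_pos.2 (hpos x hx)).ne'
  refine ⟨cfc Real.sqrt α, (cfc_predicate Real.sqrt α : IsSelfAdjoint _), ?_, h1, ?_,
    (cfc_predicate (fun t : ℝ => (Real.sqrt t)⁻¹) α : IsSelfAdjoint _)⟩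
  · rw [← cfc_mul _ _ α (hc _) (hc _)]
    conv_rhs => rw [← cfc_id ℝ α]
    exact cfc_congr fun x hx => Real.mul_self_sqrt (hpos x hx).le
  · exact mul_eq_one_comm.1 h1

end InvSqrt

theorem IsOperatorSpace.matNorm_nonneg {E : Type*} [AddCommGroup E] [Module ℂ E] [MatrixNorm E]
    (hE : IsOperatorSpace E) {n : ℕ} (x : Matrix (Fin n) (Fin n) E) : 0 ≤ matNorm n x := by
  have h0 : matNorm n (0 : Matrix (Fin n) (Fin n) E) = 0 := (hE.eq_zero_iff n 0).2 rfl
  have h1 := hE.smul_eq n (-1) x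
  have h2 := hE.add_le n x ((-1 : ℂ) • x)
  rw [h1, neg_one_smul, add_neg_cancel, h0] at h2
  simp at h2
  exact h2

/-! ### Cone and norm of the partial unitization -/

section PartialUnitization

variable {E : Type u} [AddCommGroup E] [Module ℂ E] [StarAddMonoid E] [StarModule ℂ E]
  [MatrixNorm E] [MatrixCone E]

variable {H : Type*} [NormedAddCommGroup H] [InnerProductSpace ℂ H] [CompleteSpace H] {m n : ℕ}

/-- Removes the regularization `ε` from the definition of the cone, by closedness of the nonnegative
numbers. -/
theorem nonneg_of_forall_add_mul_nonneg {z : ℂ} {c : ℝ}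
    (h : ∀ ε : ℝ, 0 < ε → 0 ≤ z + ((ε * c : ℝ) : ℂ)) : 0 ≤ z := by
  have h1 : Filter.Tendsto (fun ε : ℝ => z + ((ε * c : ℝ) : ℂ)) (nhdsWithin 0 (Set.Ioi 0))
      (nhds (z + ((0 * c : ℝ) : ℂ))) := by
    refine Filter.Tendsto.mono_left ?_ nhdsWithin_le_nhds
    exact Continuous.tendsto (f := fun ε : ℝ => z + ((ε * c : ℝ) : ℂ)) (by fun_prop) 0
  rw [zero_mul, Complex.ofReal_zero, add_zero] at h1
  refine ge_of_tendsto h1 ?_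
  filter_upwards [self_mem_nhdsWithin] with ε hε using h ε hε

theorem scalarAct_mul {p : ℕ} (A : Matrix (Fin m) (Fin n) ℂ) (B : Matrix (Fin n) (Fin p) ℂ)
    (ξ : Fin p → H) : scalarAct A (scalarAct B ξ) = scalarAct (A * B) ξ := by
  ext1 i
  simp only [scalarAct, Matrix.mul_apply, Finset.smul_sum, Finset.sum_smul, mul_smul]
  exact Finset.sum_comm

theorem scalarAct_one (ξ : Fin n → H) : scalarAct (1 : Matrix (Fin n) (Fin n) ℂ) ξ = ξ := by
  ext1 i
  simp [scalarAct, Matrix.one_apply]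

theorem sesq_one (ξ η : Fin n → H) :
    sesq (1 : Matrix (Fin n) (Fin n) (H →L[ℂ] H)) ξ η = ∑ i, ⟪ξ i, η i⟫_ℂ := by
  have := sesq_diagUnit (H := H) 1 ξ η
  rwa [one_smul, one_mul] at this

theorem map_scalarMul {F : Type*} [AddCommGroup F] [Module ℂ F] (φ : E →ₗ[ℂ] F)
    (A : Matrix (Fin m) (Fin n) ℂ) (x : Matrix (Fin n) (Fin n) E) (B : Matrix (Fin n) (Fin m) ℂ) :
    (scalarMul A x B).map φ = scalarMul A (x.map φ) B := by
  ext1 i j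
  simp [scalarMul]

/-- The quadratic form of a matrix over the partial unitization under the unital extension. -/
theorem sesq_map_sharpMap (φ : E →ₗ[ℂ] (H →L[ℂ] H)) (s : Matrix (Fin n) (Fin n) (Unitization ℂ E))
    (ξ η : Fin n → H) : sesq (s.map (sharpMap φ)) ξ η =
      sesq ((s.map fun t => t.snd).map φ) ξ η +
        ∑ i, ⟪ξ i, scalarAct (s.map fun t => t.fst) η i⟫_ℂ := by
  simp only [sesq, scalarAct, inner_sum, ← Finset.sum_add_distrib]
  refine Finset.sum_congr rfl fun i _ => Finset.sum_congr rfl fun j _ => ?_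
  simp [sharpMap_apply, inner_smul_right]

/-- Conjugating by `α_ε^{-1/2}` can be undone. -/
theorem map_conj_invSqrt_mem_cone_iff (φ : E →ₗ[ℂ] (H →L[ℂ] H))
    (s : Matrix (Fin n) (Fin n) (Unitization ℂ E)) (hs : (s.map fun t => t.fst).PosSemidef) {ε : ℝ}
    (hε : 0 < ε) :
    (scalarMul (invSqrt (s.map (fun t => t.fst) + (ε : ℂ) • 1)) (s.map (fun t => t.snd))
      (invSqrt (s.map (fun t => t.fst) + (ε : ℂ) • 1))).map φ + 1 ∈ cone (E := H →L[ℂ] H) n ↔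
    ∀ ξ : Fin n → H, 0 ≤ sesq (s.map (sharpMap φ)) ξ ξ + ((ε * sqNorm ξ : ℝ) : ℂ) := by
  obtain ⟨R, hR, hRR, hBR, hRB, hB⟩ := exists_sqrt_mul_invSqrt (posDef_add_smul_one hs hε)
  set α := s.map fun t => t.fst
  set B := invSqrt (α + (ε : ℂ) • 1)
  -- With `R = α_ε^{1/2}`, the substitution `ξ ↦ R ξ` cancels the conjugation and turns the unit
  -- into `α_ε = α + ε`. As `R` is invertible, both conditions range over all vectors.
  have key : ∀ ξ : Fin n → H,
      sesq ((scalarMul B (s.map (fun t => t.snd)) B).map φ + 1) (scalarAct R ξ) (scalarAct R ξ) =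
      sesq (s.map (sharpMap φ)) ξ ξ + ((ε * sqNorm ξ : ℝ) : ℂ) := by
    intro ξ
    rw [sesq_add, map_scalarMul, sesq_scalarMul, hB, scalarAct_mul, hBR, scalarAct_one,
      sesq_map_sharpMap, add_assoc, sesq_one]
    congr 1
    have h1 := sesq_scalarMul R (1 : Matrix (Fin n) (Fin n) (H →L[ℂ] H)) R ξ ξ
    rw [hR, sesq_one] at h1
    rw [← h1, Complex.ofReal_mul, ← sum_inner_self, Finset.mul_sum, ← Finset.sum_add_distrib]
    refine Finset.sum_congr rfl fun i _ => ?_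
    rw [← inner_smul_right, ← inner_add_right, ← inner_sum]
    refine congrArg (inner ℂ (ξ i)) ?_
    have h2 : ∀ j, scalarMul R (1 : Matrix (Fin n) (Fin n) (H →L[ℂ] H)) R i j =
        (α + (ε : ℂ) • 1) i j • (1 : H →L[ℂ] H) := by
      intro j
      rw [← hRR, Matrix.mul_apply, Finset.sum_smul]
      refine Finset.sum_congr rfl fun k _ => ?_
      rw [Finset.sum_eq_single k] <;> simp +contextual [eq_comm]
    have h3 : ∀ j, scalarMul R (1 : Matrix (Fin n) (Fin n) (H →L[ℂ] H)) R i j (ξ j) =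
        α i j • ξ j + (ε : ℂ) • if i = j then ξ j else 0 := by
      intro j
      rw [h2]
      by_cases hij : i = j <;> simp [hij, add_smul, -Complex.coe_smul]
    rw [Finset.sum_congr rfl fun j _ => h3 j, Finset.sum_add_distrib, ← Finset.smul_sum]
    simp [scalarAct]
    rfl
  rw [mem_cone_iff_sesq]
  constructor
  · intro h ξ
    rw [← key]
    exact h _
  · intro h ξ
    have := key (scalarAct B ξ)
    rw [scalarAct_mul, hRB, scalarAct_one] at this
    rw [this]
    exact h _

/-- The cone of the partial unitization in terms of the unital extensions of ccp maps. -/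
theorem mem_cone_unitization_iff (s : Matrix (Fin n) (Fin n) (Unitization ℂ E)) :
    s ∈ cone (E := Unitization ℂ E) n ↔
      (s.map fun t => t.snd).conjTranspose = (s.map fun t => t.snd) ∧
      (s.map fun t => t.fst).PosSemidef ∧
      ∀ φ : E →ₗ[ℂ] (EuclideanSpace ℂ (Fin n) →L[ℂ] EuclideanSpace ℂ (Fin n)), IsCCP φ →
        s.map (sharpMap φ) ∈ cone (E := EuclideanSpace ℂ (Fin n) →L[ℂ] EuclideanSpace ℂ (Fin n)) n := by
  refine and_congr_right fun _ => and_congr_right fun hs => ?_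
  constructor
  · intro h φ hφ
    rw [mem_cone_iff_sesq]
    intro ξ
    exact nonneg_of_forall_add_mul_nonneg (c := sqNorm ξ) fun ε hε =>
      (map_conj_invSqrt_mem_cone_iff φ s hs hε).1 (h ε hε φ hφ) ξ
  · intro h ε hε φ hφ
    refine (map_conj_invSqrt_mem_cone_iff φ s hs hε).2 fun ξ => ?_
    exact add_nonneg ((mem_cone_iff_sesq _).1 (h φ hφ) ξ)
      (Complex.zero_le_real.2 (mul_nonneg hε.le (sqNorm_nonneg ξ)))

/-- The cone at level `n` only tests maps into `M_n`. This is enough for every Hilbert space because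
the form at `n` vectors factors through their span. -/
theorem map_sharpMap_mem_cone {s : Matrix (Fin n) (Fin n) (Unitization ℂ E)}
    (hs : s ∈ cone (E := Unitization ℂ E) n) {φ : E →ₗ[ℂ] (H →L[ℂ] H)} (hφ : IsCCP φ) :
    s.map (sharpMap φ) ∈ cone (E := H →L[ℂ] H) n := by
  rw [mem_cone_iff_sesq]
  intro ξ
  obtain ⟨ψ, ζ, hψ, h⟩ := hφ.exists_transfer ξ (EuclideanSpace ℂ (Fin n)) (by simp)
  rw [← h s]
  exact (mem_cone_iff_sesq _).1 (((mem_cone_unitization_iff s).1 hs).2.2 ψ hψ) ζ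

theorem norm_single_one (d : Dim.{w}) (i : d.1) [DecidableEq d.1] :
    ‖(lp.single 2 i (1 : ℂ) : HSpace d)‖ = 1 := by
  rw [lp.norm_single (by norm_num)]; simp

/-- The cone of the partial unitization in terms of the nc quasistates. -/
theorem mem_cone_unitization_iff_forall_dim (hE : IsOperatorSpace E)
    (s : Matrix (Fin n) (Fin n) (Unitization ℂ E)) :
    s ∈ cone (E := Unitization ℂ E) n ↔ s.conjTranspose = s ∧
      ∀ (d : Dim.{w}) (φ : E →ₗ[ℂ] Mat d), IsCCP φ →
        s.map (sharpMap φ) ∈ cone (E := Mat d) n := by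
  constructor
  · intro hs
    refine ⟨?_, fun d φ hφ => map_sharpMap_mem_cone hs hφ⟩
    obtain ⟨h1, h2, -⟩ := (mem_cone_unitization_iff s).1 hs
    ext1 i j
    exact Unitization.ext (congr_fun (congr_fun h2.1 i) j) (congr_fun (congr_fun h1 i) j)
  · rintro ⟨hs, h⟩
    refine (mem_cone_unitization_iff s).2 ⟨?_, ?_, ?_⟩
    · ext1 i j
      exact congrArg (fun t : Unitization ℂ E => t.snd) (congr_fun (congr_fun hs i) j)
    · refine Matrix.PosSemidef.of_dotProduct_mulVec_nonneg ?_ fun x => ?_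
      · ext1 i j
        exact congrArg (fun t : Unitization ℂ E => t.fst) (congr_fun (congr_fun hs i) j)
      · classical
        let e : HSpace Dim.one.{w} := lp.single 2 PUnit.unit 1
        have he : ⟪e, e⟫_ℂ = 1 := by
          rw [inner_self_eq_norm_sq_to_K, norm_single_one Dim.one PUnit.unit]; simp
        -- The unital extension of the zero map is `(x, α) ↦ α 1`, which detects positivity of the
        -- scalar part.
        have h1 := (mem_cone_iff_sesq _).1 (h Dim.one 0 (isCCP_zero E hE _)) (fun i => x i • e)
        rw [sesq_map_sharpMap] at h1
        have h2 : ∀ k (y : Matrix (Fin k) (Fin k) E), y.map (0 : E →ₗ[ℂ] Mat Dim.one.{w}) = 0 :=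
          fun k y => by ext i j : 2; rfl
        rw [h2, sesq_zero, zero_add] at h1
        simp only [scalarAct, inner_sum, inner_smul_left, inner_smul_right, he] at h1
        convert h1 using 1
        simp [dotProduct, Matrix.mulVec, Finset.mul_sum, mul_comm, mul_assoc]
    · intro φ hφ
      rw [mem_cone_iff_sesq]
      intro ξ
      -- The index type of a `Dim` is nonempty, so size `0` is treated apart.
      rcases Nat.eq_zero_or_pos n with rfl | hn
      · simp [sesq]
      · let d : Dim.{w} := ⟨ULift (Fin n), ⟨⟨⟨0, hn⟩⟩⟩⟩
        let U : HSpace d ≃ₗᵢ[ℂ] EuclideanSpace ℂ (ULift (Fin n)) := lpPiLpₗᵢ _ ℂ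
        have : FiniteDimensional ℂ (HSpace d) := U.symm.toLinearEquiv.finiteDimensional
        obtain ⟨ψ, ζ, hψ, hζ⟩ := hφ.exists_transfer ξ (HSpace d) (by
          rw [U.toLinearEquiv.finrank_eq]; simp)
        rw [← hζ]
        exact (mem_cone_iff_sesq _).1 (h d ψ hψ) ζ

theorem map_block {E F : Type*} [AddCommGroup E] [AddCommGroup F] (f : E → F)
    (a b c d : Matrix (Fin n) (Fin n) E) :
    (block a b c d).map f = block (a.map f) (b.map f) (c.map f) (d.map f) := by
  ext i j
  simp only [block, Matrix.map_apply, Matrix.reindex_apply, Matrix.submatrix_apply]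
  rcases finSumFinEquiv.symm i with i | i <;> rcases finSumFinEquiv.symm j with j | j <;> rfl

theorem conjTranspose_block {E : Type*} [AddCommGroup E] [Star E] (a b c d : Matrix (Fin n) (Fin n) E) :
    (block a b c d).conjTranspose =
      block a.conjTranspose c.conjTranspose b.conjTranspose d.conjTranspose := by
  simp only [block, Matrix.conjTranspose_reindex, Matrix.fromBlocks_conjTranspose]

theorem block_inclusion_mem_cone_iff (hE : IsOperatorSpace E) (x : Matrix (Fin n) (Fin n) E) {α : ℝ}
    (hα : 0 < α) :
    block ((α : ℂ) • diagUnit (1 : Unitization ℂ E) n) (x.map (inclusion E))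
      (x.map (inclusion E)).conjTranspose ((α : ℂ) • diagUnit 1 n) ∈
        cone (E := Unitization ℂ E) (n + n) ↔
      ∀ (d : Dim.{w}) (φ : E →ₗ[ℂ] Mat d), IsCCP φ → matNorm n (x.map φ) ≤ α := by
  rw [mem_cone_unitization_iff_forall_dim.{u, w} hE]
  rw [and_iff_right]
  · refine forall_congr' fun d => forall_congr' fun φ => imp_congr_right fun hφ => ?_
    rw [map_block, ← block_mem_cone_iff _ hα.le]
    have h1 : ((α : ℂ) • diagUnit (1 : Unitization ℂ E) n).map (sharpMap φ) =
        (α : ℂ) • diagUnit (1 : Mat d) n := by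
      ext1 i j
      by_cases hij : i = j <;> simp [diagUnit, hij, sharpMap_apply, -Complex.coe_smul]
    have h2 : (x.map (inclusion E)).map (sharpMap φ) = x.map φ := by
      ext1 i j
      simp [sharpMap_apply, inclusion]
    have h3 : (x.map (inclusion E)).conjTranspose.map (sharpMap φ) =
        (x.map φ).conjTranspose := by
      ext1 i j
      simp [sharpMap_apply, inclusion, hφ.2.map_star]
    rw [h1, h2, h3]
  · rw [conjTranspose_block, Matrix.conjTranspose_conjTranspose]
    have h1 : ((α : ℂ) • diagUnit (1 : Unitization ℂ E) n).conjTranspose =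
        (α : ℂ) • diagUnit 1 n := by
      rw [Matrix.conjTranspose_smul, diagUnit, Matrix.diagonal_conjTranspose]
      have h2 : star (1 : Unitization ℂ E) = 1 := Unitization.ext (by simp) (by simp)
      simp [-Complex.coe_smul, Pi.star_def, h2]
    rw [h1]

/-- The two-by-two criterion for norms holds under each ccp map, so the order unit norm on `E` is
the supremum of the norms under ccp maps. Complete isometry of `inclusion` thus says that the
quasistates are norming. -/
theorem matNorm_inclusion (hE : IsOperatorSpace E) (x : Matrix (Fin n) (Fin n) E) :
    matNorm n (x.map (inclusion E)) = sInf {α : ℝ | 0 < α ∧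
      ∀ (d : Dim.{w}) (φ : E →ₗ[ℂ] Mat d), IsCCP φ → matNorm n (x.map φ) ≤ α} := by
  change sInf _ = _
  congr 1
  ext α
  exact and_congr_right fun hα => block_inclusion_mem_cone_iff hE x hα

theorem matNorm_inclusion_le (hE : IsOperatorSpace E) (x : Matrix (Fin n) (Fin n) E) :
    matNorm n (x.map (inclusion E)) ≤ matNorm n x := by
  -- The left-hand side does not involve the universe of the dimensions, so any choice will do.
  rw [matNorm_inclusion.{u, 0} hE]
  refine le_of_forall_pos_le_add fun ε hε => csInf_le ⟨0, fun α hα => hα.1.le⟩ ⟨?_, ?_⟩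
  · have := hE.matNorm_nonneg x
    linarith
  · intro d φ hφ
    have := hφ.matNorm_map_le x
    linarith

theorem matNorm_inclusion_le_of_forall (hE : IsOperatorSpace E) (x : Matrix (Fin n) (Fin n) E)
    {M : ℝ} (hM : 0 ≤ M)
    (h : ∀ (d : Dim.{w}) (φ : E →ₗ[ℂ] Mat d), IsCCP φ → matNorm n (x.map φ) ≤ M) :
    matNorm n (x.map (inclusion E)) ≤ M := by
  rw [matNorm_inclusion.{u, w} hE]
  refine le_of_forall_pos_le_add fun ε hε => csInf_le ⟨0, fun α hα => hα.1.le⟩ ⟨by linarith, ?_⟩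
  intro d φ hφ
  linarith [h d φ hφ]

theorem le_matNorm_inclusion (hE : IsOperatorSpace E) (x : Matrix (Fin n) (Fin n) E) {M : ℝ}
    (h : ∀ C : ℝ, 0 < C →
      (∀ (d : Dim.{w}) (φ : E →ₗ[ℂ] Mat d), IsCCP φ → matNorm n (x.map φ) ≤ C) → M ≤ C) :
    M ≤ matNorm n (x.map (inclusion E)) := by
  rw [matNorm_inclusion.{u, w} hE]
  have h0 := hE.matNorm_nonneg x
  refine le_csInf ⟨matNorm n x + 1, by linarith, fun d φ hφ => ?_⟩ fun C hC => h C hC.1 hC.2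
  have := hφ.matNorm_map_le x
  linarith

end PartialUnitization

/-! ### Weak* functionals and bounded operators -/

section WeakStar

variable {H G : Type*} [NormedAddCommGroup H] [InnerProductSpace ℂ H]
  [NormedAddCommGroup G] [InnerProductSpace ℂ G]

/-- A vector as a sequence supported at `0`. -/
def seqSingle (x : H) : lp (fun _ : ℕ => H) 2 := lp.single 2 0 x

theorem normalFunctional_seqSingle (x y : H) (T : H →L[ℂ] H) :
    normalFunctional (seqSingle x) (seqSingle y) T = ⟪x, T y⟫_ℂ := by
  rw [normalFunctional, tsum_eq_single 0]
  · simp [seqSingle]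
  · intro k hk
    simp [seqSingle, hk]

theorem WeakStarHasSum.hasSum_inner {I : Type*} {T : I → (H →L[ℂ] H)} {S : H →L[ℂ] H}
    (h : WeakStarHasSum T S) (x y : H) : HasSum (fun i => ⟪x, T i y⟫_ℂ) ⟪x, S y⟫_ℂ := by
  simpa only [normalFunctional_seqSingle] using h (seqSingle x) (seqSingle y)

variable [CompleteSpace G] [CompleteSpace H]

theorem inner_expand (α : G →ₗᵢ[ℂ] H) (T : G →L[ℂ] G) (x y : H) :
    ⟪x, expand α T y⟫_ℂ = ⟪ContinuousLinearMap.adjoint α.toContinuousLinearMap x,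
      T (ContinuousLinearMap.adjoint α.toContinuousLinearMap y)⟫_ℂ := by
  change ⟪x, α.toContinuousLinearMap _⟫_ℂ = _
  rw [← ContinuousLinearMap.adjoint_inner_left]
  rfl

theorem adjoint_isometry_apply (α : G →ₗᵢ[ℂ] H) (x : G) :
    ContinuousLinearMap.adjoint α.toContinuousLinearMap (α x) = x :=
  ext_inner_left ℂ fun v => by simp [ContinuousLinearMap.adjoint_inner_right]

/-- The image of a square summable sequence under a bounded operator. -/
def mapSeq (T : H →L[ℂ] G) (ξ : lp (fun _ : ℕ => H) 2) : lp (fun _ : ℕ => G) 2 :=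
  ⟨fun k => T (ξ k), by
    have h := (lp.memℓp ξ).norm.const_mul ‖T‖
    refine memℓp_gen ?_
    have h1 := h.summable (by norm_num)
    refine Summable.of_nonneg_of_le (fun k => by positivity) (fun k => ?_) h1
    refine Real.rpow_le_rpow (norm_nonneg _) ?_ (by norm_num)
    have h2 := T.le_opNorm (ξ k)
    simpa using h2⟩

/-- Left multiplication by a bounded operator is weak* continuous, since it can be absorbed into the
first sequence. -/
theorem normalFunctional_comp_left (S T : H →L[ℂ] H) (ξ η : lp (fun _ : ℕ => H) 2) :
    normalFunctional ξ η (S ∘L T) =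
      normalFunctional (mapSeq (ContinuousLinearMap.adjoint S) ξ) η T :=
  tsum_congr fun k => (ContinuousLinearMap.adjoint_inner_left S (T (η k)) (ξ k)).symm

end WeakStar

/-! ### Direct sums and equivariance -/

section Decomposition

variable {I : Type w} {m : I → Dim.{w}} {n : Dim.{w}} {α : ∀ i, HSpace (m i) →ₗᵢ[ℂ] HSpace n}

theorem IsDecomposition.hasSum_norm_sq (hα : IsDecomposition α) (x : HSpace n) :
    HasSum (fun i => ‖ContinuousLinearMap.adjoint (α i).toContinuousLinearMap x‖ ^ 2) (‖x‖ ^ 2) := by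
  have h := (hα : WeakStarHasSum _ _).hasSum_inner x x
  simp only [inner_expand] at h
  have h2 := Complex.reCLM.hasSum h
  simp only [Complex.reCLM_apply] at h2
  convert h2 using 1
  · ext1 i
    exact norm_sq_eq_re_inner (𝕜 := ℂ) _
  · exact norm_sq_eq_re_inner (𝕜 := ℂ) _

/-- In Parseval's identity for `α i x`, the `i`-th term already has the full value `‖x‖²`, so the
other terms vanish: the ranges are orthogonal. -/
theorem IsDecomposition.adjoint_apply_of_ne (hα : IsDecomposition α) {i j : I} (hij : j ≠ i)
    (x : HSpace (m i)) : ContinuousLinearMap.adjoint (α j).toContinuousLinearMap (α i x) = 0 := by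
  classical
  have h := hα.hasSum_norm_sq (α i x)
  have h1 := sum_le_hasSum {i, j} (fun _ _ => by positivity) h
  rw [Finset.sum_pair hij.symm, adjoint_isometry_apply, LinearIsometry.norm_map] at h1
  have h2 : ‖ContinuousLinearMap.adjoint (α j).toContinuousLinearMap (α i x)‖ ^ 2 = 0 :=
    le_antisymm (by linarith) (by positivity)
  simpa using h2

variable {V : Type v} [AddCommGroup V] [Module ℂ V]

theorem IsDirectSum.hasSum_inner {x : ∀ i, V →ₗ[ℂ] Mat (m i)} {y : V →ₗ[ℂ] Mat n}
    (h : IsDirectSum α x y) (s : V) (ξ η : HSpace n) :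
    HasSum (fun i => ⟪ContinuousLinearMap.adjoint (α i).toContinuousLinearMap ξ,
      x i s (ContinuousLinearMap.adjoint (α i).toContinuousLinearMap η)⟫_ℂ) ⟪ξ, y s η⟫_ℂ := by
  simpa only [inner_expand] using (h s).hasSum_inner ξ η

/-- Orthogonality of the ranges leaves one term of the sum. Together with its mirror image this says
that `y` is block diagonal with blocks `x i`. -/
theorem IsDirectSum.inner_apply_left {x : ∀ i, V →ₗ[ℂ] Mat (m i)} {y : V →ₗ[ℂ] Mat n}
    (h : IsDirectSum α x y) (hα : IsDecomposition α) (s : V) (i : I) (ξ : HSpace (m i))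
    (η : HSpace n) : ⟪α i ξ, y s η⟫_ℂ =
      ⟪ξ, x i s (ContinuousLinearMap.adjoint (α i).toContinuousLinearMap η)⟫_ℂ := by
  refine (h.hasSum_inner s (α i ξ) η).unique ?_
  have h1 := hasSum_single (f := fun j =>
    ⟪ContinuousLinearMap.adjoint (α j).toContinuousLinearMap (α i ξ),
      x j s (ContinuousLinearMap.adjoint (α j).toContinuousLinearMap η)⟫_ℂ) i
    (fun j hj => by rw [hα.adjoint_apply_of_ne hj, inner_zero_left])
  rwa [adjoint_isometry_apply] at h1

theorem IsDirectSum.inner_apply_right {x : ∀ i, V →ₗ[ℂ] Mat (m i)} {y : V →ₗ[ℂ] Mat n}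
    (h : IsDirectSum α x y) (hα : IsDecomposition α) (s : V) (i : I) (ξ : HSpace n)
    (η : HSpace (m i)) : ⟪ξ, y s (α i η)⟫_ℂ =
      ⟪ContinuousLinearMap.adjoint (α i).toContinuousLinearMap ξ, x i s η⟫_ℂ := by
  refine (h.hasSum_inner s ξ (α i η)).unique ?_
  have h1 := hasSum_single (f := fun j =>
    ⟪ContinuousLinearMap.adjoint (α j).toContinuousLinearMap ξ,
      x j s (ContinuousLinearMap.adjoint (α j).toContinuousLinearMap (α i η))⟫_ℂ) i
    (fun j hj => by rw [hα.adjoint_apply_of_ne hj, map_zero, inner_zero_right])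
  rwa [adjoint_isometry_apply] at h1

/-- The self-adjoint unitary `1 - 2 α α^*`. -/
def reflection {m n : Dim.{w}} (α : HSpace m →ₗᵢ[ℂ] HSpace n) : HSpace n →ₗᵢ[ℂ] HSpace n where
  toLinearMap := ((1 : Mat n) - (2 : ℂ) • expand α 1 : Mat n)
  norm_map' x := by
    have h1 : ⟪x, α (ContinuousLinearMap.adjoint α.toContinuousLinearMap x)⟫_ℂ =
        ((‖ContinuousLinearMap.adjoint α.toContinuousLinearMap x‖ : ℂ)) ^ 2 := by
      have h2 := ContinuousLinearMap.adjoint_inner_left α.toContinuousLinearMap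
        (ContinuousLinearMap.adjoint α.toContinuousLinearMap x) x
      rw [inner_self_eq_norm_sq_to_K] at h2
      exact h2.symm
    have h3 : ‖x - (2 : ℂ) • α (ContinuousLinearMap.adjoint α.toContinuousLinearMap x)‖ ^ 2 =
        ‖x‖ ^ 2 := by
      rw [@norm_sub_sq ℂ, inner_smul_right, h1, norm_smul, LinearIsometry.norm_map]
      rw [← Complex.ofReal_pow, ← Complex.ofReal_ofNat, RCLike.re_to_complex, Complex.re_ofReal_mul,
        Complex.ofReal_re]
      norm_num
      ring
    exact (pow_left_inj₀ (norm_nonneg _) (norm_nonneg _) two_ne_zero).1 h3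

theorem reflection_apply {m n : Dim.{w}} (α : HSpace m →ₗᵢ[ℂ] HSpace n) (x : HSpace n) :
    reflection α x =
      x - (2 : ℂ) • α (ContinuousLinearMap.adjoint α.toContinuousLinearMap x) := rfl

theorem reflection_reflection {m n : Dim.{w}} (α : HSpace m →ₗᵢ[ℂ] HSpace n) (x : HSpace n) :
    reflection α (reflection α x) = x := by
  rw [reflection_apply, reflection_apply, map_sub, map_smul, adjoint_isometry_apply, map_sub,
    map_smul]
  module

theorem expand_one_apply {m n : Dim.{w}} (α : HSpace m →ₗᵢ[ℂ] HSpace n) (x : HSpace n) :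
    expand α 1 x = α (ContinuousLinearMap.adjoint α.toContinuousLinearMap x) := rfl

theorem inner_isometry_adjoint {m n : Dim.{w}} (α : HSpace m →ₗᵢ[ℂ] HSpace n) (x y : HSpace n) :
    ⟪α (ContinuousLinearMap.adjoint α.toContinuousLinearMap x), y⟫_ℂ =
      ⟪x, α (ContinuousLinearMap.adjoint α.toContinuousLinearMap y)⟫_ℂ :=
  (ContinuousLinearMap.adjoint_inner_right α.toContinuousLinearMap _ y).symm.trans
    (ContinuousLinearMap.adjoint_inner_left α.toContinuousLinearMap _ x)

/-- If an assignment is equivariant under isometries, then it respects direct sums. -/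
theorem weakStarHasSum_of_equivariant {x : ∀ i, V →ₗ[ℂ] Mat (m i)} {y : V →ₗ[ℂ] Mat n}
    (hα : IsDecomposition α) (h : IsDirectSum α x y) {a : ∀ i, Mat (m i)} {b : Mat n}
    (h1 : ∀ i, x i = compress (α i) ∘ₗ y → a i = compress (α i) b)
    (h2 : ∀ β : HSpace n →ₗᵢ[ℂ] HSpace n, y = compress β ∘ₗ y → b = compress β b) :
    WeakStarHasSum (fun i => expand (α i) (a i)) b := by
  have hx : ∀ i, x i = compress (α i) ∘ₗ y := by
    intro i
    refine LinearMap.ext fun s => ContinuousLinearMap.ext fun η => ext_inner_left ℂ fun ξ => ?_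
    rw [LinearMap.comp_apply, inner_compress, h.inner_apply_left hα, adjoint_isometry_apply]
  -- Since `y` is block diagonal, it is fixed under compression by the unitary `1 - 2 α_i α_i^*`.
  -- Then so is `b`, which therefore commutes with this unitary and with the projection `α_i α_i^*`.
  have hcomm : ∀ i, expand (α i) 1 ∘L b = b ∘L expand (α i) 1 := by
    intro i
    have hy : y = compress (reflection (α i)) ∘ₗ y := by
      refine LinearMap.ext fun s => ContinuousLinearMap.ext fun η => ext_inner_left ℂ fun ξ => ?_
      rw [LinearMap.comp_apply, inner_compress, reflection_apply, reflection_apply, map_sub,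
        map_smul, inner_sub_left, inner_sub_right, inner_sub_right, inner_smul_left,
        inner_smul_left, inner_smul_right, inner_smul_right, h.inner_apply_left hα,
        h.inner_apply_left hα, h.inner_apply_right hα, adjoint_isometry_apply]
      simp only [map_ofNat]
      ring
    have hb := h2 _ hy
    refine ContinuousLinearMap.ext fun η => ext_inner_left ℂ fun ξ => ?_
    have e1 : ∀ ξ η : HSpace n, ⟪ξ, b η⟫_ℂ = ⟪reflection (α i) ξ, b (reflection (α i) η)⟫_ℂ := by
      intro ξ η
      conv_lhs => rw [hb]
      exact inner_compress _ _ _ _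
    have e2 := e1 ξ (reflection (α i) η)
    rw [reflection_reflection, reflection_apply, reflection_apply, map_sub, map_smul, inner_sub_left,
      inner_sub_right, inner_smul_left, inner_smul_right, map_ofNat, sub_right_inj,
      inner_isometry_adjoint] at e2
    exact (mul_left_cancel₀ two_ne_zero e2).symm
  intro ξ η
  -- Multiply `∑ α_i α_i^* = 1` by `b` on the left; by commutation `b α_i α_i^* = α_i (α_i^* b α_i)
  -- α_i^*`.
  have h3 := hα (mapSeq (ContinuousLinearMap.adjoint b) ξ) η
  simp only [← normalFunctional_comp_left] at h3
  refine Eq.subst (motive := fun F => HasSum F _) (funext fun i => congrArg _ ?_) h3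
  symm
  refine ContinuousLinearMap.ext fun v => ?_
  have h4 := congrArg (fun T : Mat n => T (expand (α i) 1 v)) (hcomm i)
  simp only [ContinuousLinearMap.comp_apply, expand_one_apply, adjoint_isometry_apply] at h4 ⊢
  rw [← h4, h1 i (hx i)]
  rfl

end Decomposition

/-! ### Weak limits of bounded families of operators -/

section Limits

variable {H : Type*} [NormedAddCommGroup H] [InnerProductSpace ℂ H] [CompleteSpace H]

/-- Bounded families of operators converge weakly along ultrafilters. -/
theorem exists_tendsto_inner {X : Type*} (f : Ultrafilter X) (T : X → H →L[ℂ] H) {C : ℝ}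
    (hT : ∀ᶠ x in f, ‖T x‖ ≤ C) :
    ∃ S : H →L[ℂ] H, ∀ ξ η : H,
      Filter.Tendsto (fun x => ⟪ξ, T x η⟫_ℂ) f (nhds ⟪ξ, S η⟫_ℂ) := by
  have hb : ∀ ξ η : H, ∀ᶠ x in f, ‖⟪T x ξ, η⟫_ℂ‖ ≤ C * ‖ξ‖ * ‖η‖ := by
    intro ξ η
    filter_upwards [hT] with x hx
    refine (norm_inner_le_norm _ _).trans ?_
    gcongr
    exact (T x).le_of_opNorm_le hx ξ
  have hex : ∀ ξ η : H, ∃ l : ℂ, Filter.Tendsto (fun x => ⟪T x ξ, η⟫_ℂ) f (nhds l) := by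
    intro ξ η
    have hc := isCompact_iff_ultrafilter_le_nhds.1
      (isCompact_closedBall (0 : ℂ) (C * ‖ξ‖ * ‖η‖)) (f.map fun x => ⟪T x ξ, η⟫_ℂ) (by
        rw [Filter.le_principal_iff, Ultrafilter.mem_coe, Ultrafilter.mem_map]
        filter_upwards [hb ξ η] with x hx
        simpa using hx)
    obtain ⟨l, -, hl⟩ := hc
    exact ⟨l, hl⟩
  choose l hl using hex
  -- The pointwise limits form a bounded sesquilinear form, and `S` is the operator that represents
  -- it.
  let B : H →ₗ⋆[ℂ] H →ₗ[ℂ] ℂ := LinearMap.mk₂'ₛₗ (starRingEnd ℂ) (RingHom.id ℂ) l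
    (fun ξ ξ' η => tendsto_nhds_unique (hl (ξ + ξ') η)
      (by simpa only [map_add, inner_add_left] using (hl ξ η).add (hl ξ' η)))
    (fun c ξ η => tendsto_nhds_unique (hl (c • ξ) η)
      (by simpa only [map_smul, inner_smul_left, smul_eq_mul] using (hl ξ η).const_mul _))
    (fun ξ η η' => tendsto_nhds_unique (hl ξ (η + η'))
      (by simpa only [inner_add_right] using (hl ξ η).add (hl ξ η')))
    (fun c ξ η => tendsto_nhds_unique (hl ξ (c • η))
      (by simpa only [inner_smul_right, smul_eq_mul, RingHom.id_apply] using (hl ξ η).const_mul c))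
  let B' : H →L⋆[ℂ] H →L[ℂ] ℂ := LinearMap.mkContinuous₂ B C fun ξ η =>
    le_of_tendsto (hl ξ η).norm (hb ξ η)
  refine ⟨InnerProductSpace.continuousLinearMapOfBilin B', fun ξ η => ?_⟩
  have h1 : ⟪InnerProductSpace.continuousLinearMapOfBilin B' η, ξ⟫_ℂ = l η ξ :=
    InnerProductSpace.continuousLinearMapOfBilin_apply B' η ξ
  have h2 := (hl η ξ).star
  rw [← h1] at h2
  simpa only [RCLike.star_def, inner_conj_symm] using h2

/-- On bounded sets weak convergence implies weak* convergence. -/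
theorem tendsto_normalFunctional {X : Type*} {f : Filter X} {T : X → H →L[ℂ] H} {S : H →L[ℂ] H}
    {C : ℝ} (hT : ∀ᶠ x in f, ‖T x‖ ≤ C)
    (h : ∀ ξ η : H, Filter.Tendsto (fun x => ⟪ξ, T x η⟫_ℂ) f (nhds ⟪ξ, S η⟫_ℂ))
    (ξ η : lp (fun _ : ℕ => H) 2) :
    Filter.Tendsto (fun x => normalFunctional ξ η (T x)) f (nhds (normalFunctional ξ η S)) := by
  have hs : Summable (fun k => ‖ξ k‖ * ‖η k‖) :=
    lp.summable_mul (by rw [Real.holderConjugate_iff]; norm_num) ξ η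
  refine tendsto_tsum_of_dominated_convergence (hs.mul_left C) (fun k => h _ _) ?_
  filter_upwards [hT] with x hx k
  refine (norm_inner_le_norm _ _).trans ?_
  have h1 := mul_le_mul_of_nonneg_left ((T x).le_of_opNorm_le hx (η k)) (norm_nonneg (ξ k))
  linarith

theorem le_nhds_pointWeakStar_iff {V : Type v} [AddCommGroup V] [Module ℂ V] {n : Dim.{w}}
    {f : Filter (V →ₗ[ℂ] Mat n)} {φ : V →ₗ[ℂ] Mat n} :
    f ≤ @nhds _ (pointWeakStar V n) φ ↔ ∀ (s : V) (ξ η : lp (fun _ : ℕ => HSpace n) 2),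
      Filter.Tendsto (fun ψ : V →ₗ[ℂ] Mat n => normalFunctional ξ η (ψ s)) f
        (nhds (normalFunctional ξ η (φ s))) := by
  rw [nhds_iInf]
  simp only [nhds_induced, nhds_iInf, le_iInf_iff, ← Filter.tendsto_iff_comap, Filter.comap_iInf,
    Filter.comap_comap]
  rfl

end Limits

/-! ### The nc quasistate space is compact and nc convex -/

section Quasistates

variable {E : Type u} [AddCommGroup E] [Module ℂ E] [StarAddMonoid E]
  [MatrixNorm E] [MatrixCone E]
variable {H : Type*} [NormedAddCommGroup H] [InnerProductSpace ℂ H] [CompleteSpace H]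

/-- Each condition is a closed condition on finitely many coefficients `⟪ξ, φ x η⟫`, in a form that
survives both infinite direct sums and weak limits. -/
theorem isCCP_iff_sesq (hE : IsOperatorSpace E) (φ : E →ₗ[ℂ] (H →L[ℂ] H)) : IsCCP φ ↔
    (∀ (k : ℕ) (x : Matrix (Fin k) (Fin k) E) (ξ η : Fin k → H),
      2 * ‖sesq (x.map φ) ξ η‖ ≤ matNorm k x * (sqNorm ξ + sqNorm η)) ∧
    (∀ (x : E) (ξ η : H), ⟪ξ, φ (star x) η⟫_ℂ = star ⟪η, φ x ξ⟫_ℂ) ∧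
    ∀ (k : ℕ), ∀ x ∈ cone (E := E) k, ∀ ξ : Fin k → H, 0 ≤ sesq (x.map φ) ξ ξ := by
  have hstar : ∀ (T : H →L[ℂ] H) (ξ η : H), ⟪ξ, star T η⟫_ℂ = star ⟪η, T ξ⟫_ℂ := fun T ξ η => by
    rw [ContinuousLinearMap.star_eq_adjoint, ContinuousLinearMap.adjoint_inner_right]
    exact (inner_conj_symm _ _).symm
  constructor
  · intro h
    refine ⟨fun k x => two_norm_sesq_le _ (h.matNorm_map_le x), fun x ξ η => ?_, fun k x hx => ?_⟩
    · rw [h.2.map_star, hstar]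
    · exact (mem_cone_iff_sesq _).1 (h.2.map_cone k x hx)
  · rintro ⟨h1, h2, h3⟩
    refine ⟨fun k x => ?_, fun x => ?_, fun k x hx => (mem_cone_iff_sesq _).2 (h3 k x hx)⟩
    · rw [one_mul]
      exact matNorm_le_of_two_norm_sesq_le _ (hE.matNorm_nonneg x) (h1 k x)
    · exact ContinuousLinearMap.ext fun η => ext_inner_left ℂ fun ξ => by rw [h2, hstar]

theorem IsCCP.norm_apply_le {φ : E →ₗ[ℂ] (H →L[ℂ] H)} (hφ : IsCCP φ) (x : E) :
    ‖φ x‖ ≤ matNorm 1 (fun _ _ : Fin 1 => x) := by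
  rw [← matNorm_one_eq]
  exact hφ.matNorm_map_le (fun _ _ : Fin 1 => x)

/-- The nc quasistate space is a compact nc convex set. -/
theorem isCompactNCConvex_quasistateSpace (hE : IsOperatorSpace E) :
    IsCompactNCConvex (quasistateSpace.{u, w} E) where
  completelyBounded n x hx := ⟨1, hx.1⟩
  directSum I m n α x y hx _ hα h := by
    have hs : ∀ (k : ℕ) (X : Matrix (Fin k) (Fin k) E) (ξ η : Fin k → HSpace n),
        HasSum (fun i => sesq (X.map (x i))
          (fun j => ContinuousLinearMap.adjoint (α i).toContinuousLinearMap (ξ j))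
          (fun j => ContinuousLinearMap.adjoint (α i).toContinuousLinearMap (η j)))
          (sesq (X.map y) ξ η) := fun k X ξ η =>
      hasSum_sum fun a _ => hasSum_sum fun b _ => h.hasSum_inner (X a b) (ξ a) (η b)
    have hn : ∀ {k : ℕ} (ξ : Fin k → HSpace n), HasSum (fun i => sqNorm
        (fun j => ContinuousLinearMap.adjoint (α i).toContinuousLinearMap (ξ j))) (sqNorm ξ) :=
      fun ξ => hasSum_sum fun j _ => hα.hasSum_norm_sq (ξ j)
    refine (isCCP_iff_sesq hE y).2 ⟨fun k X ξ η => ?_, fun s ξ η => ?_, fun k X hX ξ => ?_⟩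
    -- The bound for `x i` is additive in squared norms, so by Parseval its sum over `i` is the
    -- bound for `y`.
    · have h1 : ∀ i, ‖sesq (X.map (x i))
          (fun j => ContinuousLinearMap.adjoint (α i).toContinuousLinearMap (ξ j))
          (fun j => ContinuousLinearMap.adjoint (α i).toContinuousLinearMap (η j))‖ ≤ _ := fun i =>
        (le_div_iff₀' zero_lt_two).2 (((isCCP_iff_sesq hE _).1 (hx i)).1 k X _ _)
      have h2 := (((hn ξ).add (hn η)).mul_left (matNorm k X)).div_const 2
      have h3 := h2.tsum_eq ▸ tsum_of_norm_bounded h2 h1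
      rw [(hs k X ξ η).tsum_eq, h2.tsum_eq] at h3
      linarith
    · refine (h.hasSum_inner (star s) ξ η).unique ?_
      convert (h.hasSum_inner s η ξ).star using 1
      ext1 i
      exact ((isCCP_iff_sesq hE _).1 (hx i)).2.1 s _ _
    · exact (hs k X ξ ξ).nonneg fun i => ((isCCP_iff_sesq hE _).1 (hx i)).2.2 k X hX _
  compression m n β x hx := IsCCP.compress hx β
  compact n := by
    -- At each `s` the values are bounded by the norm of `s`, so an ultrafilter on `K_n` has a weak
    -- limit there. Uniqueness of limits makes it linear in `s`, and boundedness upgrades weak to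
    -- weak* convergence.
    rw [@isCompact_iff_ultrafilter_le_nhds _ (pointWeakStar E n)]
    intro f hf
    have hf' : ∀ᶠ φ in (f : Filter (E →ₗ[ℂ] Mat n)), IsCCP φ := Filter.le_principal_iff.1 hf
    have hb : ∀ s : E, ∀ᶠ φ in (f : Filter (E →ₗ[ℂ] Mat n)),
        ‖φ s‖ ≤ matNorm 1 (fun _ _ : Fin 1 => s) := fun s => by
      filter_upwards [hf'] with φ hφ using hφ.norm_apply_le s
    choose S hS using fun s : E => exists_tendsto_inner f (fun φ => φ s) (hb s)
    have huniq : ∀ (s : E) (T : Mat n), (∀ ξ η : HSpace n, Filter.Tendsto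
        (fun φ : E →ₗ[ℂ] Mat n => ⟪ξ, φ s η⟫_ℂ) f (nhds ⟪ξ, T η⟫_ℂ)) → S s = T := fun s T hT =>
      ContinuousLinearMap.ext fun η => ext_inner_left ℂ fun ξ =>
        tendsto_nhds_unique (hS s ξ η) (hT ξ η)
    let φ : E →ₗ[ℂ] Mat n :=
      { toFun := S
        map_add' := fun s t => huniq _ _ fun ξ η => by
          simpa only [map_add, add_apply, inner_add_right] using (hS s ξ η).add (hS t ξ η)
        map_smul' := fun c s => huniq _ _ fun ξ η => by
          simpa only [map_smul, smul_apply, inner_smul_right, RingHom.id_apply] using (hS s ξ η).const_mul c }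
    have hsesq : ∀ (k : ℕ) (X : Matrix (Fin k) (Fin k) E) (ξ η : Fin k → HSpace n),
        Filter.Tendsto (fun ψ : E →ₗ[ℂ] Mat n => sesq (X.map ψ) ξ η) f
          (nhds (sesq (X.map φ) ξ η)) := fun k X ξ η =>
      tendsto_finsetSum _ fun i _ => tendsto_finsetSum _ fun j _ => hS (X i j) (ξ i) (η j)
    refine ⟨φ, (isCCP_iff_sesq hE φ).2 ⟨fun k X ξ η => ?_, fun s ξ η => ?_, fun k X hX ξ => ?_⟩, ?_⟩
    · refine le_of_tendsto ((hsesq k X ξ η).norm.const_mul 2) ?_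
      filter_upwards [hf'] with ψ hψ using ((isCCP_iff_sesq hE ψ).1 hψ).1 k X ξ η
    · refine tendsto_nhds_unique (hS (star s) ξ η) ((hS s η ξ).star.congr' ?_)
      filter_upwards [hf'] with ψ hψ using (((isCCP_iff_sesq hE ψ).1 hψ).2.1 s ξ η).symm
    · refine ge_of_tendsto (hsesq k X ξ ξ) ?_
      filter_upwards [hf'] with ψ hψ using ((isCCP_iff_sesq hE ψ).1 hψ).2.2 k X hX ξ
    · exact le_nhds_pointWeakStar_iff.2 fun s => tendsto_normalFunctional (hb s) (hS s)

end Quasistates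

/-! ### Scalars as operators on a one-dimensional space, and vector states -/

section VectorStates

open Classical in
/-- The unit vector of the one-dimensional Hilbert space. -/
def unitVec : HSpace Dim.one.{w} := lp.single 2 (PUnit.unit : Dim.one.{w}.1) 1

theorem norm_unitVec : ‖unitVec.{w}‖ = 1 := by
  classical
  rw [unitVec, norm_single_one Dim.one PUnit.unit]

theorem unitVec_apply (i : Dim.one.{w}.1) : unitVec i = 1 := by
  classical
  exact lp.single_apply_self (E := fun _ : Dim.one.{w}.1 => ℂ) 2 i 1

theorem inner_unitVec_smul (x : HSpace Dim.one.{w}) : ⟪unitVec, x⟫_ℂ • unitVec = x := by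
  let i₀ : Dim.one.{w}.1 := PUnit.unit
  have hx : x = x i₀ • unitVec := by
    refine lp.ext (funext fun i => ?_)
    rw [lp.coeFn_smul, Pi.smul_apply, unitVec_apply, smul_eq_mul, mul_one]
    rfl
  rw [hx, inner_smul_right, inner_self_eq_norm_sq_to_K, norm_unitVec]
  simp

/-- The identification of operators on the one-dimensional Hilbert space with scalars. -/
def coef (T : Mat Dim.one.{w}) : ℂ := ⟪unitVec, T unitVec⟫_ℂ

theorem apply_unitVec (T : Mat Dim.one.{w}) : T unitVec = coef T • unitVec :=
  (inner_unitVec_smul (T unitVec)).symm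

theorem coef_add (S T : Mat Dim.one.{w}) : coef (S + T) = coef S + coef T := by
  simp [coef]

theorem coef_smul (c : ℂ) (T : Mat Dim.one.{w}) : coef (c • T) = c * coef T := by
  simp [coef]

theorem coef_star (T : Mat Dim.one.{w}) : coef (star T) = star (coef T) := by
  rw [coef, ContinuousLinearMap.star_eq_adjoint, ContinuousLinearMap.adjoint_inner_right]
  exact (inner_conj_symm _ _).symm

theorem coef_sum {ι : Type*} (F : Finset ι) (T : ι → Mat Dim.one.{w}) :
    coef (∑ i ∈ F, T i) = ∑ i ∈ F, coef (T i) := by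
  simp [coef]

theorem norm_coef_le (T : Mat Dim.one.{w}) : ‖coef T‖ ≤ ‖T‖ := by
  refine (norm_inner_le_norm _ _).trans ?_
  have := T.le_opNorm unitVec
  rw [norm_unitVec, mul_one] at this
  rwa [norm_unitVec, one_mul]

/-- The isometry from the one-dimensional Hilbert space with range spanned by a unit vector. -/
def vecIsometry {n : Dim.{w}} (ξ : HSpace n) (hξ : ‖ξ‖ = 1) : HSpace Dim.one.{w} →ₗᵢ[ℂ] HSpace n where
  toLinearMap := ((innerSL ℂ unitVec).smulRight ξ : HSpace Dim.one.{w} →L[ℂ] HSpace n)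
  norm_map' x := by
    have h : ‖⟪unitVec, x⟫_ℂ • unitVec.{w}‖ = ‖x‖ := by rw [inner_unitVec_smul]
    rw [norm_smul, norm_unitVec] at h
    simpa [norm_smul, hξ] using h

theorem vecIsometry_unitVec {n : Dim.{w}} (ξ : HSpace n) (hξ : ‖ξ‖ = 1) :
    vecIsometry ξ hξ unitVec = ξ := by
  change ⟪unitVec, unitVec⟫_ℂ • ξ = ξ
  rw [inner_self_eq_norm_sq_to_K, norm_unitVec]
  simp

theorem adjoint_vecIsometry {n : Dim.{w}} (ξ : HSpace n) (hξ : ‖ξ‖ = 1) (η : HSpace n) :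
    ContinuousLinearMap.adjoint (vecIsometry ξ hξ).toContinuousLinearMap η =
      ⟪ξ, η⟫_ℂ • unitVec := by
  rw [← inner_unitVec_smul (ContinuousLinearMap.adjoint _ η),
    ContinuousLinearMap.adjoint_inner_right]
  congr 2
  exact vecIsometry_unitVec ξ hξ

theorem coef_compress {n : Dim.{w}} (ξ : HSpace n) (hξ : ‖ξ‖ = 1) (T : Mat n) :
    coef (compress (vecIsometry ξ hξ) T) = ⟪ξ, T ξ⟫_ℂ := by
  rw [coef, inner_compress, vecIsometry_unitVec]

end VectorStates

/-! ### Nc functions are determined by their scalar values -/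

section Functions

variable {V : Type v} [AddCommGroup V] [Module ℂ V] [MatrixNorm V] {L : NCSet.{v, w} V}

/-- The vector state of a point of a compact nc convex set. -/
def vectorState (hL : IsCompactNCConvex L) {n : Dim.{w}} (x : L n) (ξ : HSpace n) (hξ : ‖ξ‖ = 1) :
    L Dim.one :=
  ⟨compress (vecIsometry ξ hξ) ∘ₗ x.1, hL.compression _ _ _ _ x.2⟩

/-- Equivariance under the isometry onto the line of `ξ`. It makes the quadratic forms of `a` at all
levels readable from the scalar function on `L_1`. -/
theorem inner_eval_eq_coef (hL : IsCompactNCConvex L) (a : A L) {n : Dim.{w}} (x : L n)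
    (ξ : HSpace n) (hξ : ‖ξ‖ = 1) :
    ⟪ξ, a.1 n x ξ⟫_ℂ = coef (a.1 Dim.one (vectorState hL x ξ hξ)) := by
  rw [a.2.isometry _ _ (vecIsometry ξ hξ) x (vectorState hL x ξ hξ) rfl, coef_compress]

theorem norm_eval_le_of_coef_le (hL : IsCompactNCConvex L) (a : A L) {M : ℝ} (hM : 0 ≤ M)
    (h : ∀ x : L Dim.one, ‖coef (a.1 Dim.one x)‖ ≤ M) (n : Dim.{w}) (x : L n) :
    ‖a.1 n x‖ ≤ 4 * M :=
  norm_le_of_numericalRadius _ hM fun ξ hξ => by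
    rw [inner_eval_eq_coef hL a x ξ hξ]
    exact h _

theorem A.ext_of_coef (hL : IsCompactNCConvex L) {a b : A L}
    (h : ∀ x : L Dim.one, coef (a.1 Dim.one x) = coef (b.1 Dim.one x)) : a = b := by
  have h1 := norm_eval_le_of_coef_le hL (a - b) le_rfl fun x => by
    have h2 : (a - b).1 Dim.one x = a.1 Dim.one x + (-1 : ℂ) • b.1 Dim.one x := by
      rw [neg_one_smul, ← sub_eq_add_neg]; rfl
    rw [h2, coef_add, coef_smul, h]
    simp
  refine Subtype.ext (funext fun n => funext fun x => ?_)
  have h3 := h1 n x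
  rw [mul_zero, norm_le_zero_iff] at h3
  exact sub_eq_zero.1 h3

theorem continuous_coef_eval (a : A L) :
    @Continuous _ _ (levelTopology L Dim.one) _ fun x : L Dim.one => coef (a.1 Dim.one x) := by
  have h := continuous_weakStar_iff.1 (a.2.continuous Dim.one) (seqSingle unitVec)
    (seqSingle unitVec)
  simp only [normalFunctional_seqSingle] at h
  exact h

theorem compactSpace_level (hL : IsCompactNCConvex L) (n : Dim.{w}) :
    @CompactSpace (L n) (levelTopology L n) := by
  let _ := pointWeakStar V n
  exact isCompact_iff_compactSpace.1 (hL.compact n)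

/-- Continuous affine nc functions on compact nc convex sets are uniformly bounded. -/
theorem exists_norm_eval_le (hL : IsCompactNCConvex L) (a : A L) :
    ∃ M : ℝ, 0 ≤ M ∧ ∀ (n : Dim.{w}) (x : L n), ‖a.1 n x‖ ≤ M := by
  let _ := levelTopology L Dim.one
  have := compactSpace_level hL Dim.one
  obtain ⟨C, hC⟩ := (isCompact_range (continuous_coef_eval a)).isBounded.exists_norm_le
  refine ⟨4 * max C 0, by positivity, norm_eval_le_of_coef_le hL a (le_max_right _ _) fun x => ?_⟩
  exact (hC _ ⟨x, rfl⟩).trans (le_max_left _ _)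

/-- Respect for direct sums needs no check: it follows from equivariance by
`weakStarHasSum_of_equivariant`. -/
theorem mem_A_of_isometry {a : ∀ n, L n → Mat n}
    (h1 : ∀ (m n : Dim.{w}) (β : HSpace m →ₗᵢ[ℂ] HSpace n) (x : L n) (y : L m),
      y.1 = compress β ∘ₗ x.1 → a m y = compress β (a n x))
    (h2 : ∀ n, @Continuous _ _ (levelTopology L n) (weakStarTopology (HSpace n)) (a n)) :
    a ∈ A L where
  directSum _ _ _ α x y _ hα h :=
    weakStarHasSum_of_equivariant hα h (fun i hi => h1 _ _ (α i) y (x i) hi)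
      fun β hβ => h1 _ _ β y y hβ
  isometry := h1
  continuous := h2

/-- Evaluation of a fixed vector. -/
theorem eval_mem_A (s : V) : (fun n (x : L n) => x.1 s) ∈ A L := by
  refine mem_A_of_isometry (fun m n β x y h => ?_) fun n => ?_
  · rw [h]
    rfl
  · refine continuous_iff_le_induced.2 ?_
    refine (induced_mono (iInf_le _ s)).trans ?_
    rw [induced_compose]
    rfl

end Functions

/-! ### Approximation of affine functions on compact convex sets -/

section Kadison

/-- Continuous real linear functionals on a product depend on finitely many coordinates. -/
theorem exists_re_sum_eq {ι : Type*} (l : (ι → ℂ) →L[ℝ] ℝ) :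
    ∃ (F : Finset ι) (c : ι → ℂ), ∀ q, l q = (∑ i ∈ F, c i * q i).re := by
  classical
  have h0 : {q : ι → ℂ | ‖l q‖ < 1} ∈ nhds (0 : ι → ℂ) :=
    (isOpen_lt (by fun_prop) continuous_const).mem_nhds (by simp)
  rw [nhds_pi, Filter.mem_pi'] at h0
  obtain ⟨F, t, ht, hF⟩ := h0
  have hv : ∀ q : ι → ℂ, (∀ i ∈ F, q i = 0) → l q = 0 := by
    intro q hq
    by_contra hne
    -- This multiple of `q` vanishes on `F`, so it lies in the basic neighbourhood, yet `l` takes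
    -- the value `1` on it.
    have h1 : (l q)⁻¹ • q ∈ {q : ι → ℂ | ‖l q‖ < 1} := by
      refine hF fun i hi => ?_
      rw [Pi.smul_apply, hq i hi, smul_zero]
      exact mem_of_mem_nhds (ht i)
    simp [hne] at h1
  -- For real `a`, `b` one has `Re ((a - i b) z) = a Re z + b Im z`, so these are the coefficients
  -- of the complexification of `l`.
  refine ⟨F, fun i => (l (Pi.single i 1) : ℂ) - Complex.I * l (Pi.single i Complex.I), fun q => ?_⟩
  have h1 : l q = l (∑ i ∈ F, Pi.single i (q i)) := by
    rw [← sub_eq_zero, ← map_sub]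
    refine hv _ fun i hi => ?_
    rw [Pi.sub_apply, Finset.sum_apply, Finset.sum_pi_single, if_pos hi, sub_self]
  rw [h1, map_sum, Complex.re_sum]
  refine Finset.sum_congr rfl fun i _ => ?_
  have h2 : (Pi.single i (q i) : ι → ℂ) =
      (q i).re • (Pi.single i 1 : ι → ℂ) + (q i).im • (Pi.single i Complex.I : ι → ℂ) := by
    rw [← Pi.single_smul, ← Pi.single_smul, ← Pi.single_add]
    congr 1
    apply Complex.ext <;> simp
  rw [h2, map_add, map_smul, map_smul]
  simp
  ring

/-- Affine continuous functions on a compact convex set are uniformly approximated by continuous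
affine functions of the ambient space. -/
theorem exists_affine_approx {X ι : Type*} [TopologicalSpace X] [CompactSpace X] (p : X → ι → ℂ)
    (hp : Continuous p) (hinj : Function.Injective p) (g : X → ℝ) (hg : Continuous g)
    (hconv : ∀ x y : X, ∀ s t : ℝ, 0 ≤ s → 0 ≤ t → s + t = 1 → ∃ z : X,
      p z = s • p x + t • p y ∧ g z = s * g x + t * g y) {ε : ℝ} (hε : 0 < ε) :
    ∃ (F : Finset ι) (c : ι → ℂ) (d : ℝ), ∀ x, |g x - (∑ i ∈ F, c i * p x i).re - d| < ε := by
  rcases isEmpty_or_nonempty X with hX | ⟨⟨x₀⟩⟩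
  · exact ⟨∅, 0, 0, fun x => isEmptyElim x⟩
  -- The graph of `g` over the image of `p`, raised by `e`. The graphs at heights `0` and `ε` are
  -- disjoint compact convex sets, and a hyperplane between them is the graph of the wanted affine
  -- function.
  let G : ℝ → Set ((ι → ℂ) × ℝ) := fun e => Set.range fun x => (p x, g x + e)
  have hGc : ∀ e, IsCompact (G e) := fun e => isCompact_range (by fun_prop)
  have hGv : ∀ e, Convex ℝ (G e) := by
    rintro e _ ⟨x, rfl⟩ _ ⟨y, rfl⟩ s t hs ht hst
    obtain ⟨z, h1, h2⟩ := hconv x y s t hs ht hst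
    refine ⟨z, Prod.ext (by simp [h1]) ?_⟩
    simp only [h2, Prod.smul_mk, Prod.mk_add_mk, smul_eq_mul]
    linear_combination (-e) * hst
  have hdisj : Disjoint (G 0) (G ε) := by
    rw [Set.disjoint_left]
    rintro _ ⟨x, rfl⟩ ⟨y, hy⟩
    obtain rfl := hinj (congrArg Prod.fst hy)
    have := congrArg Prod.snd hy
    simp at this
    linarith
  obtain ⟨f, u, v, hu, huv, hv⟩ := geometric_hahn_banach_compact_closed (hGv 0) (hGc 0) (hGv ε)
    (hGc ε).isClosed hdisj
  obtain ⟨F, c, hc⟩ := exists_re_sum_eq (f.comp (ContinuousLinearMap.inl ℝ (ι → ℂ) ℝ))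
  have hf : ∀ q r, f (q, r) = (∑ i ∈ F, c i * q i).re + r * f (0, 1) := by
    intro q r
    have h1 : ((q, r) : (ι → ℂ) × ℝ) = (q, 0) + r • (0, 1) := by simp
    rw [h1, map_add, map_smul, ← hc]
    rfl
  obtain ⟨k, hk⟩ : ∃ k, k = f (0, 1) := ⟨_, rfl⟩
  simp only [← hk] at hf
  have hu' : ∀ x, (∑ i ∈ F, c i * p x i).re + (g x + 0) * k < u := fun x => by
    rw [← hf]; exact hu _ ⟨x, rfl⟩
  have hv' : ∀ x, v < (∑ i ∈ F, c i * p x i).re + (g x + ε) * k := fun x => by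
    rw [← hf]; exact hv _ ⟨x, rfl⟩
  clear hk
  -- The hyperplane is not vertical: going up by `ε` over `x₀` crosses it.
  have hk : 0 < k := by
    have h1 := hu' x₀
    have h2 := hv' x₀
    by_contra hk
    nlinarith
  -- Solving the hyperplane equation at level `u` for the height gives an affine function between
  -- `g` and `g + ε`; subtracting `ε / 2` centres it around `g`.
  refine ⟨F, fun i => ((-k⁻¹ : ℝ) : ℂ) * c i, k⁻¹ * u - ε / 2, fun x => ?_⟩
  have h3 : (∑ i ∈ F, ((-k⁻¹ : ℝ) : ℂ) * c i * p x i).re =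
      -k⁻¹ * (∑ i ∈ F, c i * p x i).re := by
    rw [← Complex.re_ofReal_mul, Finset.mul_sum]
    exact congrArg _ (Finset.sum_congr rfl fun i _ => mul_assoc _ _ _)
  rw [h3]
  have h1 := mul_lt_mul_of_pos_left (hu' x) (inv_pos.2 hk)
  have h2 := mul_lt_mul_of_pos_left (huv.trans (hv' x)) (inv_pos.2 hk)
  have h4 : ∀ r, k⁻¹ * ((∑ i ∈ F, c i * p x i).re + r * k) =
      k⁻¹ * (∑ i ∈ F, c i * p x i).re + r := fun r => by field_simp
  rw [h4] at h1 h2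
  rw [abs_lt]
  constructor <;> linarith

end Kadison

/-! ### Ordinary convexity of the scalar quasistates -/

section Convexity

theorem coef_injective : Function.Injective coef.{w} := fun S T h =>
  ContinuousLinearMap.ext fun x => by
    rw [← inner_unitVec_smul x, map_smul, map_smul, apply_unitVec, apply_unitVec, h]

theorem weakStarHasSum_fintype {H : Type*} [NormedAddCommGroup H] [InnerProductSpace ℂ H]
    {I : Type*} [Fintype I] (T : I → (H →L[ℂ] H)) : WeakStarHasSum T (∑ i, T i) := fun ξ η => by
  have h := map_sum (AddMonoidHom.mk' (normalFunctional ξ η) (normal_add ξ η)) T Finset.univ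
  simp only [AddMonoidHom.mk'_apply] at h
  rw [h]
  exact hasSum_fintype _

/-- The two-dimensional Hilbert space. -/
def Dim.two : Dim.{w} := ⟨ULift Bool, ⟨⟨true⟩⟩⟩

/-- The standard basis of the two-dimensional Hilbert space. -/
def basisVec (b : Bool) : HSpace Dim.two.{w} :=
  lp.single (E := fun _ : ULift.{w} Bool => ℂ) 2 (ULift.up b) 1

theorem norm_basisVec (b : Bool) : ‖basisVec.{w} b‖ = 1 := by
  have := lp.norm_single (E := fun _ : ULift.{w} Bool => ℂ) (p := 2) (by norm_num) (ULift.up b) 1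
  rw [norm_one] at this
  exact this

theorem inner_basisVec (b : Bool) (x : HSpace Dim.two.{w}) :
    ⟪basisVec b, x⟫_ℂ = x (ULift.up b : ULift.{w} Bool) := by
  have := lp.inner_single_left (G := fun _ : ULift.{w} Bool => ℂ) (𝕜 := ℂ) (ULift.up b) 1 x
  refine this.trans ?_
  simp

theorem basisVec_apply (b c : Bool) :
    basisVec.{w} b (ULift.up c : ULift.{w} Bool) = if b = c then 1 else 0 := by
  have := lp.coeFn_single (E := fun _ : ULift.{w} Bool => ℂ) 2 (ULift.up b) (1 : ℂ)
  refine (congrFun this (ULift.up c)).trans ?_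
  rcases eq_or_ne b c with rfl | h
  · simp
  · rw [if_neg h, Pi.single_eq_of_ne]
    simpa using h.symm

theorem inner_basisVec_basisVec (b c : Bool) :
    ⟪basisVec.{w} b, basisVec c⟫_ℂ = if c = b then 1 else 0 := by
  rw [inner_basisVec, basisVec_apply]

theorem eq_smul_basisVec_add (x : HSpace Dim.two.{w}) :
    ⟪basisVec true, x⟫_ℂ • basisVec true + ⟪basisVec false, x⟫_ℂ • basisVec false = x := by
  have h : ∀ (c d : ℂ) (b : Bool), (c • basisVec.{w} true + d • basisVec false :
      HSpace Dim.two.{w}) (ULift.up b : ULift.{w} Bool) = bif b then c else d := by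
    intro c d b
    have h1 : (c • basisVec.{w} true + d • basisVec false :
      HSpace Dim.two.{w}) (ULift.up b : ULift.{w} Bool) =
      c * (if true = b then 1 else 0) + d * (if false = b then 1 else 0) := by
      rw [← basisVec_apply.{w}, ← basisVec_apply.{w}]
      rfl
    rw [h1]
    cases b <;> simp
  refine lp.ext (funext fun i => ?_)
  refine (h _ _ (i : ULift.{w} Bool).down).trans ?_
  rw [inner_basisVec, inner_basisVec]
  obtain ⟨b⟩ : ULift.{w} Bool := i
  cases b <;> rfl

/-- The coordinate isometries of the two-dimensional Hilbert space. -/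
def basisIsometry (b : ULift.{w} Bool) : HSpace Dim.one.{w} →ₗᵢ[ℂ] HSpace Dim.two.{w} :=
  vecIsometry (basisVec b.down) (norm_basisVec _)

theorem adjoint_basisIsometry (b : ULift.{w} Bool) (x : HSpace Dim.two.{w}) :
    ContinuousLinearMap.adjoint (basisIsometry b).toContinuousLinearMap x =
      ⟪basisVec b.down, x⟫_ℂ • unitVec := by
  rw [basisIsometry, adjoint_vecIsometry]

theorem basisIsometry_unitVec (b : ULift.{w} Bool) : basisIsometry b unitVec = basisVec b.down :=
  vecIsometry_unitVec _ _

theorem sum_ulift_bool {M : Type*} [AddCommMonoid M] (f : ULift.{w} Bool → M) :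
    ∑ b, f b = f ⟨true⟩ + f ⟨false⟩ := by
  rw [← Equiv.ulift.symm.sum_comp, Fintype.sum_bool]
  rfl

theorem isDecomposition_basisIsometry : IsDecomposition basisIsometry.{w} := by
  have h := weakStarHasSum_fintype fun b : ULift.{w} Bool => expand (basisIsometry b) 1
  have h1 : ∑ b : ULift.{w} Bool, expand (basisIsometry b) 1 = 1 := by
    refine ContinuousLinearMap.ext fun x => ?_
    rw [_root_.sum_apply, sum_ulift_bool]
    simp only [expand_one_apply, adjoint_basisIsometry, map_smul, basisIsometry_unitVec]
    exact eq_smul_basisVec_add x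
  rw [h1] at h
  exact h

theorem inner_of_weakStarHasSum_basisIsometry {T : ULift.{w} Bool → Mat Dim.one.{w}}
    {S : Mat Dim.two.{w}} (h : WeakStarHasSum (fun b => expand (basisIsometry b) (T b)) S)
    (x : HSpace Dim.two.{w}) :
    ⟪x, S x⟫_ℂ = ((‖⟪basisVec true, x⟫_ℂ‖ : ℂ)) ^ 2 * coef (T ⟨true⟩) +
      ((‖⟪basisVec false, x⟫_ℂ‖ : ℂ)) ^ 2 * coef (T ⟨false⟩) := by
  refine (h.hasSum_inner x x).unique ?_
  rw [← sum_ulift_bool fun b => ((‖⟪basisVec b.down, x⟫_ℂ‖ : ℂ)) ^ 2 * coef (T b)]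
  refine Eq.subst (motive := fun f => HasSum f _) (funext fun b => ?_) (hasSum_fintype _)
  rw [inner_expand, adjoint_basisIsometry, map_smul, inner_smul_left, inner_smul_right, ← mul_assoc,
    RCLike.conj_mul]
  rfl

variable {E : Type u} [AddCommGroup E] [Module ℂ E] [StarAddMonoid E]
  [MatrixNorm E] [MatrixCone E]

/-- The set of quasistates is convex, and nc affine functions are affine on it. -/
theorem exists_quasistate_convexCombination (hE : IsOperatorSpace E)
    (x y : quasistateSpace.{u, w} E Dim.one) {s t : ℝ} (hs : 0 ≤ s) (ht : 0 ≤ t) (hst : s + t = 1) :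
    ∃ z : quasistateSpace.{u, w} E Dim.one, ∀ a : A (quasistateSpace.{u, w} E),
      coef (a.1 Dim.one z) = s * coef (a.1 Dim.one x) + t * coef (a.1 Dim.one y) := by
  have hK := isCompactNCConvex_quasistateSpace.{u, w} hE
  let xs : ULift.{w} Bool → quasistateSpace.{u, w} E Dim.one := fun b => bif b.down then x else y
  let Y : E →ₗ[ℂ] Mat Dim.two.{w} := ∑ b, expand (basisIsometry b) ∘ₗ (xs b).1
  have hY : IsDirectSum basisIsometry (fun b => (xs b).1) Y := fun v => by
    have := weakStarHasSum_fintype fun b => expand (basisIsometry b) ((xs b).1 v)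
    simpa [Y] using this
  have hC : ∃ C : ℝ, ∀ b, CBBound C (xs b).1 := ⟨1, fun b => (xs b).2.1⟩
  let Y' : quasistateSpace.{u, w} E Dim.two := ⟨Y, hK.directSum _ _ _ basisIsometry _ Y
    (fun b => (xs b).2) hC isDecomposition_basisIsometry hY⟩
  -- The vector state of `x ⊕ y` at this unit vector is `s x + t y`. Since it is built from a direct
  -- sum and a compression, every nc affine function respects it.
  let ζ : HSpace Dim.two.{w} :=
    (Real.sqrt s : ℂ) • basisVec true + (Real.sqrt t : ℂ) • basisVec false
  have h1 : ((‖⟪basisVec true, ζ⟫_ℂ‖ : ℂ)) ^ 2 = s := by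
    simp only [ζ, inner_add_right, inner_smul_right, inner_basisVec_basisVec]
    simp [← Complex.ofReal_pow, Real.sq_sqrt hs]
  have h2 : ((‖⟪basisVec false, ζ⟫_ℂ‖ : ℂ)) ^ 2 = t := by
    simp only [ζ, inner_add_right, inner_smul_right, inner_basisVec_basisVec]
    simp [← Complex.ofReal_pow, Real.sq_sqrt ht]
  have hζn : ‖ζ‖ = 1 := by
    -- For the decomposition of the identity, the formula reads `‖ζ‖² = s + t`.
    have h3 := inner_of_weakStarHasSum_basisIsometry isDecomposition_basisIsometry ζ
    have h4 : coef (1 : Mat Dim.one.{w}) = 1 := by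
      simp [coef, inner_self_eq_norm_sq_to_K, norm_unitVec]
    rw [h1, h2, h4, mul_one, mul_one, ← Complex.ofReal_add, hst] at h3
    have h5 := (inner_self_eq_norm_sq_to_K (𝕜 := ℂ) ζ).symm.trans h3
    have h6 : ‖ζ‖ ^ 2 = 1 := Complex.ofReal_injective (by simpa using h5)
    exact (pow_eq_one_iff_of_nonneg (norm_nonneg ζ) two_ne_zero).1 h6
  refine ⟨vectorState hK Y' ζ hζn, fun a => ?_⟩
  rw [← inner_eval_eq_coef, inner_of_weakStarHasSum_basisIsometry
    (a.2.directSum _ _ _ basisIsometry xs Y' hC isDecomposition_basisIsometry hY), h1, h2]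
  rfl

end Convexity

/-! ### Every pointed nc function comes from an element -/

section Surjectivity

variable {S : Type u} [AddCommGroup S] [Module ℂ S] [StarAddMonoid S] [StarModule ℂ S]
  [MatrixNorm S] [MatrixCone S]

/-- The quasistates norm `S`, and at every level they are controlled by their numerical radius.
Uniform convergence on `K_1` therefore implies convergence in `S`. -/
theorem matNorm_one_le_of_coef_le (hS : IsOperatorSystem S) (s : S) {M : ℝ} (hM : 0 ≤ M)
    (h : ∀ x : quasistateSpace.{u, w} S Dim.one, ‖coef (x.1 s)‖ ≤ M) :
    matNorm 1 (fun _ _ : Fin 1 => s) ≤ 4 * M := by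
  have hE := hS.completeMatrixOrdered.operatorSpace
  refine (hS.inclusion_isometric 1 (fun _ _ : Fin 1 => s)).symm.trans_le ?_
  refine matNorm_inclusion_le_of_forall.{u, w} hE _ (by positivity) fun d φ hφ => ?_
  refine (matNorm_one_eq (φ s)).trans_le ?_
  exact norm_eval_le_of_coef_le (isCompactNCConvex_quasistateSpace hE) ⟨_, eval_mem_A s⟩ hM h d
    ⟨φ, hφ⟩

/-- Continuous affine functions on the quasistate space are uniformly approximated by elements. -/
theorem exists_approx_re (hS : IsOperatorSystem S) (g : quasistateSpace.{u, w} S Dim.one → ℝ)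
    (hg : @Continuous _ _ (levelTopology _ _) _ g)
    (hconv : ∀ (x y z : quasistateSpace.{u, w} S Dim.one) (s t : ℝ),
      (∀ a : A (quasistateSpace.{u, w} S),
        coef (a.1 Dim.one z) = s * coef (a.1 Dim.one x) + t * coef (a.1 Dim.one y)) →
      g z = s * g x + t * g y)
    (h0 : g (zeroQuasistate hS) = 0) {ε : ℝ} (hε : 0 < ε) :
    ∃ s : S, ∀ x, ‖(g x : ℂ) - coef (x.1 s)‖ < ε := by
  have hE := hS.completeMatrixOrdered.operatorSpace
  let _ := levelTopology (quasistateSpace.{u, w} S) Dim.one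
  have := compactSpace_level (isCompactNCConvex_quasistateSpace.{u, w} hE) Dim.one
  obtain ⟨F, c, d, h⟩ := exists_affine_approx
    (fun (x : quasistateSpace.{u, w} S Dim.one) (s : S) => coef (x.1 s))
    (continuous_pi fun s => continuous_coef_eval ⟨_, eval_mem_A s⟩)
    (fun x y hxy => Subtype.ext (LinearMap.ext fun s => coef_injective (congrFun hxy s))) g hg
    (fun x y s t hs ht hst => by
      obtain ⟨z, hz⟩ := exists_quasistate_convexCombination hE x y hs ht hst
      refine ⟨z, funext fun v => ?_, hconv x y z s t hz⟩
      simpa using hz ⟨_, eval_mem_A v⟩) (half_pos hε)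
  let s₀ : S := ∑ i ∈ F, c i • i
  have hs₀ : ∀ x : quasistateSpace.{u, w} S Dim.one,
      ∑ i ∈ F, c i * coef (x.1 i) = coef (x.1 s₀) := fun x => by
    simp only [s₀, map_sum, map_smul, coef_sum, coef_smul]
  have hd := h (zeroQuasistate hS)
  simp only [hs₀] at h hd
  have hz : coef ((zeroQuasistate.{u, w} hS).1 s₀) = 0 := by simp [zeroQuasistate, coef]
  rw [h0, hz] at hd
  simp only [Complex.zero_re, sub_zero, zero_sub, abs_neg] at hd
  -- The self-adjoint part of `s₀` evaluates to the real part. The constant `d` is dropped at a cost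
  -- below `ε / 2`, because `g` and `s₀` both vanish at the zero quasistate.
  refine ⟨(1 / 2 : ℂ) • (s₀ + star s₀), fun x => ?_⟩
  have h1 : coef (x.1 ((1 / 2 : ℂ) • (s₀ + star s₀))) = ((coef (x.1 s₀)).re : ℂ) := by
    rw [map_smul, coef_smul, map_add, coef_add, x.2.2.map_star, coef_star, Complex.re_eq_add_conj]
    simp only [RCLike.star_def]
    ring
  rw [h1, ← Complex.ofReal_sub, Complex.norm_real, Real.norm_eq_abs]
  have h2 := h x
  rw [abs_lt] at h2 hd ⊢
  constructor <;> linarith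

theorem exists_approx (hS : IsOperatorSystem S) (a : A (quasistateSpace.{u, w} S))
    (ha : a.1 Dim.one (zeroQuasistate hS) = 0) {ε : ℝ} (hε : 0 < ε) :
    ∃ s : S, ∀ x : quasistateSpace.{u, w} S Dim.one,
      ‖coef (a.1 Dim.one x) - coef (x.1 s)‖ < ε := by
  have h0 : coef (a.1 Dim.one (zeroQuasistate hS)) = 0 := by simp [ha, coef]
  let _ := levelTopology (quasistateSpace.{u, w} S) Dim.one
  obtain ⟨s, hs⟩ := exists_approx_re hS (fun x => (coef (a.1 Dim.one x)).re)
    (Complex.continuous_re.comp (continuous_coef_eval a))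
    (fun x y z s t h => by simp [h a]) (by simp [h0]) (half_pos hε)
  obtain ⟨t, ht⟩ := exists_approx_re hS (fun x => (coef (a.1 Dim.one x)).im)
    (Complex.continuous_im.comp (continuous_coef_eval a))
    (fun x y z s t h => by simp [h a]) (by simp [h0]) (half_pos hε)
  refine ⟨s + Complex.I • t, fun x => ?_⟩
  rw [map_add, map_smul, coef_add, coef_smul]
  have h1 : coef (a.1 Dim.one x) - (coef (x.1 s) + Complex.I * coef (x.1 t)) =
      (((coef (a.1 Dim.one x)).re : ℂ) - coef (x.1 s)) +
        Complex.I * (((coef (a.1 Dim.one x)).im : ℂ) - coef (x.1 t)) := by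
    conv_lhs => rw [← Complex.re_add_im (coef (a.1 Dim.one x))]
    ring
  rw [h1]
  refine (norm_add_le _ _).trans_lt ?_
  rw [norm_mul, Complex.norm_I, one_mul]
  linarith [hs x, ht x]

/-- Every pointed continuous affine nc function on the nc quasistate space is evaluation at an
element. -/
theorem exists_eq_eval (hS : IsOperatorSystem S) (a : A (quasistateSpace.{u, w} S))
    (ha : a.1 Dim.one (zeroQuasistate hS) = 0) :
    ∃ s : S, ∀ (n : Dim.{w}) (x : quasistateSpace.{u, w} S n), a.1 n x = x.1 s := by
  have hE := hS.completeMatrixOrdered.operatorSpace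
  choose s hs using fun k : ℕ => exists_approx hS a ha (Nat.one_div_pos_of_nat (α := ℝ) (n := k))
  have hlim : ∀ ε > (0 : ℝ), ∃ N : ℕ, ∀ k : ℕ, k ≥ N → 1 / ((k : ℝ) + 1) < ε := fun ε hε => by
    obtain ⟨N, hN⟩ := exists_nat_one_div_lt hε
    refine ⟨N, fun k hk => lt_of_le_of_lt ?_ hN⟩
    exact Nat.one_div_le_one_div hk
  -- The differences of the approximants are uniformly small on `K_1`, hence small in `S`; `ε / 8`
  -- absorbs the factor `4`.
  obtain ⟨t, ht⟩ := hS.completeMatrixOrdered.complete s (fun ε hε => by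
    obtain ⟨N, hN⟩ := hlim (ε / 16) (by positivity)
    refine ⟨N, fun k hk l hl => ?_⟩
    refine (matNorm_one_le_of_coef_le.{u, w} hS (M := ε / 8) _ (by positivity) fun x => ?_).trans_lt
      (by linarith)
    have h1 := norm_sub_le (coef (a.1 Dim.one x) - coef (x.1 (s l)))
      (coef (a.1 Dim.one x) - coef (x.1 (s k)))
    have h2 : coef (x.1 (s k - s l)) = coef (a.1 Dim.one x) - coef (x.1 (s l)) -
        (coef (a.1 Dim.one x) - coef (x.1 (s k))) := by
      rw [sub_eq_add_neg, ← neg_one_smul ℂ, map_add, map_smul, coef_add, coef_smul]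
      ring
    rw [h2]
    linarith [hs k x, hs l x, hN k hk, hN l hl])
  refine ⟨t, ?_⟩
  have key : a = ⟨_, eval_mem_A t⟩ := by
    refine A.ext_of_coef (isCompactNCConvex_quasistateSpace hE) fun x => ?_
    rw [← sub_eq_zero, ← norm_le_zero_iff]
    refine le_of_forall_pos_le_add fun ε hε => ?_
    obtain ⟨N, hN⟩ := hlim (ε / 2) (by positivity)
    obtain ⟨N', hN'⟩ := ht (ε / 2) (by positivity)
    have h1 := hs (max N N') x
    have h2 := hN _ (le_max_left N N')
    have h3 := (norm_coef_le _).trans (x.2.norm_apply_le (s (max N N') - t))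
    have h4 := hN' _ (le_max_right N N')
    have h5 : coef (a.1 Dim.one x) - coef (x.1 t) =
        (coef (a.1 Dim.one x) - coef (x.1 (s (max N N')))) + coef (x.1 (s (max N N') - t)) := by
      rw [sub_eq_add_neg (s _), ← neg_one_smul ℂ, map_add, map_smul, coef_add, coef_smul]
      ring
    change ‖coef (a.1 Dim.one x) - coef (x.1 t)‖ ≤ _
    rw [h5]
    refine (norm_add_le _ _).trans ?_
    linarith
  intro n x
  rw [key]

end Surjectivity

/-! ### Hahn-Banach separation for matrix cones -/

section Separation

variable {E : Type u} [AddCommGroup E] [Module ℂ E] [StarAddMonoid E] [StarModule ℂ E]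
  [MatrixNorm E] [MatrixCone E] {n : ℕ}

/-- Conjugation by the scalar matrix `√c · 1` is multiplication by `c`. -/
theorem IsMatrixCone.smul_mem (hE : IsMatrixCone E) {x : Matrix (Fin n) (Fin n) E}
    (hx : x ∈ cone (E := E) n) {c : ℝ} (hc : 0 ≤ c) : (c : ℂ) • x ∈ cone (E := E) n := by
  have h := hE.conj_mem n n ((Real.sqrt c : ℂ) • 1) x hx
  have h1 : scalarMul ((Real.sqrt c : ℂ) • 1) x
      (((Real.sqrt c : ℂ) • (1 : Matrix (Fin n) (Fin n) ℂ)).conjTranspose) = (c : ℂ) • x := by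
    ext1 i j
    rw [scalarMul, Finset.sum_eq_single i, Finset.sum_eq_single j]
    · rw [Matrix.conjTranspose_smul, Matrix.conjTranspose_one]
      simp only [Matrix.smul_apply, Matrix.one_apply_eq, smul_eq_mul, mul_one, RCLike.star_def,
        Complex.conj_ofReal]
      rw [← Complex.ofReal_mul, Real.mul_self_sqrt hc]
    · intro b _ hb
      simp [hb.symm]
    · simp
    · intro b _ hb
      simp [hb.symm]
    · simp
  rwa [h1] at h

theorem IsMatrixCone.zero_mem (hE : IsMatrixCone E) (n : ℕ) :
    (0 : Matrix (Fin n) (Fin n) E) ∈ cone (E := E) n :=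
  ((hE.inter_neg n 0).2 rfl).1

/-- The distance to the negative of the cone. -/
def coneGauge (x : Matrix (Fin n) (Fin n) E) : ℝ :=
  ⨅ p : cone (E := E) n, matNorm n (x + p.1)

theorem coneGauge_le (hE : IsOperatorSpace E) (x : Matrix (Fin n) (Fin n) E)
    {p : Matrix (Fin n) (Fin n) E} (hp : p ∈ cone (E := E) n) : coneGauge x ≤ matNorm n (x + p) :=
  ciInf_le ⟨0, by rintro _ ⟨q, rfl⟩; exact hE.matNorm_nonneg _⟩ (⟨p, hp⟩ : cone (E := E) n)

theorem le_coneGauge (hP : IsMatrixCone E) (x : Matrix (Fin n) (Fin n) E) {c : ℝ}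
    (h : ∀ p ∈ cone (E := E) n, c ≤ matNorm n (x + p)) : c ≤ coneGauge x :=
  have : Nonempty (cone (E := E) n) := ⟨⟨0, hP.zero_mem n⟩⟩
  le_ciInf fun p => h p.1 p.2

theorem coneGauge_nonneg (hE : IsOperatorSpace E) (hP : IsMatrixCone E)
    (x : Matrix (Fin n) (Fin n) E) : 0 ≤ coneGauge x :=
  le_coneGauge hP x fun _ _ => hE.matNorm_nonneg _

theorem real_smul_eq (c : ℝ) (x : Matrix (Fin n) (Fin n) E) : c • x = (c : ℂ) • x := rfl

theorem coneGauge_smul (hE : IsOperatorSpace E) (hP : IsMatrixCone E) {c : ℝ} (hc : 0 < c)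
    (x : Matrix (Fin n) (Fin n) E) : coneGauge (c • x) = c * coneGauge x := by
  have key : ∀ {c : ℝ}, 0 < c → ∀ x : Matrix (Fin n) (Fin n) E,
      coneGauge (c • x) ≤ c * coneGauge x := by
    intro c hc x
    rw [← div_le_iff₀' hc]
    refine le_coneGauge hP x fun p hp => ?_
    rw [div_le_iff₀' hc]
    refine (coneGauge_le hE _ (hP.smul_mem hp hc.le)).trans_eq ?_
    rw [real_smul_eq, ← smul_add, hE.smul_eq, Complex.norm_real, Real.norm_of_nonneg hc.le]
  refine le_antisymm (key hc x) ?_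
  have h := key (inv_pos.2 hc) (c • x)
  rwa [inv_smul_smul₀ hc.ne', ← div_eq_inv_mul, le_div_iff₀' hc] at h

theorem coneGauge_add (hE : IsOperatorSpace E) (hP : IsMatrixCone E)
    (x y : Matrix (Fin n) (Fin n) E) : coneGauge (x + y) ≤ coneGauge x + coneGauge y := by
  rw [← sub_le_iff_le_add]
  refine le_coneGauge hP x fun p hp => ?_
  rw [sub_le_comm]
  refine le_coneGauge hP y fun q hq => ?_
  rw [sub_le_iff_le_add]
  refine (coneGauge_le hE _ (hP.add_mem n q hq p hp)).trans ?_
  refine le_of_eq_of_le ?_ (hE.add_le n _ _)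
  congr 1
  abel

/-- Separation of a point from a matrix cone by a contractive positive real functional. -/
theorem exists_separating_real (hE : IsOperatorSpace E) (hP : IsMatrixCone E)
    {s : Matrix (Fin n) (Fin n) E} (hs : s ∉ cone (E := E) n) :
    ∃ g : Matrix (Fin n) (Fin n) E →ₗ[ℝ] ℝ, g s < 0 ∧ (∀ p ∈ cone (E := E) n, 0 ≤ g p) ∧
      ∀ x, g x ≤ matNorm n x := by
  have hs0 : s ≠ 0 := fun h => hs (h ▸ hP.zero_mem n)
  -- This is the distance from `s` to the cone, positive because the cone is closed.
  have hpos : 0 < coneGauge (-s) := by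
    have h1 := mt (hP.closed n s) hs
    push Not at h1
    obtain ⟨ε, hε, h⟩ := h1
    refine hε.trans_le (le_coneGauge hP _ fun p hp => (h p hp).trans_eq ?_)
    have h2 := hE.smul_eq n (-1) (s - p)
    rw [norm_neg, norm_one, one_mul, neg_one_smul] at h2
    rw [← h2]
    congr 1
    abel
  -- Domination by `coneGauge` yields both remaining properties: the gauge is at most the norm, and
  -- it vanishes at `-p` for positive `p`.
  obtain ⟨g, hg1, hg2⟩ := exists_extension_of_le_sublinear
    (LinearPMap.mkSpanSingleton s (-coneGauge (-s)) hs0) coneGauge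
    (fun c hc x => coneGauge_smul hE hP hc x) (coneGauge_add hE hP) (by
      rintro ⟨x, hx⟩
      obtain ⟨c, rfl⟩ := Submodule.mem_span_singleton.1 hx
      have h0 := LinearPMap.mkSpanSingleton'_apply s (-coneGauge (-s))
        (fun c hc => by simp [(smul_eq_zero.1 hc).resolve_right hs0]) c hx
      refine (le_of_eq h0).trans ?_
      change c • -coneGauge (-s) ≤ coneGauge (c • s)
      rw [smul_eq_mul]
      rcases lt_or_ge c 0 with hc | hc
      · have h1 := coneGauge_smul hE hP (neg_pos.2 hc) (-s)
        rw [neg_smul, smul_neg, neg_neg] at h1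
        linarith
      · have := coneGauge_nonneg hE hP (c • s)
        nlinarith)
  refine ⟨g, ?_, fun p hp => ?_, fun x => ?_⟩
  · have h1 := hg1 ⟨s, Submodule.mem_span_singleton_self s⟩
    have h2 := LinearPMap.mkSpanSingleton_apply ℝ ℝ (σ := RingHom.id ℝ) hs0 (-coneGauge (-s))
    rw [h1]
    refine (le_of_eq h2).trans_lt (by linarith)
  · have h1 := hg2 (-p)
    have h2 := coneGauge_le hE (-p) hp
    rw [neg_add_cancel, (hE.eq_zero_iff n 0).2 rfl] at h2
    rw [map_neg] at h1
    linarith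
  · have h2 := coneGauge_le hE x (hP.zero_mem n)
    rw [add_zero] at h2
    exact (hg2 x).trans h2

/-- Separation of a self-adjoint point from a matrix cone by a bounded positive functional. -/
theorem exists_separating_complex (hE : IsOperatorSpace E) (hP : IsMatrixCone E)
    (hstar : ∀ (n : ℕ) (x : Matrix (Fin n) (Fin n) E), matNorm n x.conjTranspose = matNorm n x)
    {s : Matrix (Fin n) (Fin n) E} (hs : s ∉ cone (E := E) n) (hsa : s.conjTranspose = s) :
    ∃ f : Matrix (Fin n) (Fin n) E →ₗ[ℂ] ℂ, (f s).re < 0 ∧ (∀ p ∈ cone (E := E) n, 0 ≤ f p) ∧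
      (∀ x, f x.conjTranspose = star (f x)) ∧ ∀ x, ‖f x‖ ≤ 2 * matNorm n x := by
  obtain ⟨g, hg1, hg2, hg3⟩ := exists_separating_real hE hP hs
  -- Averaging over the involution makes the complexification `h(x) - i h(i x)` Hermitian and leaves
  -- `g` unchanged on self-adjoint elements. The factor `2` in the norm bound comes from its two
  -- terms.
  let h : Matrix (Fin n) (Fin n) E → ℝ := fun x => (g x + g x.conjTranspose) / 2
  have hadd : ∀ x y, h (x + y) = h x + h y := fun x y => by
    simp only [h, Matrix.conjTranspose_add, map_add]; ring
  have hct : ∀ (c : ℝ) (x : Matrix (Fin n) (Fin n) E), ((c : ℂ) • x).conjTranspose =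
      (c : ℂ) • x.conjTranspose := fun c x => by
    rw [Matrix.conjTranspose_smul, RCLike.star_def, Complex.conj_ofReal]
  have hsmul : ∀ (c : ℝ) x, h ((c : ℂ) • x) = c * h x := fun c x => by
    simp only [h, hct]
    rw [← real_smul_eq, ← real_smul_eq, map_smul, map_smul, smul_eq_mul, smul_eq_mul]
    ring
  have hneg : ∀ x, h (-x) = -h x := fun x => by
    simp only [h, Matrix.conjTranspose_neg, map_neg]; ring
  have hstar' : ∀ x, h x.conjTranspose = h x := fun x => by
    simp only [h, Matrix.conjTranspose_conjTranspose]; ring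
  have hsa' : ∀ x : Matrix (Fin n) (Fin n) E, x.conjTranspose = x → h x = g x := fun x hx => by
    simp only [h, hx]; ring
  have hIstar : ∀ x, h (Complex.I • x.conjTranspose) = -h (Complex.I • x) := fun x => by
    rw [← hstar' (Complex.I • x), Matrix.conjTranspose_smul, RCLike.star_def, Complex.conj_I,
      neg_smul, hneg, neg_neg]
  have hb : ∀ x, |h x| ≤ matNorm n x := fun x => by
    have hm : ∀ y, matNorm n (-y) = matNorm n y := fun y => by
      have h2 := hE.smul_eq n (-1) y
      rwa [norm_neg, norm_one, one_mul, neg_one_smul] at h2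
    have h1 := hg3 x
    have h2 := hg3 x.conjTranspose
    have h3 := hg3 (-x)
    have h4 := hg3 (-x.conjTranspose)
    rw [hm, map_neg] at h3 h4
    rw [hstar] at h2 h4
    rw [abs_le]
    constructor <;> simp only [h] <;> linarith
  let f : Matrix (Fin n) (Fin n) E →ₗ[ℂ] ℂ :=
    { toFun := fun x => (h x : ℂ) - Complex.I * h (Complex.I • x)
      map_add' := fun x y => by
        rw [smul_add, hadd, hadd]; push_cast; ring
      map_smul' := fun c x => by
        have h1 : ∀ y : Matrix (Fin n) (Fin n) E, h (c • y) = c.re * h y + c.im * h (Complex.I • y) := by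
          intro y
          conv_lhs => rw [← Complex.re_add_im c, add_smul, mul_smul, hadd, hsmul, hsmul]
        rw [smul_comm Complex.I c x, h1, h1, smul_smul, Complex.I_mul_I, neg_one_smul, hneg,
          RingHom.id_apply, smul_eq_mul]
        apply Complex.ext <;> simp
        ring }
  have hf : ∀ x, f x = (h x : ℂ) - Complex.I * h (Complex.I • x) := fun x => rfl
  have hfsa : ∀ x : Matrix (Fin n) (Fin n) E, x.conjTranspose = x → f x = g x := fun x hx => by
    have h1 := hIstar x
    rw [hx] at h1
    have h2 : h (Complex.I • x) = 0 := by linarith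
    rw [hf, h2, hsa' x hx]
    simp
  refine ⟨f, ?_, fun p hp => ?_, fun x => ?_, fun x => ?_⟩
  · rw [hfsa s hsa]
    exact hg1
  · rw [hfsa p (hP.selfAdjoint n p hp)]
    exact Complex.zero_le_real.2 (hg2 p hp)
  · rw [hf, hf, hstar', hIstar]
    simp
  · rw [hf]
    refine (norm_sub_le _ _).trans ?_
    rw [norm_mul, Complex.norm_I, one_mul, Complex.norm_real, Complex.norm_real, Real.norm_eq_abs,
      Real.norm_eq_abs]
    have h1 := hb x
    have h2 := hb (Complex.I • x)
    rw [hE.smul_eq, Complex.norm_I, one_mul] at h2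
    linarith

theorem l2_opNorm_le_of_sum_sq {m : ℕ} (M : Matrix (Fin m) (Fin n) ℂ) {c : ℝ} (hc : 0 ≤ c)
    (h : ∑ i, ∑ j, ‖M i j‖ ^ 2 ≤ c ^ 2) : ‖M‖ ≤ c := by
  rw [Matrix.l2_opNorm_def]
  refine ContinuousLinearMap.opNorm_le_bound _ hc fun x => ?_
  refine le_of_sq_le_sq ?_ (by positivity)
  rw [mul_pow, EuclideanSpace.norm_sq_eq, EuclideanSpace.norm_sq_eq]
  refine le_trans ?_ (mul_le_mul_of_nonneg_right h (by positivity))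
  rw [Finset.sum_mul]
  refine Finset.sum_le_sum fun i _ => ?_
  change ‖∑ j, M i j * x j‖ ^ 2 ≤ _
  have h1 : ‖∑ j, M i j * x j‖ ≤ ∑ j, ‖M i j‖ * ‖x j‖ :=
    (norm_sum_le _ _).trans (by simp)
  exact (pow_le_pow_left₀ (norm_nonneg _) h1 2).trans (Finset.sum_mul_sq_le_sq_mul_sq _ _ _)

/-- The matrix cones of a matrix ordered operator space are determined by the ccp maps into
matrix algebras. -/
theorem mem_cone_of_forall_isCCP (hE : IsOperatorSpace E) (hP : IsMatrixCone E)
    (hstar : ∀ (n : ℕ) (x : Matrix (Fin n) (Fin n) E), matNorm n x.conjTranspose = matNorm n x)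
    {s : Matrix (Fin n) (Fin n) E} (hsa : s.conjTranspose = s)
    (h : ∀ φ : E →ₗ[ℂ] (EuclideanSpace ℂ (Fin n) →L[ℂ] EuclideanSpace ℂ (Fin n)), IsCCP φ →
      s.map φ ∈ cone (E := EuclideanSpace ℂ (Fin n) →L[ℂ] EuclideanSpace ℂ (Fin n)) n) :
    s ∈ cone (E := E) n := by
  by_contra hs
  obtain ⟨f, hf1, hf2, hf3, hf4⟩ := exists_separating_complex hE hP hstar hs hsa
  -- The correspondence between functionals on `M_n(E)` and maps `E → M_n`. The factor `1 / 2` in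
  -- `φ` compensates for the bound `2` on the norm of `f`.
  let φ₀ : E →ₗ[ℂ] Matrix (Fin n) (Fin n) ℂ :=
    { toFun := fun v => Matrix.of fun i j => f (Matrix.single i j v)
      map_add' := fun v w => by ext i j; simp [Matrix.single_add]
      map_smul' := fun c v => by ext i j; simp [← Matrix.smul_single] }
  let φ : E →ₗ[ℂ] (EuclideanSpace ℂ (Fin n) →L[ℂ] EuclideanSpace ℂ (Fin n)) :=
    { toFun := fun v => (1 / 2 : ℂ) • Matrix.toEuclideanCLM (n := Fin n) (𝕜 := ℂ) (φ₀ v)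
      map_add' := fun v w => by rw [map_add, map_add, smul_add]
      map_smul' := fun c v => by rw [map_smul, map_smul, smul_comm, RingHom.id_apply] }
  have hinner : ∀ (v : E) (ξ η : EuclideanSpace ℂ (Fin n)),
      ⟪ξ, φ v η⟫_ℂ = (1 / 2 : ℂ) * ∑ i, ∑ j, star (ξ i) * η j * f (Matrix.single i j v) := by
    intro v ξ η
    change ⟪ξ, ((1 / 2 : ℂ) • Matrix.toEuclideanCLM (n := Fin n) (𝕜 := ℂ) (φ₀ v)) η⟫_ℂ = _
    rw [smul_apply, inner_smul_right, PiLp.inner_apply]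
    congr 1
    refine Finset.sum_congr rfl fun i _ => ?_
    rw [Matrix.ofLp_toEuclideanCLM]
    simp only [Matrix.mulVec, dotProduct, RCLike.inner_apply, φ₀, LinearMap.coe_mk, AddHom.coe_mk,
      Matrix.of_apply, Finset.sum_mul, RCLike.star_def]
    refine Finset.sum_congr rfl fun j _ => ?_
    ring
  let M : ∀ {k : ℕ}, (Fin k → EuclideanSpace ℂ (Fin n)) → Matrix (Fin n) (Fin k) ℂ :=
    fun ξ => Matrix.of fun i a => star (ξ a i)
  -- The form of `φ_k` at `X` is half of `f` at a scalar multiple `A X B` in `M_n(E)`. With `B =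
  -- A^*`, positivity of `f` on the one cone `P_n` gives complete positivity; Ruan's axiom gives
  -- complete contractivity.
  have hsesq : ∀ {k : ℕ} (X : Matrix (Fin k) (Fin k) E) (ξ η : Fin k → EuclideanSpace ℂ (Fin n)),
      sesq (X.map φ) ξ η = (1 / 2 : ℂ) * f (scalarMul (M ξ) X (M η).conjTranspose) := by
    intro k X ξ η
    have h1 : scalarMul (M ξ) X (M η).conjTranspose = ∑ a, ∑ b, ∑ i, ∑ j,
        (star (ξ a i) * η b j) • Matrix.single i j (X a b) := by
      ext1 i j
      simp only [Matrix.sum_apply, Matrix.smul_apply, Matrix.single_apply, scalarMul]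
      refine Finset.sum_congr rfl fun a _ => Finset.sum_congr rfl fun b _ => ?_
      rw [Finset.sum_eq_single i, Finset.sum_eq_single j]
      · simp [M]
      · intro c _ hc
        simp [hc]
      · simp
      · intro c _ hc
        simp [hc]
      · simp
    rw [h1]
    simp only [map_sum, map_smul, sesq, Matrix.map_apply, hinner, Finset.mul_sum, smul_eq_mul]
  -- The norm of the family `ξ` is the Hilbert-Schmidt norm of `M ξ`.
  have hM : ∀ {k : ℕ} (ξ : Fin k → EuclideanSpace ℂ (Fin n)), ‖M ξ‖ ≤ ‖WithLp.toLp 2 ξ‖ := by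
    intro k ξ
    refine l2_opNorm_le_of_sum_sq _ (norm_nonneg _) ?_
    rw [← sqNorm_toLp, Finset.sum_comm]
    refine (Finset.sum_le_sum fun a _ => ?_)
    rw [EuclideanSpace.norm_sq_eq]
    simp [M]
  have hφ : IsCCP φ := by
    refine (isCCP_iff_sesq hE φ).2 ⟨fun k X ξ η => ?_, fun v ξ η => ?_, fun k X hX ξ => ?_⟩
    · rw [hsesq, norm_mul]
      have h1 := hf4 (scalarMul (M ξ) X (M η).conjTranspose)
      have h2 := hE.scalarMul_le n k (M ξ) X (M η).conjTranspose
      rw [Matrix.l2_opNorm_conjTranspose] at h2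
      have h3 : ‖M ξ‖ * matNorm k X * ‖M η‖ ≤
          ‖WithLp.toLp 2 ξ‖ * matNorm k X * ‖WithLp.toLp 2 η‖ := by
        have := hE.matNorm_nonneg X
        gcongr
        · exact hM ξ
        · exact hM η
      rw [sqNorm_toLp, sqNorm_toLp]
      have h4 : ‖(1 / 2 : ℂ)‖ = 1 / 2 := by simp
      rw [h4]
      nlinarith [mul_nonneg (hE.matNorm_nonneg X)
        (sq_nonneg (‖WithLp.toLp 2 ξ‖ - ‖WithLp.toLp 2 η‖))]
    · rw [hinner, hinner, star_mul', star_sum, Finset.sum_comm]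
      congr 1
      · simp
      · refine Finset.sum_congr rfl fun i _ => ?_
        rw [star_sum]
        refine Finset.sum_congr rfl fun j _ => ?_
        rw [star_mul', star_mul', star_star, ← hf3, Matrix.conjTranspose_single]
        ring
    · rw [hsesq]
      exact mul_nonneg (by simp) (hf2 _ (hP.conj_mem _ _ _ X hX))
  -- At the standard basis vectors the form of `φ_n` at `s` is `f s / 2`, whose real part is
  -- negative.
  have h1 := (mem_cone_iff_sesq _).1 (h φ hφ) (fun i => EuclideanSpace.single i 1)
  rw [hsesq] at h1
  have h2 : M (fun i : Fin n => EuclideanSpace.single i (1 : ℂ)) = 1 := by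
    ext i j
    simp [M, Matrix.one_apply]
  have h3 : scalarMul (1 : Matrix (Fin n) (Fin n) ℂ) s (1 : Matrix (Fin n) (Fin n) ℂ) = s := by
    ext1 i j
    rw [scalarMul, Finset.sum_eq_single i, Finset.sum_eq_single j] <;>
      simp +contextual [Matrix.one_apply, eq_comm]
  rw [h2, Matrix.conjTranspose_one, h3] at h1
  have h4 := (Complex.le_def.1 h1).1
  simp at h4
  linarith

end Separation

/-! ### The positive cone of operator matrices -/

section OperatorCone

variable {H : Type*} [NormedAddCommGroup H] [InnerProductSpace ℂ H] [CompleteSpace H] {m : ℕ}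

/-- Complex polarization. It is the source of self-adjointness of positive matrices and of `P_n ∩
-P_n = {0}`. -/
theorem eq_zero_of_sesq_self (T : Matrix (Fin m) (Fin m) (H →L[ℂ] H))
    (h : ∀ ξ : Fin m → H, sesq T ξ ξ = 0) : T = 0 := by
  refine (isOperatorSpace_op.eq_zero_iff m T).1 ?_
  change ‖blockOp T‖ = 0
  rw [norm_eq_zero, ← ContinuousLinearMap.coe_inj]
  refine (inner_map_self_eq_zero _).1 fun x => ?_
  rw [← inner_conj_symm]
  have := inner_blockOp T x x
  rw [h] at this
  change star ⟪x, blockOp T x⟫_ℂ = 0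
  rw [this, star_zero]

theorem conjTranspose_eq_of_mem_cone {T : Matrix (Fin m) (Fin m) (H →L[ℂ] H)}
    (hT : T ∈ cone (E := H →L[ℂ] H) m) : T.conjTranspose = T := by
  rw [← sub_eq_zero]
  refine eq_zero_of_sesq_self _ fun ξ => ?_
  have h := (mem_cone_iff_sesq T).1 hT ξ
  rw [sub_eq_add_neg, ← neg_one_smul ℂ, sesq_add, sesq_smul, sesq_conjTranspose,
    (IsSelfAdjoint.of_nonneg h).star_eq]
  ring

theorem mem_cone_of_forall_norm_sub_lt {T : Matrix (Fin m) (Fin m) (H →L[ℂ] H)}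
    (h : ∀ ε > 0, ∃ S ∈ cone (E := H →L[ℂ] H) m, matNorm m (T - S) < ε) :
    T ∈ cone (E := H →L[ℂ] H) m := by
  rw [mem_cone_iff_sesq]
  intro ξ
  have h0 : IsClosed {z : ℂ | 0 ≤ z} := isClosed_Ici
  refine h0.closure_subset (Metric.mem_closure_iff.2 fun ε hε => ?_)
  have hq := sqNorm_nonneg ξ
  obtain ⟨S, hS, hTS⟩ := h (ε / (sqNorm ξ + 1)) (by positivity)
  refine ⟨sesq S ξ ξ, (mem_cone_iff_sesq S).1 hS ξ, ?_⟩
  have h1 : sesq T ξ ξ - sesq S ξ ξ = sesq (T - S) ξ ξ := by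
    rw [sub_eq_add_neg T, ← neg_one_smul ℂ S, sesq_add, sesq_smul]
    ring
  have h2 := two_norm_sesq_le (T - S) hTS.le ξ ξ
  rw [dist_eq_norm, h1]
  have h3 : ε / (sqNorm ξ + 1) * (sqNorm ξ + sqNorm ξ) < 2 * ε := by
    rw [div_mul_eq_mul_div, div_lt_iff₀ (by positivity)]
    nlinarith
  linarith

end OperatorCone

/-! ### Pointed functions form an operator system -/

section PointedFunctions

variable {V : Type v} [AddCommGroup V] [Module ℂ V] [MatrixNorm V] {L : NCSet.{v, w} V}
  {y : L Dim.one}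

/-- Evaluation of pointed functions at a point. -/
def evalMap {n : Dim.{w}} (x : L n) : APointed L y →ₗ[ℂ] Mat n where
  toFun f := f.1 n x
  map_add' _ _ := rfl
  map_smul' _ _ := rfl

/-- A real `sSup` is `0` on unbounded sets, so this bound is what makes the uniform norm a genuine
supremum. -/
theorem bddAbove_norm_eval (hL : IsCompactNCConvex L) {k : ℕ} (a : Matrix (Fin k) (Fin k) (A L)) :
    BddAbove {r : ℝ | ∃ (n : Dim.{w}) (x : L n), r = matNorm k (evalMat a x)} := by
  choose M _ hM using fun f : A L => exists_norm_eval_le hL f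
  refine ⟨∑ i, ∑ j, M (a i j), ?_⟩
  rintro _ ⟨n, x, rfl⟩
  exact (matNorm_le_sum _).trans
    (Finset.sum_le_sum fun i _ => Finset.sum_le_sum fun j _ => hM (a i j) n x)

theorem matNorm_map_evalMap_le (hL : IsCompactNCConvex L) {k : ℕ}
    (a : Matrix (Fin k) (Fin k) (APointed L y)) {n : Dim.{w}} (x : L n) :
    matNorm k (a.map (evalMap x)) ≤ matNorm k a :=
  le_csSup (bddAbove_norm_eval hL (a.map APointed.toA)) ⟨n, x, rfl⟩

theorem matNorm_le_of_forall_evalMap {k : ℕ} (a : Matrix (Fin k) (Fin k) (APointed L y)) {M : ℝ}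
    (hM : 0 ≤ M) (h : ∀ (n : Dim.{w}) (x : L n), matNorm k (a.map (evalMap x)) ≤ M) :
    matNorm k a ≤ M := by
  refine Real.sSup_le ?_ hM
  rintro _ ⟨n, x, rfl⟩
  exact h n x

theorem APointed.ext_evalMap {k : ℕ} {a b : Matrix (Fin k) (Fin k) (APointed L y)}
    (h : ∀ (n : Dim.{w}) (x : L n), a.map (evalMap x) = b.map (evalMap x)) : a = b := by
  ext1 i j
  exact Subtype.ext (funext fun n => funext fun x => congrFun (congrFun (h n x) i) j)

theorem mem_cone_APointed_iff {k : ℕ} (a : Matrix (Fin k) (Fin k) (APointed L y)) :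
    a ∈ cone (E := APointed L y) k ↔
      ∀ (n : Dim.{w}) (x : L n), a.map (evalMap x) ∈ cone (E := Mat n) k :=
  Iff.rfl

theorem map_add_linear {E F : Type*} [AddCommGroup E] [Module ℂ E] [AddCommGroup F] [Module ℂ F]
    (φ : E →ₗ[ℂ] F) {k : ℕ} (a b : Matrix (Fin k) (Fin k) E) :
    (a + b).map φ = a.map φ + b.map φ :=
  Matrix.map_add _ (map_add φ) _ _

theorem map_smul_linear {E F : Type*} [AddCommGroup E] [Module ℂ E] [AddCommGroup F] [Module ℂ F]
    (φ : E →ₗ[ℂ] F) {k : ℕ} (c : ℂ) (a : Matrix (Fin k) (Fin k) E) :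
    (c • a).map φ = c • a.map φ :=
  Matrix.map_smul _ c (map_smul φ c) _

theorem map_sub_linear {E F : Type*} [AddCommGroup E] [Module ℂ E] [AddCommGroup F] [Module ℂ F]
    (φ : E →ₗ[ℂ] F) {k : ℕ} (a b : Matrix (Fin k) (Fin k) E) :
    (a - b).map φ = a.map φ - b.map φ :=
  Matrix.map_sub _ (map_sub φ) _ _

theorem map_conjTranspose_evalMap {k : ℕ} (a : Matrix (Fin k) (Fin k) (APointed L y)) {n : Dim.{w}}
    (x : L n) : a.conjTranspose.map (evalMap x) = (a.map (evalMap x)).conjTranspose := rfl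

theorem APointed.matNorm_nonneg (hL : IsCompactNCConvex L) {k : ℕ}
    (a : Matrix (Fin k) (Fin k) (APointed L y)) : 0 ≤ matNorm k a :=
  (matNorm_nonneg_op _).trans (matNorm_map_evalMap_le hL a y)

theorem isOperatorSpace_APointed (hL : IsCompactNCConvex L) : IsOperatorSpace (APointed L y) where
  eq_zero_iff k a := by
    constructor
    · intro h
      refine APointed.ext_evalMap fun n x => ?_
      have h1 : a.map (evalMap x) = 0 := (isOperatorSpace_op.eq_zero_iff k _).1
        (le_antisymm ((matNorm_map_evalMap_le hL a x).trans h.le) (matNorm_nonneg_op _))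
      rw [h1]
      rfl
    · rintro rfl
      refine le_antisymm (matNorm_le_of_forall_evalMap _ le_rfl fun n x => ?_)
        (APointed.matNorm_nonneg hL _)
      exact ((isOperatorSpace_op.eq_zero_iff k _).2 rfl).le
  add_le k a b := by
    refine matNorm_le_of_forall_evalMap _
      (add_nonneg (APointed.matNorm_nonneg hL _) (APointed.matNorm_nonneg hL _)) fun n x => ?_
    rw [map_add_linear]
    exact (isOperatorSpace_op.add_le k _ _).trans
      (add_le_add (matNorm_map_evalMap_le hL a x) (matNorm_map_evalMap_le hL b x))
  smul_eq k c a := by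
    have key : ∀ (c : ℂ) (a : Matrix (Fin k) (Fin k) (APointed L y)),
        matNorm k (c • a) ≤ ‖c‖ * matNorm k a := fun c a => by
      refine matNorm_le_of_forall_evalMap _
        (mul_nonneg (norm_nonneg _) (APointed.matNorm_nonneg hL _)) fun n x => ?_
      have h1 : (c • a).map (evalMap x) = c • a.map (evalMap x) := map_smul_linear _ c a
      rw [h1, isOperatorSpace_op.smul_eq]
      gcongr
      exact matNorm_map_evalMap_le hL a x
    refine le_antisymm (key c a) ?_
    by_cases hc : c = 0
    · simpa [hc] using APointed.matNorm_nonneg hL _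
    · have h := mul_le_mul_of_nonneg_left (key c⁻¹ (c • a)) (norm_nonneg c)
      rwa [inv_smul_smul₀ hc, norm_inv, mul_inv_cancel_left₀ (norm_ne_zero_iff.2 hc)] at h
  directSum m n a b := by
    have hblock : ∀ {d : Dim.{w}} (x : L d), matNorm (m + n) ((block a 0 0 b).map (evalMap x)) =
        max (matNorm m (a.map (evalMap x))) (matNorm n (b.map (evalMap x))) := by
      intro d x
      rw [← isOperatorSpace_op.directSum]
      congr 1
      ext1 i j
      refine Fin.addCases (fun i => ?_) (fun i => ?_) i <;>
        refine Fin.addCases (fun j => ?_) (fun j => ?_) j <;> simp [block]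
    apply le_antisymm
    · refine matNorm_le_of_forall_evalMap _
        ((APointed.matNorm_nonneg hL a).trans (le_max_left _ _)) fun d x => ?_
      rw [hblock]
      exact max_le_max (matNorm_map_evalMap_le hL a x) (matNorm_map_evalMap_le hL b x)
    · have h0 := APointed.matNorm_nonneg hL (block a 0 0 b)
      refine max_le (matNorm_le_of_forall_evalMap _ h0 fun d x => ?_)
        (matNorm_le_of_forall_evalMap _ h0 fun d x => ?_)
      · exact (le_max_left _ _).trans ((hblock x).symm.trans_le (matNorm_map_evalMap_le hL _ x))
      · exact (le_max_right _ _).trans ((hblock x).symm.trans_le (matNorm_map_evalMap_le hL _ x))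
  scalarMul_le m n α a β := by
    have h0 := APointed.matNorm_nonneg hL a
    refine matNorm_le_of_forall_evalMap _ (by positivity) fun d x => ?_
    rw [map_scalarMul]
    refine (isOperatorSpace_op.scalarMul_le m n α _ β).trans ?_
    gcongr
    exact matNorm_map_evalMap_le hL a x

theorem isMatrixCone_APointed (hL : IsCompactNCConvex L) : IsMatrixCone (APointed L y) where
  selfAdjoint k a ha := APointed.ext_evalMap fun n x =>
    conjTranspose_eq_of_mem_cone ((mem_cone_APointed_iff a).1 ha n x)
  add_mem k a ha b hb := (mem_cone_APointed_iff _).2 fun n x => by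
    rw [map_add_linear, mem_cone_iff_sesq]
    intro ξ
    rw [sesq_add]
    exact add_nonneg ((mem_cone_iff_sesq _).1 (ha n x) ξ) ((mem_cone_iff_sesq _).1 (hb n x) ξ)
  closed k a h := (mem_cone_APointed_iff _).2 fun n x =>
    mem_cone_of_forall_norm_sub_lt fun ε hε => by
      obtain ⟨b, hb, hab⟩ := h ε hε
      refine ⟨b.map (evalMap x), (mem_cone_APointed_iff b).1 hb n x, ?_⟩
      rw [← map_sub_linear]
      exact (matNorm_map_evalMap_le hL _ x).trans_lt hab
  inter_neg k a := by
    constructor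
    · rintro ⟨h1, h2⟩
      refine APointed.ext_evalMap fun n x => ?_
      have h3 : a.map (evalMap x) = 0 := by
        refine eq_zero_of_sesq_self _ fun ξ => ?_
        have h4 := (mem_cone_iff_sesq _).1 ((mem_cone_APointed_iff a).1 h1 n x) ξ
        have h5 := (mem_cone_iff_sesq _).1 ((mem_cone_APointed_iff (-a)).1 h2 n x) ξ
        rw [← neg_one_smul ℂ a, map_smul_linear, sesq_smul, neg_one_mul, neg_nonneg] at h5
        exact le_antisymm h5 h4
      rw [h3]
      rfl
    · rintro rfl
      have h0 : (0 : Matrix (Fin k) (Fin k) (APointed L y)) ∈ cone (E := APointed L y) k :=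
        (mem_cone_APointed_iff _).2 fun n x => (mem_cone_iff_sesq _).2 fun ξ => by
          have h3 : (0 : Matrix (Fin k) (Fin k) (APointed L y)).map (evalMap x) = 0 := rfl
          rw [h3, sesq_zero]
      rw [neg_zero]
      exact ⟨h0, h0⟩
  conj_mem m k B a ha := (mem_cone_APointed_iff _).2 fun n x => by
    rw [map_scalarMul, mem_cone_iff_sesq]
    intro ξ
    rw [sesq_scalarMul]
    exact (mem_cone_iff_sesq _).1 ((mem_cone_APointed_iff a).1 ha n x) _

theorem norm_normalFunctional_le {H : Type*} [NormedAddCommGroup H] [InnerProductSpace ℂ H]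
    (ξ η : lp (fun _ : ℕ => H) 2) (T : H →L[ℂ] H) :
    ‖normalFunctional ξ η T‖ ≤ ‖T‖ * ∑' k, ‖ξ k‖ * ‖η k‖ := by
  have hs : Summable (fun k => ‖ξ k‖ * ‖η k‖) :=
    lp.summable_mul (by rw [Real.holderConjugate_iff]; norm_num) ξ η
  refine tsum_of_norm_bounded (hs.hasSum.mul_left ‖T‖) fun k => ?_
  refine (norm_inner_le_norm _ _).trans ?_
  have h1 := mul_le_mul_of_nonneg_left (T.le_opNorm (η k)) (norm_nonneg (ξ k))
  linarith

/-- Cauchy sequences converge uniformly on all levels. Compressions pass to the limit, and weak*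
continuity does because each normal functional is norm bounded, so that the scalar functions
converge uniformly. -/
theorem isNormComplete_APointed (hL : IsCompactNCConvex L) : IsNormComplete (APointed L y) := by
  intro f hf
  have hev : ∀ (g : APointed L y) (n : Dim.{w}) (x : L n),
      ‖g.1 n x‖ ≤ matNorm 1 (fun _ _ : Fin 1 => g) := fun g n x =>
    (matNorm_one_eq (g.1 n x)).symm.trans_le
      (matNorm_map_evalMap_le hL (fun _ _ : Fin 1 => g) x)
  have hC : ∀ (n : Dim.{w}) (x : L n), CauchySeq fun k => (f k).1 n x := fun n x => by
    refine Metric.cauchySeq_iff.2 fun ε hε => ?_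
    obtain ⟨N, hN⟩ := hf ε hε
    refine ⟨N, fun k hk l hl => ?_⟩
    rw [dist_eq_norm]
    exact (hev (f k - f l) n x).trans_lt (hN k hk l hl)
  choose g hg using fun n (x : L n) => cauchySeq_tendsto_of_complete (hC n x)
  have hunif : ∀ ε > 0, ∃ N, ∀ k ≥ N, ∀ (n : Dim.{w}) (x : L n), ‖(f k).1 n x - g n x‖ ≤ ε := by
    intro ε hε
    obtain ⟨N, hN⟩ := hf ε hε
    refine ⟨N, fun k hk n x => ?_⟩
    refine le_of_tendsto (tendsto_const_nhds.sub (hg n x)).norm ?_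
    filter_upwards [Filter.eventually_ge_atTop N] with l hl
    exact (hev (f k - f l) n x).trans (hN k hk l hl).le
  have hinner : ∀ (n : Dim.{w}) (x : L n) (ξ η : HSpace n),
      Filter.Tendsto (fun k => ⟪ξ, (f k).1 n x η⟫_ℂ) Filter.atTop (nhds ⟪ξ, g n x η⟫_ℂ) :=
    fun n x ξ η => ((continuous_const.inner
      (ContinuousLinearMap.apply ℂ (HSpace n) η).continuous).tendsto _).comp (hg n x)
  have hgA : g ∈ A L := by
    refine mem_A_of_isometry (fun m n β x z h => ?_) fun n => ?_
    · refine ContinuousLinearMap.ext fun η => ext_inner_left ℂ fun ξ => ?_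
      refine tendsto_nhds_unique (hinner m z ξ η) ?_
      rw [inner_compress]
      refine (hinner n x (β ξ) (β η)).congr fun k => ?_
      rw [(f k).2.1.isometry m n β x z h, inner_compress]
    · refine continuous_weakStar_iff.2 fun ξ η => ?_
      let _ := levelTopology L n
      have hu : TendstoUniformly (fun k x => normalFunctional ξ η ((f k).1 n x))
          (fun x => normalFunctional ξ η (g n x)) Filter.atTop := by
        refine Metric.tendstoUniformly_iff.2 fun ε hε => ?_
        set c := ∑' k, ‖ξ k‖ * ‖η k‖ with hc
        have hc0 : 0 ≤ c := tsum_nonneg fun k => by positivity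
        obtain ⟨N, hN⟩ := hunif (ε / (c + 1)) (by positivity)
        filter_upwards [Filter.eventually_ge_atTop N] with k hk x
        have h1 : normalFunctional ξ η ((f k).1 n x - g n x) =
            normalFunctional ξ η ((f k).1 n x) - normalFunctional ξ η (g n x) := by
          rw [sub_eq_add_neg, ← neg_one_smul ℂ (g n x), normal_add, normal_smul]
          ring
        rw [dist_comm, dist_eq_norm, ← h1]
        refine (norm_normalFunctional_le ξ η _).trans_lt ?_
        rw [← hc]
        have h2 := mul_le_mul_of_nonneg_right (hN k hk n x) hc0
        refine h2.trans_lt ?_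
        rw [div_mul_eq_mul_div, div_lt_iff₀ (by positivity)]
        nlinarith
      exact hu.continuous (Filter.Frequently.of_forall fun k =>
        continuous_weakStar_iff.1 ((f k).2.1.continuous n) ξ η)
  have hgy : g Dim.one y = 0 := by
    refine tendsto_nhds_unique (hg Dim.one y) ?_
    simp only [(f _).2.2]
    exact tendsto_const_nhds
  refine ⟨⟨g, hgA, hgy⟩, fun ε hε => ?_⟩
  obtain ⟨N, hN⟩ := hunif (ε / 2) (by positivity)
  refine ⟨N, fun k hk => ?_⟩
  refine (matNorm_le_of_forall_evalMap _ (by positivity : 0 ≤ ε / 2) fun n x => ?_).trans_lt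
    (by linarith)
  exact (matNorm_one_eq ((f k).1 n x - g n x)).trans_le (hN k hk n x)

theorem isCCP_evalMap (hL : IsCompactNCConvex L) {n : Dim.{w}} (x : L n) :
    IsCCP (evalMap x : APointed L y →ₗ[ℂ] Mat n) :=
  ⟨fun k a => by rw [one_mul]; exact matNorm_map_evalMap_le hL a x,
    ⟨fun _ => rfl, fun k a ha => (mem_cone_APointed_iff a).1 ha n x⟩⟩

/-- The pointed continuous affine nc functions form an operator system. -/
theorem isOperatorSystem_APointed (hL : IsCompactNCConvex L) :
    IsOperatorSystem (APointed L y) where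
  completeMatrixOrdered :=
    { operatorSpace := isOperatorSpace_APointed hL
      star_isometric := fun k a => by
        have key : ∀ a : Matrix (Fin k) (Fin k) (APointed L y),
            matNorm k a.conjTranspose ≤ matNorm k a := fun a =>
          matNorm_le_of_forall_evalMap _ (APointed.matNorm_nonneg hL a) fun n x => by
            rw [map_conjTranspose_evalMap, matNorm_conjTranspose]
            exact matNorm_map_evalMap_le hL a x
        refine le_antisymm (key a) ?_
        simpa using key a.conjTranspose
      complete := isNormComplete_APointed hL
      matrixCone := isMatrixCone_APointed hL }
  inclusion_isometric k a := by
    have hE : IsOperatorSpace (APointed L y) := isOperatorSpace_APointed hL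
    refine le_antisymm (matNorm_inclusion_le hE a) ?_
    -- The points of `L` are among the ccp maps and already attain the uniform norm as a supremum.
    exact le_matNorm_inclusion.{max v (w + 1), w} hE a fun C hC h =>
      matNorm_le_of_forall_evalMap a hC.le fun n x => h n (evalMap x) (isCCP_evalMap hL x)

end PointedFunctions

/-! ### The isomorphisms of `S^♯` with `A(K)` and of `S` with `A(K, z)` -/

section Representation

theorem isCompleteOrderIso_of_iff {E F : Type*} [AddCommGroup E] [Module ℂ E] [AddCommGroup F]
    [Module ℂ F] [Star E] [Star F] [MatrixCone E] [MatrixCone F] (e : E ≃ₗ[ℂ] F)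
    (h1 : ∀ x, e (star x) = star (e x))
    (h2 : ∀ (n : ℕ) (x : Matrix (Fin n) (Fin n) E), x ∈ cone (E := E) n ↔
      x.map e ∈ cone (E := F) n) : IsCompleteOrderIso e := by
  refine ⟨⟨h1, fun n x hx => (h2 n x).1 hx⟩, ⟨fun x => ?_, fun n x hx => (h2 n _).2 ?_⟩⟩
  · refine e.injective ?_
    rw [h1]
    simp
  · have h3 : (x.map (e.symm : F →ₗ[ℂ] E)).map e = x := by
      ext1 i j
      simp
    rwa [h3]

variable {S : Type u} [AddCommGroup S] [Module ℂ S] [StarAddMonoid S] [StarModule ℂ S]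
  [MatrixNorm S] [MatrixCone S]

/-- The function `ŝ` on the nc quasistate space for an element `s` of an operator system. -/
def evalFun (s : S) : A (quasistateSpace.{u, w} S) := ⟨fun _ x => x.1 s, eval_mem_A s⟩

/-- The function `ŝ` on the nc quasistate space for an element `s` of the partial unitization. -/
def evalUnitization : Unitization ℂ S →ₗ[ℂ] A (quasistateSpace.{u, w} S) where
  toFun s := evalFun s.snd + s.fst • (1 : A (quasistateSpace.{u, w} S))
  map_add' s t := Subtype.ext (funext fun _ => funext fun x => map_add (sharpMap x.1) s t)
  map_smul' c s := Subtype.ext (funext fun _ => funext fun x => map_smul (sharpMap x.1) c s)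

theorem evalUnitization_apply (s : Unitization ℂ S) (n : Dim.{w})
    (x : quasistateSpace.{u, w} S n) : (evalUnitization s).1 n x = sharpMap x.1 s := rfl

theorem eq_zero_of_forall_eval_eq_zero (hS : IsOperatorSystem S) {s : S}
    (h : ∀ x : quasistateSpace.{u, w} S Dim.one, x.1 s = 0) : s = 0 := by
  have hE := hS.completeMatrixOrdered.operatorSpace
  have h1 := matNorm_one_le_of_coef_le.{u, w} hS s le_rfl fun x => by simp [h x, coef]
  rw [mul_zero] at h1
  have h2 := (hE.eq_zero_iff 1 _).1 (le_antisymm h1 (hE.matNorm_nonneg _))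
  exact congrFun (congrFun h2 0) 0

/-- The zero quasistate sees only the scalar part; once that vanishes, the quasistates separate the
points of `S`. -/
theorem evalUnitization_injective (hS : IsOperatorSystem S) :
    Function.Injective (evalUnitization.{u, w} (S := S)) := by
  refine (injective_iff_map_eq_zero _).2 fun s hs => ?_
  have h : ∀ (n : Dim.{w}) (x : quasistateSpace.{u, w} S n), x.1 s.snd + s.fst • 1 = 0 :=
    fun n x => congrFun (congrFun (congrArg Subtype.val hs) n) x
  have h0 : s.fst = 0 := by
    have h1 : coef ((0 : Mat Dim.one.{w}) + s.fst • 1) = 0 := by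
      have : (0 : Mat Dim.one.{w}) + s.fst • 1 = 0 := h Dim.one (zeroQuasistate hS)
      rw [this]
      simp [coef]
    simpa [coef, inner_smul_right, inner_self_eq_norm_sq_to_K, norm_unitVec] using h1
  refine Unitization.ext h0 (eq_zero_of_forall_eval_eq_zero.{u, w} hS fun x => ?_)
  simpa [h0] using h Dim.one x

/-- Subtracting the constant `a(z)` leaves a pointed function, which is evaluation at an element of
`S`. -/
theorem evalUnitization_surjective (hS : IsOperatorSystem S) :
    Function.Surjective (evalUnitization.{u, w} (S := S)) := by
  intro a
  set c := coef (a.1 Dim.one (zeroQuasistate hS)) with hc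
  obtain ⟨s, hs⟩ := exists_eq_eval hS (a - c • 1) (coef_injective (by
    change coef (a.1 Dim.one (zeroQuasistate hS) - c • (1 : Mat Dim.one.{w})) = coef 0
    rw [sub_eq_add_neg, ← neg_smul, coef_add, coef_smul, ← hc]
    simp [coef, inner_self_eq_norm_sq_to_K, norm_unitVec]))
  refine ⟨Unitization.inl c + Unitization.inr s, Subtype.ext (funext fun n => funext fun x => ?_)⟩
  have h1 : a.1 n x - c • (1 : Mat n) = x.1 s := hs n x
  rw [evalUnitization_apply, sharpMap_apply]
  simp [← h1]

/-- The representation of the partial unitization of an operator system by continuous affine nc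
functions. -/
def evalUnitizationEquiv (hS : IsOperatorSystem S) :
    Unitization ℂ S ≃ₗ[ℂ] A (quasistateSpace.{u, w} S) :=
  LinearEquiv.ofBijective evalUnitization
    ⟨evalUnitization_injective hS, evalUnitization_surjective hS⟩

theorem evalUnitization_star (s : Unitization ℂ S) :
    evalUnitization.{u, w} (star s) = star (evalUnitization.{u, w} s) := by
  refine Subtype.ext (funext fun n => funext fun x => ?_)
  change x.1 (star s).snd + (star s).fst • (1 : Mat n) = star (x.1 s.snd + s.fst • (1 : Mat n))
  rw [Unitization.snd_star, Unitization.fst_star, x.2.2.map_star, star_add, star_smul, star_one]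

theorem evalUnitization_one : evalUnitization.{u, w} (1 : Unitization ℂ S) = 1 := by
  refine Subtype.ext (funext fun n => funext fun x => ?_)
  rw [evalUnitization_apply, sharpMap_apply]
  simp
  rfl

/-- Both cones test all quasistates. Self-adjointness in `S^♯` comes for free: it holds for positive
operators at each point, and evaluation is injective. -/
theorem mem_cone_unitization_iff_evalUnitization (hS : IsOperatorSystem S) {n : ℕ}
    (s : Matrix (Fin n) (Fin n) (Unitization ℂ S)) : s ∈ cone (E := Unitization ℂ S) n ↔
      s.map evalUnitization.{u, w} ∈ cone (E := A (quasistateSpace.{u, w} S)) n := by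
  rw [mem_cone_unitization_iff_forall_dim.{u, w} hS.completeMatrixOrdered.operatorSpace]
  refine ⟨fun h d x => h.2 d x.1 x.2, fun h => ⟨?_, fun d φ hφ => h d ⟨φ, hφ⟩⟩⟩
  ext1 i j
  refine evalUnitization_injective.{u, w} hS (Subtype.ext (funext fun d => funext fun x => ?_))
  rw [Matrix.conjTranspose_apply, evalUnitization_star]
  exact congrFun (congrFun (conjTranspose_eq_of_mem_cone (h d x)) i) j

theorem isCompleteOrderIso_evalUnitizationEquiv (hS : IsOperatorSystem S) :
    IsCompleteOrderIso (evalUnitizationEquiv.{u, w} hS) :=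
  isCompleteOrderIso_of_iff _ evalUnitization_star fun _ s =>
    mem_cone_unitization_iff_evalUnitization hS s

/-- The representation of an operator system by pointed continuous affine nc functions. -/
def evalPointed (hS : IsOperatorSystem S) :
    S ≃ₗ[ℂ] APointed (quasistateSpace.{u, w} S) (zeroQuasistate hS) :=
  LinearEquiv.ofBijective
    { toFun := fun s => ⟨fun _ x => x.1 s, eval_mem_A s, rfl⟩
      map_add' := fun s t => Subtype.ext (funext fun _ => funext fun x => map_add x.1 s t)
      map_smul' := fun c s => Subtype.ext (funext fun _ => funext fun x => map_smul x.1 c s) }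
    ⟨(injective_iff_map_eq_zero _).2 fun _ hs => eq_zero_of_forall_eval_eq_zero.{u, w} hS fun x =>
        congrFun (congrFun (congrArg Subtype.val hs) Dim.one) x,
      fun a => by
        obtain ⟨s, hs⟩ := exists_eq_eval hS (APointed.toA a) a.2.2
        exact ⟨s, Subtype.ext (funext fun n => funext fun x => (hs n x).symm)⟩⟩

theorem toA_evalPointed (hS : IsOperatorSystem S) (s : S) :
    APointed.toA (evalPointed.{u, w} hS s) = evalUnitization (inclusion S s) := by
  refine Subtype.ext (funext fun n => funext fun x => ?_)
  change x.1 s = x.1 s + (0 : ℂ) • (1 : Mat n)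
  rw [zero_smul, add_zero]

/-- One inequality is contractivity of quasistates; the other is the defining property of an
operator system, that they norm `S`. -/
theorem isCompletelyIsometric_evalPointed (hS : IsOperatorSystem S) :
    IsCompletelyIsometric
      (evalPointed hS : S →ₗ[ℂ] APointed (quasistateSpace.{u, w} S) (zeroQuasistate hS)) := by
  have hE := hS.completeMatrixOrdered.operatorSpace
  have hK := isCompactNCConvex_quasistateSpace.{u, w} hE
  intro n s
  refine le_antisymm ?_ ?_
  · exact matNorm_le_of_forall_evalMap _ (hE.matNorm_nonneg s) fun d x =>
      IsCCP.matNorm_map_le x.2 s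
  · refine (hS.inclusion_isometric n s).symm.trans_le ?_
    refine matNorm_inclusion_le_of_forall.{u, w} hE s (APointed.matNorm_nonneg hK _)
      fun d φ hφ => ?_
    exact matNorm_map_evalMap_le hK (s.map (evalPointed.{u, w} hS))
      (⟨φ, hφ⟩ : quasistateSpace.{u, w} S d)

/-- Pointwise positivity only gives positivity in `S^♯`, i.e. under all ccp maps. Returning to the
given cone of `S` is the Hahn-Banach step `mem_cone_of_forall_isCCP`. -/
theorem mem_cone_iff_evalPointed (hS : IsOperatorSystem S) {n : ℕ}
    (s : Matrix (Fin n) (Fin n) S) : s ∈ cone (E := S) n ↔ s.map (evalPointed.{u, w} hS) ∈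
      cone (E := APointed (quasistateSpace.{u, w} S) (zeroQuasistate hS)) n := by
  have hE := hS.completeMatrixOrdered.operatorSpace
  refine ⟨fun hs d x => x.2.2.map_cone n s hs, fun h => ?_⟩
  have h1 : s.map (inclusion S) ∈ cone (E := Unitization ℂ S) n := by
    rw [mem_cone_unitization_iff_evalUnitization.{u, w} hS]
    have h2 : (s.map (inclusion S)).map evalUnitization.{u, w} =
        (s.map (evalPointed.{u, w} hS)).map APointed.toA := by
      ext1 i j
      exact (toA_evalPointed hS (s i j)).symm
    rw [h2]
    exact h
  refine mem_cone_of_forall_isCCP hE hS.completeMatrixOrdered.matrixCone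
    hS.completeMatrixOrdered.star_isometric ?_ fun φ hφ => ?_
  · exact ((mem_cone_unitization_iff _).1 h1).1
  · have h2 := map_sharpMap_mem_cone h1 hφ
    have h3 : (s.map (inclusion S)).map (sharpMap φ) = s.map φ := by
      ext1 i j
      simp [sharpMap_apply, inclusion]
    rwa [h3] at h2

theorem isCompleteOrderIso_evalPointed (hS : IsOperatorSystem S) :
    IsCompleteOrderIso (evalPointed.{u, w} hS) :=
  isCompleteOrderIso_of_iff _
    (fun s => Subtype.ext (funext fun _ => funext fun x => x.2.2.map_star s))
    fun _ s => mem_cone_iff_evalPointed hS s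

/-- The nc quasistate space of an operator system is a pointed compact nc convex set. -/
theorem isPointedCompactNCConvex_quasistateSpace (hS : IsOperatorSystem S) :
    IsPointedCompactNCConvex (quasistateSpace.{u, w} S) (zeroQuasistate hS) where
  compactNCConvex := isCompactNCConvex_quasistateSpace hS.completeMatrixOrdered.operatorSpace
  quasistate_eq_eval n θ hθ := by
    -- Carried over to `S` by `evalPointed`, the quasistate `θ` is itself the required point of `K`.
    refine ⟨⟨θ ∘ₗ (evalPointed.{u, w} hS : S →ₗ[ℂ] _), fun k s => ?_,
      fun s => ?_, fun k s hs => ?_⟩, fun a => ?_⟩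
    · rw [one_mul, ← isCompletelyIsometric_evalPointed.{u, w} hS k s]
      exact hθ.matNorm_map_le (s.map (evalPointed.{u, w} hS))
    · rw [LinearMap.comp_apply, LinearMap.comp_apply, ← hθ.2.map_star]
      exact congrArg θ ((isCompleteOrderIso_evalPointed hS).1.map_star s)
    · exact hθ.2.map_cone k _ ((mem_cone_iff_evalPointed hS s).1 hs)
    · obtain ⟨s, rfl⟩ := (evalPointed.{u, w} hS).surjective a
      rfl

end Representation

/-! ### Affine nc maps through their coordinate functions -/

section Homeomorphism

variable {V : Type v} [AddCommGroup V] [Module ℂ V] [MatrixNorm V] {L : NCSet.{v, w} V}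

/-- The point-weak* topology is initial for the evaluations, and direct sums and compressions are
tested at each vector, so it is enough that every coordinate function is nc affine. -/
theorem isContinuousAffineNCMap_of_isometry {W : Type*} [AddCommGroup W] [Module ℂ W]
    {K : ∀ n : Dim.{w}, Set (W →ₗ[ℂ] Mat n)} {θ : ∀ n, L n → K n}
    (h : ∀ s : W, (fun n x => (θ n x).1 s) ∈ A L) : IsContinuousAffineNCMap L K θ where
  directSum I m n α x y hC hα hs s := (h s).directSum I m n α x y hC hα hs
  isometry m n β x y hxy := LinearMap.ext fun s => (h s).isometry m n β x y hxy
  continuous n := by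
    rw [continuous_induced_rng, continuous_iInf_rng]
    exact fun s => continuous_induced_rng.2 ((h s).continuous n)

theorem comp_mem_A {W : Type*} [AddCommGroup W] [Module ℂ W] [MatrixNorm W]
    {K : ∀ n : Dim.{w}, Set (W →ₗ[ℂ] Mat n)} {θ : ∀ n, L n → K n}
    (hθ : IsContinuousAffineNCMap L K θ) {a : ∀ n, K n → Mat n} (ha : IsContinuousAffineNCFun K a) :
    (fun n x => a n (θ n x)) ∈ A L :=
  mem_A_of_isometry
    (fun m n β x y h => ha.isometry m n β (θ n x) (θ m y) (hθ.isometry m n β x y h))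
    fun n => @Continuous.comp _ _ _ (levelTopology L n) (levelTopology K n)
      (weakStarTopology (HSpace n)) _ _ (ha.continuous n) (hθ.continuous n)

end Homeomorphism

/-! ### Pointed compact nc convex sets are quasistate spaces -/

section Characterization

variable {V : Type v} [AddCommGroup V] [Module ℂ V] [MatrixNorm V] {L : NCSet.{v, w} V}

/-- The pointed function `x ↦ x(v) - y(v) 1`. -/
def centeredEval (y : L Dim.one) (s : V) : APointed L y :=
  ⟨fun _ x => x.1 s - coef (y.1 s) • 1,
    (A L).sub_mem (eval_mem_A s) ((A L).smul_mem _ (1 : A L).2), coef_injective (by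
      change coef (y.1 s - coef (y.1 s) • (1 : Mat Dim.one.{w})) = coef 0
      rw [sub_eq_add_neg, ← neg_smul, coef_add, coef_smul]
      simp [coef, inner_self_eq_norm_sq_to_K, norm_unitVec])⟩

theorem centeredEval_apply (y : L Dim.one) (s : V) (n : Dim.{w}) (x : L n) :
    (centeredEval y s).1 n x = x.1 s - coef (y.1 s) • 1 := rfl

/-- The points of a pointed compact nc convex set are the quasistates of its pointed functions. -/
def evalQuasistate {y : L Dim.one} (hL : IsPointedCompactNCConvex L y) (n : Dim.{w}) :
    L n ≃ quasistateSpace.{max v (w + 1), w} (APointed L y) n :=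
  Equiv.ofBijective (fun x => ⟨evalMap x, isCCP_evalMap hL.compactNCConvex x⟩)
    ⟨fun x x' h => Subtype.ext (LinearMap.ext fun s => by
        have h1 := LinearMap.congr_fun (congrArg Subtype.val h) (centeredEval y s)
        exact sub_left_injective h1),
      fun ψ => by
        obtain ⟨x, hx⟩ := hL.quasistate_eq_eval n ψ.1 ψ.2
        exact ⟨x, Subtype.ext (LinearMap.ext fun a => (hx a).symm)⟩⟩

theorem evalQuasistate_apply {y : L Dim.one} (hL : IsPointedCompactNCConvex L y) {n : Dim.{w}}
    (x : L n) (a : APointed L y) : (evalQuasistate hL n x).1 a = a.1 n x := rfl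

/-- Evaluation at `s` need not vanish at `y`, hence the centring. The formula shows that the
coordinates of the inverse are evaluations plus constants, so the inverse is continuous and affine.
-/
theorem evalQuasistate_symm_apply {y : L Dim.one} (hL : IsPointedCompactNCConvex L y)
    {n : Dim.{w}} (ψ : quasistateSpace.{max v (w + 1), w} (APointed L y) n) (s : V) :
    ((evalQuasistate hL n).symm ψ).1 s = ψ.1 (centeredEval y s) + coef (y.1 s) • 1 := by
  obtain ⟨x, rfl⟩ := (evalQuasistate hL n).surjective ψ
  rw [Equiv.symm_apply_apply, evalQuasistate_apply, centeredEval_apply, sub_add_cancel]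

theorem IsPointedCompactNCConvex.homeomorphic {y : L Dim.one}
    (hL : IsPointedCompactNCConvex L y) :
    PointedlyAffinelyHomeomorphic L y (quasistateSpace.{max v (w + 1), w} (APointed L y))
      (zeroQuasistate (isOperatorSystem_APointed hL.compactNCConvex)) := by
  refine ⟨evalQuasistate hL, isContinuousAffineNCMap_of_isometry fun a => a.2.1,
    isContinuousAffineNCMap_of_isometry fun s => ?_, Subtype.ext (LinearMap.ext fun a => a.2.2)⟩
  simp only [evalQuasistate_symm_apply]
  exact (A _).add_mem (eval_mem_A (centeredEval y s)) ((A _).smul_mem _ (1 : A _).2)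

section Pullback

variable {W : Type u} [AddCommGroup W] [Module ℂ W] [MatrixNorm W] {K : NCSet.{u, w} W}

/-- Composition with a continuous affine nc map. -/
def pullback {θ : ∀ n, L n → K n} (hθ : IsContinuousAffineNCMap L K θ) {y : L Dim.one}
    {z : K Dim.one} (h : θ Dim.one y = z) : APointed K z →ₗ[ℂ] APointed L y where
  toFun a := ⟨fun n x => a.1 n (θ n x), comp_mem_A hθ a.2.1, (congrArg _ h).trans a.2.2⟩
  map_add' _ _ := rfl
  map_smul' _ _ := rfl

theorem pullback_apply {θ : ∀ n, L n → K n} (hθ : IsContinuousAffineNCMap L K θ) {y : L Dim.one}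
    {z : K Dim.one} (h : θ Dim.one y = z) (a : APointed K z) (n : Dim.{w}) (x : L n) :
    (pullback hθ h a).1 n x = a.1 n (θ n x) := rfl

/-- A pulled back function takes only values of the original one, so neither norms nor positivity
can get worse. -/
theorem IsCCP.comp_pullback (hK : IsCompactNCConvex K) {θ : ∀ n, L n → K n}
    (hθ : IsContinuousAffineNCMap L K θ) {y : L Dim.one} {z : K Dim.one} (h : θ Dim.one y = z)
    {n : Dim.{w}} {χ : APointed L y →ₗ[ℂ] Mat n} (hχ : IsCCP χ) : IsCCP (χ ∘ₗ pullback hθ h) := by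
  refine ⟨fun k a => ?_, fun a => ?_, fun k a ha => ?_⟩
  · rw [one_mul]
    refine (hχ.matNorm_map_le (a.map (pullback hθ h))).trans ?_
    exact matNorm_le_of_forall_evalMap _ (APointed.matNorm_nonneg hK a) fun d x =>
      matNorm_map_evalMap_le hK a (θ d x)
  · exact hχ.2.map_star (pullback hθ h a)
  · exact hχ.2.map_cone k (a.map (pullback hθ h)) fun d x => ha d (θ d x)

/-- A quasistate of `A(L, y)`, composed with the pullback along the homeomorphism, is evaluation at
some `x ∈ K`; on `L` it is then evaluation at the preimage of `x`. -/
theorem IsPointedCompactNCConvex.of_homeomorphic {y : L Dim.one} {z : K Dim.one}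
    (hL : IsCompactNCConvex L) (hK : IsPointedCompactNCConvex K z)
    (h : PointedlyAffinelyHomeomorphic L y K z) : IsPointedCompactNCConvex L y where
  compactNCConvex := hL
  quasistate_eq_eval n χ hχ := by
    obtain ⟨θ, h1, h2, h3⟩ := h
    obtain ⟨x, hx⟩ := hK.quasistate_eq_eval n _ (hχ.comp_pullback hK.compactNCConvex h1 h3)
    refine ⟨(θ n).symm x, fun a => ?_⟩
    have h4 : pullback h1 h3 (pullback h2 ((Equiv.symm_apply_eq _).2 h3.symm) a) = a := by
      refine Subtype.ext (funext fun d => funext fun x => ?_)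
      rw [pullback_apply, pullback_apply, Equiv.symm_apply_apply]
    have h5 := hx (pullback h2 ((Equiv.symm_apply_eq _).2 h3.symm) a)
    rwa [LinearMap.comp_apply, h4] at h5

end Pullback

end Characterization

end

end NCDuality

theorem mainTheorem1 {S : Type u} [AddCommGroup S] [Module ℂ S] [StarAddMonoid S] [StarModule ℂ S]
    [MatrixNorm S] [MatrixCone S] (hS : IsOperatorSystem S) :
    -- the map `s ↦ ŝ` is a unital complete order isomorphism from `S^♯` onto `A(K)` ...
    (∃ Φ : Unitization ℂ S ≃ₗ[ℂ] A (quasistateSpace.{u, w} S),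
      (∀ (s : Unitization ℂ S) (n : Dim.{w}) (x : quasistateSpace.{u, w} S n),
        (Φ s).1 n x = sharp x.1 s) ∧
      Φ 1 = 1 ∧ IsCompleteOrderIso Φ ∧
      -- ... which restricts to a completely isometric complete order isomorphism from `S` onto
      -- `A(K, z)`
      ∃ Ψ : S ≃ₗ[ℂ] APointed (quasistateSpace.{u, w} S) (zeroQuasistate hS),
        (∀ s : S, APointed.toA (Ψ s) = Φ (inclusion S s)) ∧
        IsCompletelyIsometric
          (Ψ : S →ₗ[ℂ] APointed (quasistateSpace.{u, w} S) (zeroQuasistate hS)) ∧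
        IsCompleteOrderIso Ψ) ∧
    -- `(K, z)` is a pointed compact nc convex set
    IsPointedCompactNCConvex (quasistateSpace.{u, w} S) (zeroQuasistate hS) ∧
    -- a pair `(L, y)` is pointed if and only if it is the nc quasistate space of an operator system
    (∀ (V : Type v) [AddCommGroup V] [Module ℂ V] [MatrixNorm V], IsOperatorSpace V →
      IsNormComplete V → ∀ (L : NCSet.{v, w} V) (y : L Dim.one), IsCompactNCConvex L →
      (IsPointedCompactNCConvex L y ↔
        ∃ (T : Type (max v (w + 1))) (_ : AddCommGroup T) (_ : Module ℂ T) (_ : StarAddMonoid T)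
          (_ : StarModule ℂ T) (_ : MatrixNorm T) (_ : MatrixCone T) (hT : IsOperatorSystem T),
          PointedlyAffinelyHomeomorphic L y (quasistateSpace T) (zeroQuasistate hT))) := by
  refine ⟨⟨evalUnitizationEquiv hS, fun s n x => rfl, evalUnitization_one,
    isCompleteOrderIso_evalUnitizationEquiv hS, evalPointed hS, toA_evalPointed hS,
    isCompletelyIsometric_evalPointed hS, isCompleteOrderIso_evalPointed hS⟩,
    isPointedCompactNCConvex_quasistateSpace hS, fun V _ _ _ _ _ L y hL => ⟨fun h => ?_, ?_⟩⟩
  -- Functions on `L` range over all dimensions, which accounts for the universe `max v (w + 1)` of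
  -- the operator system.
  · exact ⟨APointed L y, _, _, _, inferInstance, _, _, _, h.homeomorphic⟩
  · rintro ⟨T, _, _, _, _, _, _, hT, h⟩
    exact .of_homeomorphic hL (isPointedCompactNCConvex_quasistateSpace hT) h
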